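/- **Setting.** Let $\Bbbk$ be $\mathbb R$ or $\mathbb C$ and let $V=\bigoplus_{k\in\mathbb Z}V_k$ be a graded vector space with every $V_k$ finite-dimensional. Let $\omega$ be an odd symplectic form of degree $-1$ on $V$ (bilinear, $\omega(V_i,V_j)=0$ unless $i+j=1$, graded-antisymmetric, nondegenerate) and $Q$ a differential of degree $1$ with $\omega(Q\otimes 1+1\otimes Q)=0$. Let $V=H\oplus B\oplus C$ be a Hodge decomposition: $B=\operatorname{Im}Q$, $C$ is a complement of $\operatorname{Ker}Q$, $H$ is a complement of $B$ in $\operatorname{Ker}Q$, $\omega(H,B\oplus C)=0$, $\omega$ is nondegenerate on $H$ and on $B\oplus C$, and $\omega|_B=0$, $\omega|_C=0$. Choose homogeneous bases $(a_i)$ of $H$, $(b_k)$ of $B$, $(c_i)$ of $C$; together they form a basis $(e_i)$ of $V$, with dual basis $(\phi^i)$ of the graded dual $V^*$, consisting of $\alpha^i,\beta^k,\gamma^i$. Let $(\omega^{ij})$ be the inverse of the matrix $(\omega(e_i,e_j))$, and let $Q c_i=\sum_k Q_i^k b_k$. The space of formal functions is $\mathrm{Fun}(V)=\prod_{g\ge0,n\ge0}\hbar^g(V^*)^{\odot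 n}$. A term in $\hbar^g(V^*)^{\odot n}$ has genus $g$, polynomial degree $n$ and weight $2g+n$, and $\mathrm{Fun}_+(V)=\prod_{w\ge1}\bigoplus_{2g+n=w}\hbar^g(V^*)^{\odot n}$ (with $g\in\mathbb Z$, $n\ge 0$). Infinite sums below are taken weight by weight. With graded left and right derivatives put $$\Delta F=\tfrac12\sum_{i,j}(-1)^{|\phi^i|}\omega^{ij}\frac{\partial_L^2F}{\partial\phi^i\partial\phi^j},\qquad \{F,G\}=\sum_{i,j}\frac{\partial_RF}{\partial\phi^i}\,\omega^{ij}\,\frac{\partial_LG}{\partial\phi^j}.$$ Let $S\in\mathrm{Fun}(V)$ have degree $0$, be at least quadratic in genus $0$ and at least linear in genus $1$, and satisfy the quantum master equation $\hbar\Delta S+\tfrac12\{S,S\}=0$. Write $S=S_{\mathrm{free}}+S_{\mathrm{int}}$, where $S_{\mathrm{free}}$ is the part of genus $0$ and polynomial degree $2$, and assume that $Q$ is the differential encoded by $S$: $S_{\mathrm{free}}=\frac12\sum_{i,j}(-1)^{|e_i|}\omega(e_i,Qe_j)\phi^i\phi^j$. Let $P$ be the restriction of functions from $V$ to $H$ ($\alpha^i\mapsto\alpha^i$,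 $\beta^k,\gamma^i\mapsto0$) and $$K(x)=\frac1{\#_{\beta+\gamma}}\sum_{k,i}\beta^k(Q^{-1})_k^i\frac{\partial_Lx}{\partial\gamma^i},$$ where $\#_{\beta+\gamma}$ is the number of variables $\beta,\gamma$ in a monomial and $K$ is $0$ where this number is $0$. Put $\delta_1=\hbar\Delta$, $\delta_2=\hbar\Delta+\{S_{\mathrm{int}},-\}$ and $P_r=P(1-\delta_rK)^{-1}=P\sum_{n\ge0}(\delta_rK)^n$ for $r=1,2$. Let $W=\hbar\log P_1(e^{S_{\mathrm{int}}/\hbar})$ be the effective action and $$Z(f)=e^{-W/\hbar}\,P_1\big(f\,e^{S_{\mathrm{int}}/\hbar}\big)$$ the normalized path integral. **Theorem.** 1. $W/\hbar\in\mathrm{Fun}_+(H)$ and $e^{W/\hbar}=P_1(e^{S_{\mathrm{int}}/\hbar})$. 2. For every $f\in\mathrm{Fun}(V)\cup\mathrm{Fun}_+(V)$ the series $\sum_n(\delta_1K)^n(f e^{S_{\mathrm{int}}/\hbar})$ and $\sum_n(\delta_2K)^n(f)$ converge (in each weight only finitely many of their terms are nonzero, and the weights are bounded below), and $$Z(f)=P_2(f).$$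 3. $Z$ maps $\mathrm{Fun}_+(V)$ to $\mathrm{Fun}_+(H)$. 4. $Z$ maps $\mathrm{Fun}(V)$ to $\mathrm{Fun}(H)$. -/

import Mathlib

noncomputable section

namespace BV

open Classical in
/-- `1` on the diagonal, `0` elsewhere. -/
def delta (R : Type*) [Zero R] [One R] {α : Type*} (i j : α) : R := if i = j then 1 else 0

open Classical in
/-- The (two-sided) inverse of a possibly infinite matrix; all sums occurring below for degreewise
finite-dimensional spaces are finite. The value is `0` if there is no inverse. -/
def invMatrix {𝕜 α β : Type*} [Field 𝕜] (M : α → β → 𝕜) : β → α → 𝕜 :=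
  if h : ∃ N : β → α → 𝕜,
      (∀ i k, ∑ᶠ j, M i j * N j k = delta 𝕜 i k) ∧ (∀ j l, ∑ᶠ i, N j i * M i l = delta 𝕜 j l)
  then h.choose else 0

/-! ### Linear algebra: dg symplectic vector spaces and Hodge decompositions -/

section Linear

variable {𝕜 V : Type*} [Field 𝕜] [AddCommGroup V] [Module 𝕜 V]

/-- An odd symplectic form of degree `-1` on the graded vector space `V = ⨁ 𝒱 d`: it vanishes on
`𝒱 i × 𝒱 j` unless `i + j - 1 = 0`, is graded-antisymmetric and nondegenerate. -/
structure IsOddSymplectic (𝒱 : ℤ → Submodule 𝕜 V) (ω : V →ₗ[𝕜] V →ₗ[𝕜] 𝕜) : Prop where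
  degree : ∀ i j, ∀ x ∈ 𝒱 i, ∀ y ∈ 𝒱 j, i + j ≠ 1 → ω x y = 0
  antisymm : ∀ i j, ∀ x ∈ 𝒱 i, ∀ y ∈ 𝒱 j, ω x y = -((-1 : 𝕜) ^ (i * j) * ω y x)
  nondegenerate : ∀ x, (∀ y, ω x y = 0) → x = 0

/-- `(V, ω, Q)` is a dg symplectic vector space: `Q` is a differential of degree `1` with
`ω (1 ⊗ Q + Q ⊗ 1) = 0`. -/
structure IsDGSymplectic (𝒱 : ℤ → Submodule 𝕜 V) (ω : V →ₗ[𝕜] V →ₗ[𝕜] 𝕜)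
    (Q : V →ₗ[𝕜] V) : Prop extends IsOddSymplectic 𝒱 ω where
  map_degree : ∀ i, ∀ x ∈ 𝒱 i, Q x ∈ 𝒱 (i + 1)
  sq_zero : ∀ x, Q (Q x) = 0
  compat : ∀ i, ∀ x ∈ 𝒱 i, ∀ y, ω (Q x) y + (-1 : 𝕜) ^ i * ω x (Q y) = 0

/-- A Hodge decomposition `V = H ⊕ B ⊕ C`, where `B = range Q`: the space `C` is a complement of
`ker Q`, `H` is a complement of `B` in `ker Q`, the form `ω` is block diagonal with respect to
`V = H ⊕ (B ⊕ C)`, nondegenerate on `H` and on `B ⊕ C`, and `B`, `C` are Lagrangian in `B ⊕ C`. -/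
structure IsHodgeDecomposition (ω : V →ₗ[𝕜] V →ₗ[𝕜] 𝕜) (Q : V →ₗ[𝕜] V)
    (H C : Submodule 𝕜 V) : Prop where
  compl_ker : IsCompl (LinearMap.ker Q) C
  disjoint : Disjoint H (LinearMap.range Q)
  sup_eq : H ⊔ LinearMap.range Q = LinearMap.ker Q
  nondegenerate_H : ∀ x ∈ H, (∀ y ∈ H, ω x y = 0) → x = 0
  nondegenerate_BC : ∀ x ∈ LinearMap.range Q ⊔ C,
    (∀ y ∈ LinearMap.range Q ⊔ C, ω x y = 0) → x = 0
  lagrangian_B : ∀ x ∈ LinearMap.range Q, ∀ y ∈ LinearMap.range Q, ω x y = 0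
  lagrangian_C : ∀ x ∈ C, ∀ y ∈ C, ω x y = 0
  orthogonal : ∀ x ∈ H, ∀ y ∈ LinearMap.range Q ⊔ C, ω x y = 0

variable {ιH ιB ιC : Type*} {H B C : Submodule 𝕜 V}

/-- The family `(a_i), (b_j), (c_k)` of vectors of `V` assembled from bases of `H`, `B`, `C`. -/
def assemble (a : Module.Basis ιH 𝕜 H) (b : Module.Basis ιB 𝕜 B) (c : Module.Basis ιC 𝕜 C) :
    ιH ⊕ ιB ⊕ ιC → V :=
  Sum.elim (fun i => (a i : V)) (Sum.elim (fun j => (b j : V)) (fun k => (c k : V)))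

/-- The matrix `Q_i^k` of `Q : C → B`, that is, `Q c_i = ∑ k, Q_i^k b_k`. -/
def matrixQ (Q : V →ₗ[𝕜] V) (b : Module.Basis ιB 𝕜 (LinearMap.range Q))
    (c : Module.Basis ιC 𝕜 C) (i : ιC) (k : ιB) : 𝕜 :=
  b.repr (Q.rangeRestrict (c i)) k

end Linear

/-! ### Graded-commutative polynomials

For a family of degrees `p : ι → ℤ`, `Pol 𝕜 p` is the free graded-commutative algebra on generators
`X i` of degree `p i`. If `p i = -|e_i|` for a homogeneous basis `e` of `V`, then `X i` stands for
the dual basis vector `φ^i` and `Pol 𝕜 p` is the symmetric algebra `⨁ n, (V^*)^{⊙ n}` of the graded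
dual of `V`. -/

section Pol

variable (𝕜 : Type*) [Field 𝕜] {ι : Type*}

/-- The relations `x_i x_j = (-1)^{|x_i||x_j|} x_j x_i`. -/
inductive PolRel (p : ι → ℤ) : FreeAlgebra 𝕜 ι → FreeAlgebra 𝕜 ι → Prop
  | comm (i j : ι) : PolRel p (FreeAlgebra.ι 𝕜 i * FreeAlgebra.ι 𝕜 j)
      ((-1 : 𝕜) ^ (p i * p j) • (FreeAlgebra.ι 𝕜 j * FreeAlgebra.ι 𝕜 i))

/-- The free graded-commutative algebra on generators of degrees `p i`. -/
abbrev Pol (p : ι → ℤ) : Type _ := RingQuot (PolRel 𝕜 p)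

variable {𝕜}
variable {p : ι → ℤ}

/-- The generators. -/
def X (p : ι → ℤ) (i : ι) : Pol 𝕜 p := RingQuot.mkAlgHom 𝕜 (PolRel 𝕜 p) (FreeAlgebra.ι 𝕜 i)

theorem X_mul_X (i j : ι) :
    (X p i * X p j : Pol 𝕜 p) = (-1 : 𝕜) ^ (p i * p j) • (X p j * X p i) := by
  have := RingQuot.mkAlgHom_rel 𝕜 (PolRel.comm (𝕜 := 𝕜) (p := p) i j)
  simpa [X] using this

/-- The universal property of `Pol 𝕜 p`. -/
def polLift {A : Type*} [Ring A] [Algebra 𝕜 A] (f : ι → A)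
    (hf : ∀ i j, f i * f j = (-1 : 𝕜) ^ (p i * p j) • (f j * f i)) : Pol 𝕜 p →ₐ[𝕜] A :=
  RingQuot.liftAlgHom 𝕜 ⟨FreeAlgebra.lift 𝕜 f, by
    rintro _ _ ⟨i, j⟩
    simpa using hf i j⟩

theorem polLift_X {A : Type*} [Ring A] [Algebra 𝕜 A] (f : ι → A)
    (hf : ∀ i j, f i * f j = (-1 : 𝕜) ^ (p i * p j) • (f j * f i)) (i : ι) :
    polLift f hf (X p i) = f i := by
  simp [polLift, X]

theorem neg_one_zpow_mul_self (n : ℤ) : (-1 : 𝕜) ^ n * (-1 : 𝕜) ^ n = 1 := by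
  rw [← mul_zpow]
  simp

/-- The algebra map `x ↦ ∑ m, x_m T^m` that separates the components `x_m` of weight `m`, where
the generator `X i` has weight `wt i`. -/
def gradeHom {M : Type*} [AddCommMonoid M] (wt : ι → M) :
    Pol 𝕜 p →ₐ[𝕜] AddMonoidAlgebra (Pol 𝕜 p) M :=
  polLift (fun i => AddMonoidAlgebra.single (wt i) (X p i)) (by
    intro i j
    rw [AddMonoidAlgebra.single_mul_single, AddMonoidAlgebra.single_mul_single, X_mul_X,
      add_comm (wt j) (wt i), AddMonoidAlgebra.smul_single])

/-- The component of weight `m`. -/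
def component {M : Type*} [AddCommMonoid M] (wt : ι → M) (m : M) : Pol 𝕜 p →ₗ[𝕜] Pol 𝕜 p :=
  Finsupp.lapply m ∘ₗ (AddMonoidAlgebra.coeffLinearEquiv 𝕜).toLinearMap ∘ₗ
    (gradeHom wt).toLinearMap

/-- The component in `(V^*)^{⊙ n}`. -/
def polyPart (n : ℕ) : Pol 𝕜 p →ₗ[𝕜] Pol 𝕜 p := component (fun _ => 1) n

/-- Multiplication by `1/m` on the component of weight `m`, for every `m`
(and by `0` on the component of weight `0`). -/
def invCount (wt : ι → ℕ) : Pol 𝕜 p →ₗ[𝕜] Pol 𝕜 p :=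
  Finsupp.lsum 𝕜 (fun m : ℕ => (m : 𝕜)⁻¹ • (LinearMap.id : Pol 𝕜 p →ₗ[𝕜] Pol 𝕜 p)) ∘ₗ
    (AddMonoidAlgebra.coeffLinearEquiv 𝕜).toLinearMap ∘ₗ (gradeHom wt).toLinearMap

/-- The algebra map `x ↦ [[σ x, ∂ x], [0, x]]`, where `σ x = (-1)^{|x_i||x|} x` and `∂` is the left
derivative `∂_L/∂x_i`. Multiplicativity is `∂ (x y) = ∂ x * y + (-1)^{|x_i||x|} x * ∂ y`. -/
def leftHom (i : ι) : Pol 𝕜 p →ₐ[𝕜] Matrix (Fin 2) (Fin 2) (Pol 𝕜 p) :=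
  polLift (fun j => !![(-1 : 𝕜) ^ (p i * p j) • X p j, delta (Pol 𝕜 p) i j; 0, X p j]) (by
    intro j k
    have h := X_mul_X (𝕜 := 𝕜) (p := p) j k
    ext r s
    fin_cases r <;> fin_cases s
    · simp only [Matrix.mul_apply, Fin.sum_univ_two]
      simp [h, smul_smul, mul_comm, mul_left_comm, mul_assoc]
    · by_cases hij : i = j <;> by_cases hik : i = k
      · subst hij
        subst hik
        simp [Matrix.mul_apply, Fin.sum_univ_two, delta, smul_add, smul_smul,
          neg_one_zpow_mul_self, add_comm]
      · subst hij
        simp [Matrix.mul_apply, Fin.sum_univ_two, delta, hik, smul_smul, neg_one_zpow_mul_self]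
      · subst hik
        simp [Matrix.mul_apply, Fin.sum_univ_two, delta, hij, mul_comm]
      · simp [Matrix.mul_apply, Fin.sum_univ_two, delta, hij, hik]
    · simp [Matrix.mul_apply, Fin.sum_univ_two]
    · simpa [Matrix.mul_apply, Fin.sum_univ_two] using h)

/-- The algebra map `x ↦ [[x, ∂ x], [0, σ x]]`, where `σ x = (-1)^{|x_i||x|} x` and `∂` is the right
derivative `∂_R/∂x_i`. Multiplicativity is `∂ (x y) = x * ∂ y + (-1)^{|x_i||y|} ∂ x * y`. -/
def rightHom (i : ι) : Pol 𝕜 p →ₐ[𝕜] Matrix (Fin 2) (Fin 2) (Pol 𝕜 p) :=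
  polLift (fun j => !![X p j, delta (Pol 𝕜 p) i j; 0, (-1 : 𝕜) ^ (p i * p j) • X p j]) (by
    intro j k
    have h := X_mul_X (𝕜 := 𝕜) (p := p) j k
    ext r s
    fin_cases r <;> fin_cases s
    · simpa [Matrix.mul_apply, Fin.sum_univ_two] using h
    · by_cases hij : i = j <;> by_cases hik : i = k
      · subst hij
        subst hik
        simp [Matrix.mul_apply, Fin.sum_univ_two, delta, smul_add, smul_smul,
          neg_one_zpow_mul_self, add_comm]
      · subst hij
        simp [Matrix.mul_apply, Fin.sum_univ_two, delta, hik]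
      · subst hik
        simp [Matrix.mul_apply, Fin.sum_univ_two, delta, hij, smul_smul, mul_comm,
          neg_one_zpow_mul_self]
      · simp [Matrix.mul_apply, Fin.sum_univ_two, delta, hij, hik]
    · simp [Matrix.mul_apply, Fin.sum_univ_two]
    · simp only [Matrix.mul_apply, Fin.sum_univ_two]
      simp [h, smul_smul, mul_comm, mul_left_comm, mul_assoc])

/-- The left derivative `∂_L/∂x_i` of graded-commutative polynomials. -/
def polDL (i : ι) : Pol 𝕜 p →ₗ[𝕜] Pol 𝕜 p :=
  Matrix.entryLinearMap 𝕜 (Pol 𝕜 p) 0 1 ∘ₗ (leftHom i).toLinearMap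

/-- The right derivative `∂_R/∂x_i` of graded-commutative polynomials. -/
def polDR (i : ι) : Pol 𝕜 p →ₗ[𝕜] Pol 𝕜 p :=
  Matrix.entryLinearMap 𝕜 (Pol 𝕜 p) 0 1 ∘ₗ (rightHom i).toLinearMap

/-- Restriction of polynomials on `V` to `H`: the algebra map with `α^i ↦ α^i`, `β^j ↦ 0`,
`γ^k ↦ 0`. -/
def polRestrict {ιH ιB ιC : Type*} (p : ιH ⊕ ιB ⊕ ιC → ℤ) :
    Pol 𝕜 p →ₐ[𝕜] Pol 𝕜 (fun i : ιH => p (Sum.inl i)) :=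
  polLift (Sum.elim (fun i => X (fun i : ιH => p (Sum.inl i)) i) (fun _ => 0)) (by
    rintro (i | i) (j | j)
    · exact X_mul_X (p := fun i : ιH => p (Sum.inl i)) i j
    all_goals simp)

end Pol

/-! ### Formal functions

A formal function is a formal sum `∑ ħ^g f_{g,n}` with `f_{g,n} ∈ (V^*)^{⊙ n}`. The part
`ħ^g f_{g,n}` has weight `2 g + n`, and we store the sum as the Laurent series
`∑ t^{2 g + n} f_{g,n}` in an auxiliary central variable `t` with coefficients in `Pol 𝕜 p`.
So `ħ` is `t^2`, the coordinate `φ^i` is `t X_i`, and the elements are the sums with weights bounded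
below that have finitely many parts of each weight. -/

section Fun

variable (𝕜 : Type*) [Field 𝕜] {ι : Type*}

/-- The ambient algebra of formal sums with weights bounded below and finitely many parts of each
weight. -/
abbrev Formal (p : ι → ℤ) : Type _ := HahnSeries ℤ (Pol 𝕜 p)

variable {𝕜}
variable {p : ι → ℤ}

/-- The part of genus `g` and polynomial degree `n`, an element of `(V^*)^{⊙ n}`. -/
def part (g : ℤ) (n : ℕ) (F : Formal 𝕜 p) : Pol 𝕜 p := polyPart n (F.coeff (2 * g + n))

/-- `ħ^g`. -/
def hbar (𝕜 : Type*) [Field 𝕜] {ι : Type*} (p : ι → ℤ) (g : ℤ) : Formal 𝕜 p :=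
  HahnSeries.single (2 * g) 1

/-- `F` is a sum of parts `ħ^g f_{g,n}` where only the pairs `(g, n)` with `cond g n` occur. -/
def HasParts (cond : ℤ → ℕ → Prop) (F : Formal 𝕜 p) : Prop :=
  ∀ (w : ℤ) (n : ℕ), polyPart n (F.coeff w) ≠ 0 → ∃ g : ℤ, w = 2 * g + n ∧ cond g n

/-- The space of formal functions `Fun(V) = ∏_{g ≥ 0, n ≥ 0} (V^*)^{⊙ n} ħ^g`. -/
def Fun (𝕜 : Type*) [Field 𝕜] {ι : Type*} (p : ι → ℤ) : Set (Formal 𝕜 p) :=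
  {F | HasParts (fun g _ => 0 ≤ g) F}

/-- The space of elements of positive weight,
`Fun_+(V) = ∏_{w ≥ 1} ⨁_{2 g + n = w} ħ^g (V^*)^{⊙ n}` with `g ∈ ℤ`, `n ≥ 0`. -/
def FunPos (𝕜 : Type*) [Field 𝕜] {ι : Type*} (p : ι → ℤ) : Set (Formal 𝕜 p) :=
  {F | HasParts (fun g n => 1 ≤ 2 * g + n) F}

/-- `F` is homogeneous of degree `k` for the grading induced from that of `V`
(where `ħ` has degree `0`). -/
def HasDegree (k : ℤ) (F : Formal 𝕜 p) : Prop :=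
  ∀ w, gradeHom p (F.coeff w) = AddMonoidAlgebra.single k (F.coeff w)

/-- A family is summable if its weights are uniformly bounded below and only finitely many members
contribute to each weight. -/
def Summable {α : Type*} (x : α → Formal 𝕜 p) : Prop :=
  (⋃ a, (x a).support).IsPWO ∧ ∀ w, {a | (x a).coeff w ≠ 0}.Finite

open Classical in
/-- The sum of a summable family, weight by weight. -/
def formalSum {α : Type*} (x : α → Formal 𝕜 p) : Formal 𝕜 p :=
  if h : Summable x then HahnSeries.SummableFamily.hsum ⟨x, h.1, h.2⟩ else 0

/-- The coordinate function `φ^i`. -/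
def coord (i : ι) : Formal 𝕜 p := HahnSeries.single 1 (X p i)

/-- The left derivative `∂_L/∂φ^i`. -/
def dL (i : ι) (F : Formal 𝕜 p) : Formal 𝕜 p := HahnSeries.single (-1) 1 * F.map (polDL i)

/-- The right derivative `∂_R/∂φ^i`. -/
def dR (i : ι) (F : Formal 𝕜 p) : Formal 𝕜 p := HahnSeries.single (-1) 1 * F.map (polDR i)

/-- The BV Laplacian `Δ F = 1/2 ∑_{i,j} (-1)^{|φ^i|} ω^{ij} ∂_L² F / ∂φ^i ∂φ^j`, for the inverse
`ωi i j = ω^{ij}` of the matrix of `ω`. -/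
def lap (ωi : ι → ι → 𝕜) (F : Formal 𝕜 p) : Formal 𝕜 p :=
  (1 / 2 : 𝕜) • formalSum (fun x : ι × ι =>
    ((-1 : 𝕜) ^ p x.1 * ωi x.1 x.2) • dL x.1 (dL x.2 F))

/-- The BV bracket `{F, G} = ∑_{i,j} (∂_R F / ∂φ^i) ω^{ij} (∂_L G / ∂φ^j)`. -/
def bracket (ωi : ι → ι → 𝕜) (F G : Formal 𝕜 p) : Formal 𝕜 p :=
  formalSum (fun x : ι × ι => ωi x.1 x.2 • (dR x.1 F * dL x.2 G))

/-- The exponential series `∑ F^n / n!`. -/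
def formalExp (F : Formal 𝕜 p) : Formal 𝕜 p :=
  formalSum (fun n : ℕ => (n.factorial : 𝕜)⁻¹ • F ^ n)

/-- The logarithm series `∑_{n ≥ 1} (-1)^{n+1} (F - 1)^n / n`. -/
def formalLog (F : Formal 𝕜 p) : Formal 𝕜 p :=
  formalSum (fun n : ℕ => ((-1 : 𝕜) ^ n / ((n : 𝕜) + 1)) • (F - 1) ^ (n + 1))

/-- The free action `S_free`: the part of `S` of genus `0` and polynomial degree `2`. -/
def free (S : Formal 𝕜 p) : Formal 𝕜 p := HahnSeries.single 2 (part 0 2 S)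

/-- The interaction `S_int = S - S_free`. -/
def int (S : Formal 𝕜 p) : Formal 𝕜 p := S - free S

/-- `S` defines a quantum `L_∞` algebra: it is a formal function of degree `0`, its genus `0` part
is at least quadratic, its genus `1` part is at least linear, and it satisfies the quantum master
equation `ħ Δ S + 1/2 {S, S} = 0`. -/
structure IsQuantumLInfty (ωi : ι → ι → 𝕜) (S : Formal 𝕜 p) : Prop where
  mem_fun : S ∈ Fun 𝕜 p
  degree_zero : HasDegree 0 S
  genus_zero : ∀ n < 2, part 0 n S = 0
  genus_one : part 1 0 S = 0
  master : hbar 𝕜 p 1 * lap ωi S + (1 / 2 : 𝕜) • bracket ωi S S = 0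

/-- `Q` is the operation `λ_1^0` encoded by `S`, that is,
`S_free = 1/2 ∑_{i,j} s(e_i, e_j) φ^i φ^j` for `s(v, v') = (-1)^{|v|} ω(v, Q v')`; this is expressed
through the second derivatives `∂_L/∂φ^j (∂_L/∂φ^i S_free) = s(e_i, e_j)`. Here `|e_i| = -p i`. -/
def IsLinearOperation {V : Type*} [AddCommGroup V] [Module 𝕜 V] (ω : V →ₗ[𝕜] V →ₗ[𝕜] 𝕜)
    (Q : V →ₗ[𝕜] V) (e : ι → V) (S : Formal 𝕜 p) : Prop :=
  ∀ i j, dL j (dL i (free S)) = algebraMap 𝕜 (Formal 𝕜 p) ((-1 : 𝕜) ^ (-p i) * ω (e i) (Q (e j)))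

end Fun

/-! ### The deformation retract and its perturbations -/

section Retract

variable {𝕜 : Type*} [Field 𝕜] {ιH ιB ιC : Type*} {p : ιH ⊕ ιB ⊕ ιC → ℤ}

/-- The coordinates `β^k` and `γ^i` count `1`, the coordinates `α^i` count `0`. -/
def countBC : ιH ⊕ ιB ⊕ ιC → ℕ := Sum.elim (fun _ => 0) (fun _ => 1)

/-- The homotopy `K x = (1 / #_{β+γ}) ∑_{k,i} β^k (Q⁻¹)_k^i ∂_L x / ∂γ^i`, which is zero when
`#_{β+γ} = 0`, for the inverse `Qi k i` of the matrix of `Q : C → B`. -/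
def homotopy (Qi : ιB → ιC → 𝕜) (F : Formal 𝕜 p) : Formal 𝕜 p :=
  (formalSum (fun x : ιB × ιC =>
    Qi x.1 x.2 • (coord (Sum.inr (Sum.inl x.1)) * dL (Sum.inr (Sum.inr x.2)) F))).map
      (invCount countBC)

/-- The projection `P = ∑ n, (i^*)^{⊗ n}` from functions on `V` to functions on `H`. -/
def proj (F : Formal 𝕜 p) : Formal 𝕜 (fun i : ιH => p (Sum.inl i)) := F.map (polRestrict p)

/-- The terms `(δ K)^n F` of the series `(1 - δ K)⁻¹ F`. -/
def perturbTerms (Qi : ιB → ιC → 𝕜) (δ : Formal 𝕜 p → Formal 𝕜 p) (F : Formal 𝕜 p) (n : ℕ) :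
    Formal 𝕜 p :=
  (fun G => δ (homotopy Qi G))^[n] F

/-- The perturbed projection `P (1 - δ K)⁻¹ = P ∑ n, (δ K)^n`. -/
def perturbedProj (Qi : ιB → ιC → 𝕜) (δ : Formal 𝕜 p → Formal 𝕜 p) (F : Formal 𝕜 p) :
    Formal 𝕜 (fun i : ιH => p (Sum.inl i)) :=
  proj (formalSum (perturbTerms Qi δ F))

/-- The perturbation `δ₁ = ħ Δ`. -/
def delta₁ (ωi : ιH ⊕ ιB ⊕ ιC → ιH ⊕ ιB ⊕ ιC → 𝕜) (F : Formal 𝕜 p) : Formal 𝕜 p :=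
  hbar 𝕜 p 1 * lap ωi F

/-- The perturbation `δ₂ = ħ Δ + {S_int, -}`. -/
def delta₂ (ωi : ιH ⊕ ιB ⊕ ιC → ιH ⊕ ιB ⊕ ιC → 𝕜) (S F : Formal 𝕜 p) : Formal 𝕜 p :=
  hbar 𝕜 p 1 * lap ωi F + bracket ωi (int S) F

/-- The weight `e^{S_int/ħ}`. -/
def expInt (S : Formal 𝕜 p) : Formal 𝕜 p := formalExp (hbar 𝕜 p (-1) * int S)

/-- The effective action `W = ħ log P₁(e^{S_int/ħ})`. -/
def effAction (ωi : ιH ⊕ ιB ⊕ ιC → ιH ⊕ ιB ⊕ ιC → 𝕜) (Qi : ιB → ιC → 𝕜) (S : Formal 𝕜 p) :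
    Formal 𝕜 (fun i : ιH => p (Sum.inl i)) :=
  hbar 𝕜 _ 1 * formalLog (perturbedProj Qi (delta₁ ωi) (expInt S))

/-- The normalized path integral `Z(f) = e^{-W/ħ} P₁(f e^{S_int/ħ})`. -/
def pathIntegral (ωi : ιH ⊕ ιB ⊕ ιC → ιH ⊕ ιB ⊕ ιC → 𝕜) (Qi : ιB → ιC → 𝕜)
    (S f : Formal 𝕜 p) : Formal 𝕜 (fun i : ιH => p (Sum.inl i)) :=
  formalExp (-(hbar 𝕜 _ (-1) * effAction ωi Qi S)) * perturbedProj Qi (delta₁ ωi) (f * expInt S)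

end Retract

end BV

end

/-! Put s = S_int/ħ. The heart of the matter is the factorization P₁(f e^s) = P₁(e^s) P₂(f)
(`IsHodgeMatrices.perturbedProj_mul_expInt`): once P₁(e^s) is identified with e^{W/ħ}, the factor
e^{-W/ħ} in Z(f) cancels it and Z(f) = P₂(f) remains.

Everything may be computed after setting β = 0. The homotopy K replaces a γ by a β, and this β
survives only if the next operator differentiates it; the entry ω^{γβ} then pairs that derivative
with a γ-derivative. Hence modulo β the operator ħΔK becomes ∑ D^{kl} ∂_k ∂_l (1/#_γ), and {S_int,
K-} becomes the bidifferential operator of D with first argument s, preceded by 1/#_γ. Here D is the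
propagator on the γ-variables, the product of ω^{-1} and Q^{-1} up to sign
(`killB_secondOrder_koszul`, `killB_bidiff_koszul`).

So P₁ is a Gaussian integral Φ over γ, applied after β = 0. The form ω(Q-,-) is graded-symmetric,
therefore so is D (`propagator_symm`), and this gives integration by parts: Φ(γ^i x) = Φ(∑_k D^{ki}
∂_k x) (`gaussian_X_mul`). Let y be e^s at β = 0, so that ∂_j y = (∂_j s) y. Split F into its γ-free
part πF and E(F/#_γ), where E is the Euler operator of γ. Integrating by parts in every variable of
E yields Φ(F y) = Φ(πF y) + Φ((TF) y), where T is δ₂K modulo β. The γ-free factor leaves the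
integral, so iteration gives Φ(f y) = ∑_{n<N} Φ(y) P(T^n f) + Φ((T^N f) y), and in a given weight
the remainder vanishes for large N.

Convergence: s has weight at least 1, so on the lowest weight of its argument δ₂K acts as ħΔK. The
latter lowers the polynomial degree by 2 at fixed weight, hence is nilpotent on each polynomial, and
induction on the weight makes the iterates tend to 0 (`exists_iterate_mem_fil`).

For W: e^s - 1 has weight at least 1, while Φ preserves weights and fixes 1, so the logarithm
converges and exp(log(1 + X)) = 1 + X applies. The last two claims count genera: at fixed weight,
lowering the degree by 2 raises the genus by 1, and s has genus at least -1, so δ₂K preserves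
nonnegativity of the genus as well as positivity of the weight. -/

noncomputable section

namespace BV

/-! ### Graded-commutative polynomials: signs, derivatives, gradings. -/

section PolBasics

variable {𝕜 : Type*} [Field 𝕜] {ι : Type*} {p : ι → ℤ}

/-- Induction on graded-commutative polynomials: every polynomial is obtained from `1` by
multiplication with generators from the left, sums and scalar multiples. -/
theorem Pol.induction {C : Pol 𝕜 p → Prop} (one : C 1) (X_mul : ∀ i x, C x → C (X p i * x))
    (add : ∀ x y, C x → C y → C (x + y)) (smul : ∀ (r : 𝕜) x, C x → C (r • x)) (x : Pol 𝕜 p) :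
    C x := by
  have key : ∀ (y : FreeAlgebra 𝕜 ι) (x : Pol 𝕜 p), C x →
      C (RingQuot.mkAlgHom 𝕜 (PolRel 𝕜 p) y * x) := by
    intro y
    induction y using FreeAlgebra.induction with
    | grade0 r => intro x hx; simpa [Algebra.algebraMap_eq_smul_one] using smul r x hx
    | grade1 i => intro x hx; exact X_mul i x hx
    | mul a b ha hb => intro x hx; rw [map_mul, mul_assoc]; exact ha _ (hb _ hx)
    | add a b ha hb => intro x hx; rw [map_add, add_mul]; exact add _ _ (ha _ hx) (hb _ hx)
  obtain ⟨y, rfl⟩ := RingQuot.mkAlgHom_surjective 𝕜 (PolRel 𝕜 p) x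
  simpa using key y 1 one

theorem Pol.algHom_ext {A : Type*} [Semiring A] [Algebra 𝕜 A] {f g : Pol 𝕜 p →ₐ[𝕜] A}
    (h : ∀ i, f (X p i) = g (X p i)) (x : Pol 𝕜 p) : f x = g x := by
  induction x using Pol.induction with
  | one => simp
  | X_mul i x hx => rw [map_mul, map_mul, h, hx]
  | add x y hx hy => rw [map_add, map_add, hx, hy]
  | smul r x hx => rw [map_smul, map_smul, hx]

theorem neg_one_zpow_comm (a b : ℤ) : (-1 : 𝕜) ^ (a * b) = (-1 : 𝕜) ^ (b * a) := by
  rw [mul_comm]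

theorem neg_one_zpow_add (a b : ℤ) : (-1 : 𝕜) ^ (a + b) = (-1 : 𝕜) ^ a * (-1 : 𝕜) ^ b :=
  zpow_add₀ (by simp) a b

theorem neg_one_zpow_even {a : ℤ} (h : Even a) : (-1 : 𝕜) ^ a = 1 := h.neg_one_zpow

/-- The algebra automorphism `x ↦ (-1)^{k |x|} x`. -/
def sgn (k : ℤ) : Pol 𝕜 p →ₐ[𝕜] Pol 𝕜 p :=
  polLift (fun j => (-1 : 𝕜) ^ (k * p j) • X p j) (by
    intro i j
    have h := X_mul_X (𝕜 := 𝕜) (p := p) i j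
    simp only [h, smul_mul_smul_comm, smul_smul]
    congr 1
    ring)

theorem sgn_X (k : ℤ) (j : ι) : sgn k (X p j : Pol 𝕜 p) = (-1 : 𝕜) ^ (k * p j) • X p j :=
  polLift_X _ _ _

theorem sgn_sgn (k : ℤ) (x : Pol 𝕜 p) : sgn k (sgn k x) = x := by
  refine Pol.algHom_ext (f := (sgn k).comp (sgn k)) (g := AlgHom.id 𝕜 _) (fun i => ?_) x
  simp [sgn_X, smul_smul, neg_one_zpow_mul_self]

theorem delta_self (R : Type*) [Zero R] [One R] {α : Type*} (i : α) : delta R i i = 1 := by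
  simp [delta]

theorem delta_of_ne (R : Type*) [Zero R] [One R] {α : Type*} {i j : α} (h : i ≠ j) :
    delta R i j = 0 := by
  simp [delta, h]

theorem leftHom_X (i j : ι) : leftHom i (X p j : Pol 𝕜 p) =
    !![(-1 : 𝕜) ^ (p i * p j) • X p j, delta (Pol 𝕜 p) i j; 0, X p j] := polLift_X _ _ _

theorem rightHom_X (i j : ι) : rightHom i (X p j : Pol 𝕜 p) =
    !![X p j, delta (Pol 𝕜 p) i j; 0, (-1 : 𝕜) ^ (p i * p j) • X p j] := polLift_X _ _ _

/-- With these entries known, the upper right entry of a matrix product is the graded Leibniz rule.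
-/
theorem leftHom_entries (i : ι) (x : Pol 𝕜 p) :
    leftHom i x 0 0 = sgn (p i) x ∧ leftHom i x 1 0 = 0 ∧ leftHom i x 1 1 = x := by
  induction x using Pol.induction with
  | one => simp
  | X_mul j x hx => simp [leftHom_X, Matrix.mul_apply, Fin.sum_univ_two, hx, sgn_X]
  | add x y hx hy => simp [hx, hy]
  | smul r x hx => simp [hx]

theorem rightHom_entries (i : ι) (x : Pol 𝕜 p) :
    rightHom i x 1 1 = sgn (p i) x ∧ rightHom i x 1 0 = 0 ∧ rightHom i x 0 0 = x := by
  induction x using Pol.induction with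
  | one => simp
  | X_mul j x hx => simp [rightHom_X, Matrix.mul_apply, Fin.sum_univ_two, hx, sgn_X]
  | add x y hx hy => simp [hx, hy]
  | smul r x hx => simp [hx]

theorem polDL_apply (i : ι) (x : Pol 𝕜 p) : polDL i x = leftHom i x 0 1 := rfl

theorem polDR_apply (i : ι) (x : Pol 𝕜 p) : polDR i x = rightHom i x 0 1 := rfl

theorem polDL_mul (i : ι) (x y : Pol 𝕜 p) :
    polDL i (x * y) = polDL i x * y + sgn (p i) x * polDL i y := by
  simp only [polDL_apply, map_mul, Matrix.mul_apply, Fin.sum_univ_two, leftHom_entries]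
  rw [add_comm]

theorem polDR_mul (i : ι) (x y : Pol 𝕜 p) :
    polDR i (x * y) = x * polDR i y + polDR i x * sgn (p i) y := by
  simp only [polDR_apply, map_mul, Matrix.mul_apply, Fin.sum_univ_two, rightHom_entries]

@[simp] theorem polDL_one (i : ι) : polDL i (1 : Pol 𝕜 p) = 0 := by
  simp [polDL_apply]

@[simp] theorem polDR_one (i : ι) : polDR i (1 : Pol 𝕜 p) = 0 := by
  simp [polDR_apply]

theorem polDL_X (i j : ι) : polDL i (X p j : Pol 𝕜 p) = delta (Pol 𝕜 p) i j := by
  simp [polDL_apply, leftHom_X]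

theorem polDR_X (i j : ι) : polDR i (X p j : Pol 𝕜 p) = delta (Pol 𝕜 p) i j := by
  simp [polDR_apply, rightHom_X]

theorem polDL_X_mul (i j : ι) (x : Pol 𝕜 p) : polDL i (X p j * x) =
    delta 𝕜 i j • x + (-1 : 𝕜) ^ (p i * p j) • (X p j * polDL i x) := by
  rw [polDL_mul, polDL_X, sgn_X]
  by_cases h : i = j
  · subst h; simp [delta_self]
  · simp [delta_of_ne _ h]

/-- Moving x_i from the right end of a monomial to the left costs (-1)^{|x_i|(|x|-|x_i|)}, and
|x_i|² has the parity of |x_i|. Right derivatives are eliminated this way. -/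
theorem polDR_eq (i : ι) (x : Pol 𝕜 p) :
    polDR i x = (-1 : 𝕜) ^ (p i) • polDL i (sgn (p i) x) := by
  induction x using Pol.induction with
  | one => simp
  | X_mul j x hx =>
    rw [polDR_mul, polDR_X, hx, map_mul, polDL_mul, sgn_sgn, smul_add, sgn_X, map_smul, polDL_X]
    by_cases h : i = j
    · subst h
      have h2 : (-1 : 𝕜) ^ (p i) * (-1 : 𝕜) ^ (p i * p i) = 1 := by
        rw [← neg_one_zpow_add]
        exact neg_one_zpow_even (by have := Int.even_mul_succ_self (p i); grind)
      simp [delta_self, smul_smul, h2, add_comm]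
    · simp [delta_of_ne _ h]
  | add x y hx hy => simp [hx, hy]
  | smul r x hx => simp [hx, smul_smul, mul_comm]

theorem polDL_comm (i j : ι) (x : Pol 𝕜 p) :
    polDL i (polDL j x) = (-1 : 𝕜) ^ (p i * p j) • polDL j (polDL i x) := by
  induction x using Pol.induction with
  | one => simp
  | X_mul k x hx =>
    rw [polDL_X_mul, polDL_X_mul, map_add, map_add, map_smul, map_smul, map_smul, map_smul,
      polDL_X_mul, polDL_X_mul, hx]
    by_cases hi : i = k <;> by_cases hj : j = k
    · subst hi; subst hj
      simp [delta_self, smul_add, smul_smul, neg_one_zpow_mul_self, add_left_comm]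
    · subst hi
      simp [delta_self, delta_of_ne _ hj, smul_add, smul_smul, neg_one_zpow_comm (p j) (p i)]
    · subst hj
      simp [delta_self, delta_of_ne _ hi, smul_add, smul_smul, neg_one_zpow_mul_self]
      rw [← mul_assoc, neg_one_zpow_mul_self, one_mul]
    · simp [delta_of_ne _ hi, delta_of_ne _ hj, smul_smul]
      congr 1
      ring
  | add x y hx hy => simp [hx, hy]
  | smul r x hx => simp [hx, smul_smul, mul_comm]

/-- A polynomial involves finitely many variables. This makes sums over a possibly infinite basis of
V finite. -/
theorem finite_polDL_ne_zero (x : Pol 𝕜 p) : {i | polDL i x ≠ 0}.Finite := by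
  induction x using Pol.induction with
  | one => simp
  | X_mul k x hx =>
    refine (hx.union (Set.finite_singleton k)).subset fun i hi => ?_
    by_contra hc
    simp only [Set.mem_union, Set.mem_ofPred_eq, Set.mem_singleton_iff, not_or, not_not] at hc
    apply hi
    rw [polDL_X_mul, hc.1, delta_of_ne _ hc.2]
    simp
  | add x y hx hy =>
    refine (hx.union hy).subset fun i hi => ?_
    by_contra hc
    simp only [Set.mem_union, Set.mem_ofPred_eq, not_or, not_not] at hc
    exact hi (by rw [map_add, hc.1, hc.2, add_zero])
  | smul r x hx =>
    refine hx.subset fun i hi h => hi ?_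
    rw [map_smul, h, smul_zero]

/-! ### Gradings -/

variable {M : Type*} [AddCommMonoid M]

theorem gradeHom_X (wt : ι → M) (i : ι) :
    gradeHom wt (X p i : Pol 𝕜 p) = AddMonoidAlgebra.single (wt i) (X p i) := polLift_X _ _ _

/-- The polynomials that are homogeneous of weight `m`. -/
def homog (wt : ι → M) (m : M) : Submodule 𝕜 (Pol 𝕜 p) where
  carrier := {x | gradeHom wt x = AddMonoidAlgebra.single m x}
  add_mem' {x y} hx hy := by
    simp only [Set.mem_ofPred_eq] at *
    rw [map_add, hx, hy, AddMonoidAlgebra.single_add]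
  zero_mem' := by simp
  smul_mem' r x hx := by
    simp only [Set.mem_ofPred_eq] at *
    rw [map_smul, hx, AddMonoidAlgebra.smul_single]

theorem mem_homog {wt : ι → M} {m : M} {x : Pol 𝕜 p} :
    x ∈ homog wt m ↔ gradeHom wt x = AddMonoidAlgebra.single m x := Iff.rfl

theorem one_mem_homog (wt : ι → M) : (1 : Pol 𝕜 p) ∈ homog wt 0 := by
  rw [mem_homog, map_one]; rfl

theorem X_mem_homog (wt : ι → M) (i : ι) : (X p i : Pol 𝕜 p) ∈ homog wt (wt i) := gradeHom_X wt i

theorem mul_mem_homog {wt : ι → M} {m n : M} {x y : Pol 𝕜 p} (hx : x ∈ homog wt m)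
    (hy : y ∈ homog wt n) : x * y ∈ homog wt (m + n) := by
  rw [mem_homog] at *
  rw [map_mul, hx, hy, AddMonoidAlgebra.single_mul_single]

/-- The sign automorphism is the grading map followed by the substitution T = (-1)^j, called `ε`
below; a homogeneous element contributes a single power of T. -/
theorem sgn_of_mem {k j : ℤ} {x : Pol 𝕜 p} (hx : x ∈ homog p k) :
    sgn j x = (-1 : 𝕜) ^ (j * k) • x := by
  let ε : AddMonoidAlgebra (Pol 𝕜 p) ℤ →ₗ[𝕜] Pol 𝕜 p :=
    Finsupp.lsum 𝕜 (fun m : ℤ => (-1 : 𝕜) ^ (j * m) • (LinearMap.id : Pol 𝕜 p →ₗ[𝕜] Pol 𝕜 p)) ∘ₗ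
      (AddMonoidAlgebra.coeffLinearEquiv 𝕜).toLinearMap
  have hε : ∀ m (x : Pol 𝕜 p), ε (AddMonoidAlgebra.single m x) = (-1 : 𝕜) ^ (j * m) • x := by
    intro m x
    exact Finsupp.sum_single_index (by simp)
  have hmul : ∀ (i : ι) (y : AddMonoidAlgebra (Pol 𝕜 p) ℤ),
      ε (AddMonoidAlgebra.single (p i) (X p i) * y) =
        ((-1 : 𝕜) ^ (j * p i) • X p i) * ε y := by
    intro i y
    induction y using AddMonoidAlgebra.induction_linear with
    | zero => simp
    | add y z hy hz => rw [mul_add, map_add, hy, hz, map_add, mul_add]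
    | single m r =>
      rw [AddMonoidAlgebra.single_mul_single, hε, hε, mul_add, neg_one_zpow_add,
        smul_mul_smul_comm]
  have key : ∀ x : Pol 𝕜 p, ε (gradeHom p x) = sgn j x := by
    intro x
    induction x using Pol.induction with
    | one =>
      rw [map_one (gradeHom p), map_one (sgn j), AddMonoidAlgebra.one_def, hε]
      simp
    | X_mul i x hx => rw [map_mul (gradeHom p), map_mul (sgn j), gradeHom_X, hmul, hx, sgn_X]
    | add x y hx hy => rw [map_add, map_add, map_add, hx, hy]
    | smul r x hx => rw [map_smul, map_smul, map_smul, hx]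
  rw [← key, mem_homog.1 hx, hε]

theorem component_apply (wt : ι → M) (m : M) (x : Pol 𝕜 p) :
    component wt m x = (gradeHom wt x).coeff m := rfl

open Classical in
theorem component_of_mem {wt : ι → M} {m : M} {x : Pol 𝕜 p} (hx : x ∈ homog wt m) (n : M) :
    component wt n x = if m = n then x else 0 := by
  rw [component_apply, mem_homog.1 hx, AddMonoidAlgebra.coeff_single, Finsupp.single_apply]

theorem component_self {wt : ι → M} {m : M} {x : Pol 𝕜 p} (hx : x ∈ homog wt m) :
    component wt m x = x := by
  rw [component_of_mem hx, if_pos rfl]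

theorem component_of_ne {wt : ι → M} {m n : M} {x : Pol 𝕜 p} (hx : x ∈ homog wt m)
    (h : m ≠ n) : component wt n x = 0 := by
  rw [component_of_mem hx, if_neg h]

theorem invCount_of_mem {wt : ι → ℕ} {m : ℕ} {x : Pol 𝕜 p} (hx : x ∈ homog wt m) :
    invCount wt x = (m : 𝕜)⁻¹ • x := by
  simp [invCount, mem_homog.1 hx]

/-- Induction on polynomials with respect to two gradings. -/
theorem Pol.induction_homog₂ {M' : Type*} [AddCommMonoid M'] (wt : ι → M) (wt' : ι → M')
    {C : Pol 𝕜 p → Prop} (mem : ∀ m m' x, x ∈ homog wt m → x ∈ homog wt' m' → C x)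
    (add : ∀ x y, C x → C y → C (x + y)) (x : Pol 𝕜 p) : C x := by
  have key : x ∈ ⨆ m : M × M', (homog wt m.1 ⊓ homog wt' m.2 : Submodule 𝕜 (Pol 𝕜 p)) := by
    induction x using Pol.induction with
    | one =>
      exact Submodule.mem_iSup_of_mem (0, 0) ⟨one_mem_homog wt, one_mem_homog wt'⟩
    | X_mul i x hx =>
      induction hx using Submodule.iSup_induction' with
      | mem m x hx =>
        exact Submodule.mem_iSup_of_mem (wt i + m.1, wt' i + m.2)
          ⟨mul_mem_homog (X_mem_homog wt i) hx.1, mul_mem_homog (X_mem_homog wt' i) hx.2⟩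
      | zero => simp
      | add x y _ _ hx hy => rw [mul_add]; exact add_mem hx hy
    | add x y hx hy => exact add_mem hx hy
    | smul r x hx => exact Submodule.smul_mem _ r hx
  induction key using Submodule.iSup_induction' with
  | mem m x hx => exact mem m.1 m.2 x hx.1 hx.2
  | zero => exact mem 0 0 0 (zero_mem _) (zero_mem _)
  | add x y _ _ hx hy => exact add _ _ hx hy

theorem Pol.induction_homog (wt : ι → M) {C : Pol 𝕜 p → Prop}
    (mem : ∀ m x, x ∈ homog wt m → C x) (add : ∀ x y, C x → C y → C (x + y)) (x : Pol 𝕜 p) :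
    C x :=
  Pol.induction_homog₂ wt wt (fun m _ x hx _ => mem m x hx) add x

theorem component_mem_homog (wt : ι → M) (m : M) (x : Pol 𝕜 p) : component wt m x ∈ homog wt m := by
  induction x using Pol.induction_homog wt with
  | mem n x hx =>
    rw [component_of_mem hx]
    split_ifs with h
    · exact h ▸ hx
    · exact zero_mem _
  | add x y hx hy => rw [map_add]; exact add_mem hx hy

theorem component_comm {M' : Type*} [AddCommMonoid M'] (wt : ι → M) (wt' : ι → M') (m : M) (m' : M')
    (x : Pol 𝕜 p) :
    component wt m (component wt' m' x) = component wt' m' (component wt m x) := by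
  induction x using Pol.induction_homog₂ wt wt' with
  | mem n n' x hx hx' =>
    rw [component_of_mem hx, component_of_mem hx']
    split_ifs with h h' h' <;> simp [component_of_mem hx, component_of_mem hx', *]
  | add x y hx hy => simp [hx, hy]

theorem component_mem_homog_of_mem {M' : Type*} [AddCommMonoid M'] {wt : ι → M} (wt' : ι → M')
    {m : M} (m' : M') {x : Pol 𝕜 p} (hx : x ∈ homog wt m) : component wt' m' x ∈ homog wt m := by
  rw [← component_self hx, component_comm]
  exact component_mem_homog _ _ _

theorem finite_component_ne_zero (wt : ι → M) (x : Pol 𝕜 p) :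
    {m | component wt m x ≠ 0}.Finite := by
  refine (gradeHom wt x).coeff.support.finite_toSet.subset fun m hm => ?_
  simpa [component_apply] using hm

theorem finsum_component (wt : ι → M) (x : Pol 𝕜 p) : ∑ᶠ m, component wt m x = x := by
  induction x using Pol.induction_homog wt with
  | mem n x hx =>
    rw [finsum_eq_single _ n fun m hm => component_of_ne hx hm.symm, component_self hx]
  | add x y hx hy =>
    simp only [map_add]
    rw [finsum_add_distrib (finite_component_ne_zero wt x) (finite_component_ne_zero wt y), hx, hy]

/-- The span of the polynomials whose weight is in `A`. -/
def degIn (wt : ι → M) (A : Set M) : Submodule 𝕜 (Pol 𝕜 p) where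
  carrier := {x | ∀ m, component wt m x ≠ 0 → m ∈ A}
  add_mem' {x y} hx hy m hm := by
    by_contra hA
    exact hm (by rw [map_add, not_not.1 (mt (hx m) hA), not_not.1 (mt (hy m) hA), add_zero])
  zero_mem' := by simp
  smul_mem' r x hx m hm := hx m fun h => hm (by rw [map_smul, h, smul_zero])

theorem homog_le_degIn {wt : ι → M} {A : Set M} {m : M} (hm : m ∈ A) :
    (homog wt m : Submodule 𝕜 (Pol 𝕜 p)) ≤ degIn wt A := by
  intro x hx n hn
  by_contra h
  exact hn (component_of_ne hx fun e => h (e ▸ hm))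

theorem degIn_mono {wt : ι → M} {A B : Set M} (h : A ⊆ B) :
    (degIn wt A : Submodule 𝕜 (Pol 𝕜 p)) ≤ degIn wt B := fun _ hx m hm => h (hx m hm)

theorem degIn_induction {wt : ι → M} {A : Set M} {C : Pol 𝕜 p → Prop}
    (mem : ∀ m ∈ A, ∀ x ∈ homog wt m, C x) (zero : C 0)
    (add : ∀ x y, C x → C y → C (x + y)) {x : Pol 𝕜 p} (hx : x ∈ degIn wt A) : C x := by
  rw [← finsum_component wt x]
  refine finsum_induction C zero add fun m => ?_
  by_cases h : component wt m x = 0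
  · rwa [h]
  · exact mem m (hx m h) _ (component_mem_homog wt m x)

theorem degIn_empty {wt : ι → M} {x : Pol 𝕜 p} (hx : x ∈ degIn wt (∅ : Set M)) : x = 0 := by
  refine degIn_induction (C := fun x => x = 0) (fun m hm => hm.elim) rfl ?_ hx
  rintro _ _ rfl rfl
  simp

theorem homog_eq_degIn (wt : ι → M) (m : M) :
    (homog wt m : Submodule 𝕜 (Pol 𝕜 p)) = degIn wt {m} := by
  refine le_antisymm (homog_le_degIn rfl) fun x hx => ?_
  refine degIn_induction (fun n hn y hy => ?_) (zero_mem _) (fun x y => add_mem) hx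
  rwa [Set.mem_singleton_iff.1 hn] at hy

theorem mul_mem_degIn {wt : ι → M} {A B E : Set M} (h : ∀ a ∈ A, ∀ b ∈ B, a + b ∈ E)
    {x y : Pol 𝕜 p} (hx : x ∈ degIn wt A) (hy : y ∈ degIn wt B) : x * y ∈ degIn wt E := by
  refine degIn_induction (C := fun x => x * y ∈ degIn wt E) (fun m hm x hx => ?_) (by simp)
    (fun x x' hx hx' => by rw [add_mul]; exact add_mem hx hx') hx
  refine degIn_induction (C := fun y => x * y ∈ degIn wt E) (fun n hn y hy => ?_) (by simp)
    (fun x x' hx hx' => by rw [mul_add]; exact add_mem hx hx') hy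
  exact homog_le_degIn (h m hm n hn) (mul_mem_homog hx hy)

theorem invCount_mem_degIn {wt : ι → M} {A : Set M} (wt' : ι → ℕ) {x : Pol 𝕜 p}
    (hx : x ∈ degIn wt A) : invCount wt' x ∈ degIn wt A := by
  have key : ∀ (m : M) (x : Pol 𝕜 p),
      component wt m (invCount wt' x) = invCount wt' (component wt m x) := by
    intro m x
    induction x using Pol.induction_homog₂ wt wt' with
    | mem n n' x hx hx' =>
      rw [invCount_of_mem hx', map_smul, component_of_mem hx]
      split_ifs
      · rw [invCount_of_mem hx']
      · simp
    | add x y hx hy => simp [hx, hy]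
  intro m hm
  rw [key] at hm
  exact hx m fun h => hm (by rw [h, map_zero])

/-- Left derivatives lower the weight by the weight of the variable. -/
theorem component_polDL_int (wt : ι → ℤ) (i : ι) (m : ℤ) (x : Pol 𝕜 p) :
    component wt m (polDL i x) = polDL i (component wt (m + wt i) x) := by
  induction x using Pol.induction generalizing m with
  | one =>
    rw [polDL_one, map_zero, component_of_mem (one_mem_homog wt)]
    split_ifs <;> simp
  | X_mul j x hx =>
    have h2 : ∀ (j : ι) (y : Pol 𝕜 p) n, component wt n (X p j * y) =
        X p j * component wt (n - wt j) y := by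
      intro j y n
      induction y using Pol.induction_homog wt with
      | mem k y hy =>
        rw [component_of_mem (mul_mem_homog (X_mem_homog wt j) hy), component_of_mem hy]
        by_cases h : k = n - wt j
        · rw [if_pos h, if_pos (by lia)]
        · rw [if_neg h, if_neg (by lia), mul_zero]
      | add x y hx hy => simp [mul_add, hx, hy]
    rw [h2, polDL_X_mul, polDL_X_mul, map_add, map_smul, map_smul, h2, hx]
    by_cases hij : i = j
    · subst hij; simp
    · rw [delta_of_ne _ hij]
      simp only [zero_smul, zero_add]
      congr 5
      ring
  | add x y hx hy => simp [hx, hy]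
  | smul r x hx => simp [hx]

/-- Transfers the derivative formula from integer weights, where subtraction is available, to
natural ones. -/
theorem component_natCast (wt : ι → ℕ) (m : ℕ) (x : Pol 𝕜 p) :
    component (fun i => (wt i : ℤ)) (m : ℤ) x = component wt m x := by
  have h : ∀ x : Pol 𝕜 p, gradeHom (fun i => (wt i : ℤ)) x =
      AddMonoidAlgebra.mapDomain (Nat.castAddMonoidHom ℤ) (gradeHom wt x) := by
    refine Pol.algHom_ext (g := (AddMonoidAlgebra.mapDomainAlgHom 𝕜 (Pol 𝕜 p)
      (Nat.castAddMonoidHom ℤ)).comp (gradeHom wt)) fun i => ?_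
    rw [AlgHom.comp_apply, gradeHom_X, gradeHom_X]
    exact (AddMonoidAlgebra.mapDomain_single).symm
  rw [component_apply, component_apply, h]
  exact Finsupp.mapDomain_apply Nat.cast_injective _ _

theorem component_polDL (wt : ι → ℕ) (i : ι) (m : ℕ) (x : Pol 𝕜 p) :
    component wt m (polDL i x) = polDL i (component wt (m + wt i) x) := by
  rw [← component_natCast, component_polDL_int, ← component_natCast]
  simp

theorem polDL_mem_degIn {wt : ι → ℕ} (i : ι) {A : Set ℕ} {x : Pol 𝕜 p} (hx : x ∈ degIn wt A) :
    polDL i x ∈ degIn wt {n | n + wt i ∈ A} := fun m hm =>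
  hx _ fun h => hm (by rw [component_polDL, h, map_zero])

theorem polDL_mem_homog_int {wt : ι → ℤ} (i : ι) {m : ℤ} {x : Pol 𝕜 p} (hx : x ∈ homog wt m) :
    polDL i x ∈ homog wt (m - wt i) := by
  have := component_polDL_int wt i (m - wt i) x
  rw [sub_add_cancel, component_self hx] at this
  rw [← this]
  exact component_mem_homog _ _ _

theorem polDL_mem_homog {wt : ι → ℕ} (i : ι) {m n : ℕ} (h : n + wt i = m) {x : Pol 𝕜 p}
    (hx : x ∈ homog wt m) : polDL i x ∈ homog wt n := by
  have := component_polDL wt i n x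
  rw [h, component_self hx] at this
  rw [← this]
  exact component_mem_homog _ _ _

theorem polDL_eq_zero {wt : ι → ℕ} (i : ι) {m : ℕ} (h : m < wt i) {x : Pol 𝕜 p}
    (hx : x ∈ homog wt m) : polDL i x = 0 := by
  rw [homog_eq_degIn] at hx
  refine degIn_empty (wt := wt) (degIn_mono (fun n hn => ?_) (polDL_mem_degIn i hx))
  simp at hn
  lia

/-- Homogeneous elements commute up to sign with all elements. -/
theorem mul_comm_of_mem_homog {k : ℤ} {v : Pol 𝕜 p} (hv : v ∈ homog p k) (u : Pol 𝕜 p) :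
    v * u = sgn k u * v := by
  induction u using Pol.induction with
  | one => simp
  | X_mul j u hu =>
    have h : ∀ x : Pol 𝕜 p, ∀ j, x * X p j = X p j * sgn (p j) x := by
      intro x j
      induction x using Pol.induction with
      | one => simp
      | X_mul i x hx =>
        rw [mul_assoc, hx, map_mul, sgn_X, ← mul_assoc, X_mul_X, smul_mul_assoc, smul_mul_assoc,
          mul_smul_comm, mul_assoc, neg_one_zpow_comm]
      | add x y hx hy => rw [add_mul, hx, hy, map_add, mul_add]
      | smul r x hx => rw [smul_mul_assoc, hx, map_smul, mul_smul_comm]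
    rw [← mul_assoc, h, sgn_of_mem hv, map_mul, sgn_X, mul_smul_comm, smul_mul_assoc, mul_assoc, hu,
      smul_mul_assoc, smul_mul_assoc, mul_assoc, neg_one_zpow_comm]
  | add x y hx hy => rw [mul_add, hx, hy, map_add, add_mul]
  | smul r x hx => rw [mul_smul_comm, hx, map_smul, smul_mul_assoc]

end PolBasics

/-! ### Finitely supported sums. -/

section Finsum

theorem finsum_eq_sum_of_forall {α N : Type*} [AddCommMonoid N] {f : α → N} (s : Finset α)
    (h : ∀ a, a ∉ s → f a = 0) : ∑ᶠ a, f a = ∑ a ∈ s, f a :=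
  finsum_eq_sum_of_support_subset f fun a ha => by
    by_contra hs
    exact ha (h a hs)

/-- `∑ᶠ` takes the value 0 on an infinite support, so the interchange is secured by a finite
rectangle containing all nonzero terms. -/
theorem finsum_comm_of_finite {α β N : Type*} [AddCommMonoid N] {f : α → β → N} {s : Set α}
    {t : Set β} (hs : s.Finite) (ht : t.Finite) (h : ∀ a b, f a b ≠ 0 → a ∈ s ∧ b ∈ t) :
    ∑ᶠ a, ∑ᶠ b, f a b = ∑ᶠ b, ∑ᶠ a, f a b := by
  have h1 : ∀ a, a ∉ s → ∀ b, f a b = 0 := fun a ha b => by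
    by_contra hc; exact ha (h a b hc).1
  have h2 : ∀ b, b ∉ t → ∀ a, f a b = 0 := fun b hb a => by
    by_contra hc; exact hb (h a b hc).2
  rw [finsum_eq_sum_of_forall hs.toFinset, finsum_eq_sum_of_forall ht.toFinset]
  · rw [Finset.sum_congr rfl fun a _ => finsum_eq_sum_of_forall ht.toFinset (f := f a) fun b hb =>
      h2 b (by simpa using hb) a, Finset.sum_comm]
    refine Finset.sum_congr rfl fun b _ => (finsum_eq_sum_of_forall hs.toFinset fun a ha =>
      h1 a (by simpa using ha) b).symm
  · intro b hb
    simp [h2 b (by simpa using hb)]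
  · intro a ha
    simp [h1 a (by simpa using ha)]

/-- The sum of a locally finite family of linear maps. -/
def finsumLin {R : Type*} [CommRing R] {α N N' : Type*} [AddCommGroup N] [Module R N]
    [AddCommGroup N'] [Module R N'] (L : α → N →ₗ[R] N')
    (h : ∀ x, (fun a => L a x).HasFiniteSupport) : N →ₗ[R] N' where
  toFun x := ∑ᶠ a, L a x
  map_add' x y := by
    simp only [map_add]
    exact finsum_add_distrib (h x) (h y)
  map_smul' r x := by
    simp only [map_smul, RingHom.id_apply]
    exact (smul_finsum' r (h x)).symm

end Finsum

/-! ### Second-order operators, geometric series and the Euler operator. -/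

section Calculus

variable {𝕜 : Type*} [Field 𝕜] {ι : Type*} {q : ι → ℤ}

theorem hasFiniteSupport_of_polDL {N : Type*} [Zero N] (x : Pol 𝕜 q) {f : ι → N}
    (h : ∀ k, polDL k x = 0 → f k = 0) : f.HasFiniteSupport :=
  (finite_polDL_ne_zero x).subset fun k hk => mt (h k) hk

/-- The derivation `∑ k, D^{kl} ∂_L/∂x_k`. -/
def contract (D : ι → ι → 𝕜) (l : ι) : Pol 𝕜 q →ₗ[𝕜] Pol 𝕜 q :=
  finsumLin (fun k => D k l • polDL k) fun x => hasFiniteSupport_of_polDL x fun k hk => by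
    simp [hk]

theorem contract_apply (D : ι → ι → 𝕜) (l : ι) (x : Pol 𝕜 q) :
    contract D l x = ∑ᶠ k, D k l • polDL k x := rfl

/-- The operator `∑ k l, D^{kl} ∂_L² / ∂x_k ∂x_l`. -/
def secondOrder (D : ι → ι → 𝕜) : Pol 𝕜 q →ₗ[𝕜] Pol 𝕜 q :=
  finsumLin (fun l => contract D l ∘ₗ polDL l) fun x => hasFiniteSupport_of_polDL x fun k hk => by
    simp [hk]

theorem secondOrder_apply (D : ι → ι → 𝕜) (x : Pol 𝕜 q) :
    secondOrder D x = ∑ᶠ l, contract D l (polDL l x) := rfl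

/-- The bidifferential operator `∑ k l, D^{kl} (∂_L x / ∂x_k) (∂_L y / ∂x_l)`. -/
def bidiff (D : ι → ι → 𝕜) : Pol 𝕜 q →ₗ[𝕜] Pol 𝕜 q →ₗ[𝕜] Pol 𝕜 q :=
  LinearMap.mk₂ 𝕜 (fun x y => ∑ᶠ l, contract D l x * polDL l y)
    (fun x x' y => by
      simp only [map_add, add_mul]
      exact finsum_add_distrib (hasFiniteSupport_of_polDL y fun k hk => by simp [hk])
        (hasFiniteSupport_of_polDL y fun k hk => by simp [hk]))
    (fun r x y => by
      simp only [map_smul, smul_mul_assoc]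
      exact (smul_finsum' r (hasFiniteSupport_of_polDL y fun k hk => by simp [hk])).symm)
    (fun x y y' => by
      simp only [map_add, mul_add]
      exact finsum_add_distrib (hasFiniteSupport_of_polDL y fun k hk => by simp [hk])
        (hasFiniteSupport_of_polDL y' fun k hk => by simp [hk]))
    (fun r x y => by
      simp only [map_smul, mul_smul_comm]
      exact (smul_finsum' r (hasFiniteSupport_of_polDL y fun k hk => by simp [hk])).symm)

theorem bidiff_apply (D : ι → ι → 𝕜) (x y : Pol 𝕜 q) :
    bidiff D x y = ∑ᶠ l, contract D l x * polDL l y := rfl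

theorem finsum_mem_submodule {α N : Type*} [AddCommGroup N] [Module 𝕜 N] (P : Submodule 𝕜 N)
    {f : α → N} (h : ∀ a, f a ∈ P) : ∑ᶠ a, f a ∈ P :=
  finsum_induction (· ∈ P) (zero_mem P) (fun _ _ => add_mem) h

theorem contract_mem_degIn (D : ι → ι → 𝕜) (l : ι) {A : Set ℕ} {x : Pol 𝕜 q}
    (hx : x ∈ degIn (fun _ => 1) A) : contract D l x ∈ degIn (fun _ => 1) {n | n + 1 ∈ A} :=
  finsum_mem_submodule _ fun k => Submodule.smul_mem _ _ (polDL_mem_degIn k hx)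

/-- Operators that lower the polynomial degree by `2`. -/
def LowersDegree (T : Pol 𝕜 q →ₗ[𝕜] Pol 𝕜 q) : Prop :=
  ∀ (A : Set ℕ) (x : Pol 𝕜 q), x ∈ degIn (fun _ => 1) A → T x ∈ degIn (fun _ => 1) {n | n + 2 ∈ A}

theorem lowersDegree_secondOrder (D : ι → ι → 𝕜) : LowersDegree (secondOrder (q := q) D) := by
  intro A x hx
  exact finsum_mem_submodule _ fun l => contract_mem_degIn D l (polDL_mem_degIn l hx)

theorem LowersDegree.iterate {T : Pol 𝕜 q →ₗ[𝕜] Pol 𝕜 q} (hT : LowersDegree T) (n : ℕ) (A : Set ℕ)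
    (x : Pol 𝕜 q) (hx : x ∈ degIn (fun _ => 1) A) :
    (T ^ n) x ∈ degIn (fun _ => 1) {k | k + 2 * n ∈ A} := by
  induction n with
  | zero => simpa using hx
  | succ n ih =>
    rw [pow_succ']
    refine degIn_mono (fun k hk => ?_) (hT _ _ ih)
    have h : k + 2 * (n + 1) = k + 2 + 2 * n := by ring
    exact (congrArg (· ∈ A) h).mpr hk

/-- The degree of a polynomial is bounded and each application of T lowers it by 2. This local
nilpotency is behind the convergence of both perturbation series. -/
theorem LowersDegree.exists_pow_eq_zero {T : Pol 𝕜 q →ₗ[𝕜] Pol 𝕜 q} (hT : LowersDegree T)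
    (x : Pol 𝕜 q) : ∃ N, ∀ n, N ≤ n → (T ^ n) x = 0 := by
  obtain ⟨N, hN⟩ := (finite_component_ne_zero (fun _ => 1) x : {m : ℕ | _}.Finite).bddAbove
  refine ⟨N + 1, fun n hn => degIn_empty (wt := fun _ => 1) (degIn_mono ?_
    (hT.iterate n {m | component (fun _ => 1) m x ≠ 0} x fun m hm => hm))⟩
  intro k hk
  have := hN hk
  lia

theorem LowersDegree.hasFiniteSupport {T : Pol 𝕜 q →ₗ[𝕜] Pol 𝕜 q} (hT : LowersDegree T)
    {N : Type*} [AddCommGroup N] [Module 𝕜 N] (ρ : Pol 𝕜 q →ₗ[𝕜] N) (x : Pol 𝕜 q) :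
    (fun n : ℕ => ρ ((T ^ n) x)).HasFiniteSupport := by
  obtain ⟨N, hN⟩ := hT.exists_pow_eq_zero x
  refine (Set.finite_lt_nat N).subset fun n hn => ?_
  by_contra hc
  exact hn (by simp [hN n (by simpa using hc)])

/-- The series `ρ ∑ n, T^n` for an operator that lowers the degree. -/
def geomSum {T : Pol 𝕜 q →ₗ[𝕜] Pol 𝕜 q} (hT : LowersDegree T)
    {N : Type*} [AddCommGroup N] [Module 𝕜 N] (ρ : Pol 𝕜 q →ₗ[𝕜] N) : Pol 𝕜 q →ₗ[𝕜] N :=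
  finsumLin (fun n : ℕ => ρ ∘ₗ T ^ n) (hT.hasFiniteSupport ρ)

theorem geomSum_apply {T : Pol 𝕜 q →ₗ[𝕜] Pol 𝕜 q} (hT : LowersDegree T)
    {N : Type*} [AddCommGroup N] [Module 𝕜 N] (ρ : Pol 𝕜 q →ₗ[𝕜] N) (x : Pol 𝕜 q) :
    geomSum hT ρ x = ∑ᶠ n : ℕ, ρ ((T ^ n) x) := rfl

theorem geomSum_eq_add {T : Pol 𝕜 q →ₗ[𝕜] Pol 𝕜 q} (hT : LowersDegree T)
    {N : Type*} [AddCommGroup N] [Module 𝕜 N] (ρ : Pol 𝕜 q →ₗ[𝕜] N) (x : Pol 𝕜 q) :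
    geomSum hT ρ x = ρ x + geomSum hT ρ (T x) := by
  obtain ⟨N, hN⟩ := hT.exists_pow_eq_zero x
  rw [geomSum_apply, geomSum_apply,
    finsum_eq_sum_of_forall (Finset.range (N + 1)) fun n hn => by
      rw [hN n (by simp at hn; lia), map_zero],
    finsum_eq_sum_of_forall (Finset.range N) fun n hn => by
      rw [← Module.End.mul_apply, ← pow_succ, hN (n + 1) (by simp at hn; lia), map_zero],
    Finset.sum_range_succ', add_comm]
  simp [pow_succ]

/-- The number operator `∑ i, c_i x_i ∂_L/∂x_i`. -/
def euler (c : ι → ℕ) : Pol 𝕜 q →ₗ[𝕜] Pol 𝕜 q :=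
  finsumLin (fun i => (c i : 𝕜) • (LinearMap.mulLeft 𝕜 (X q i) ∘ₗ polDL i)) fun x =>
    hasFiniteSupport_of_polDL x fun k hk => by simp [hk]

theorem euler_apply (c : ι → ℕ) (x : Pol 𝕜 q) :
    euler c x = ∑ᶠ i, (c i : 𝕜) • (X q i * polDL i x) := rfl

theorem euler_X_mul (c : ι → ℕ) (k : ι) (x : Pol 𝕜 q) :
    euler c (X q k * x) = (c k : 𝕜) • (X q k * x) + X q k * euler c x := by
  have h : ∀ i, (c i : 𝕜) • (X q i * polDL i (X q k * x)) =
      (c i : 𝕜) • delta 𝕜 i k • (X q i * x) +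
        LinearMap.mulLeft 𝕜 (X q k) ((c i : 𝕜) • (X q i * polDL i x)) := by
    intro i
    rw [polDL_X_mul, mul_add, smul_add, mul_smul_comm, mul_smul_comm, ← mul_assoc, X_mul_X,
      LinearMap.mulLeft_apply, mul_smul_comm, smul_mul_assoc, mul_assoc]
    rw [smul_smul ((-1 : 𝕜) ^ _) ((-1 : 𝕜) ^ _), neg_one_zpow_mul_self, one_smul]
  rw [euler_apply, euler_apply, finsum_congr h, finsum_add_distrib, ← map_finsum]
  · congr 1
    rw [finsum_eq_single _ k fun i hi => by rw [delta_of_ne _ hi]; simp]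
    simp [delta_self]
  · exact hasFiniteSupport_of_polDL x fun k hk => by simp [hk]
  · refine (Set.finite_singleton k).subset fun i hi => ?_
    by_contra hc
    exact hi (by simp [delta_of_ne _ hc])
  · exact hasFiniteSupport_of_polDL x fun k hk => by simp [hk]

/-- `ε'` substitutes T = 1 and `ε` applies T d/dT before doing so. Composed with the grading map,
`ε` obeys the same product recursion as `euler`, so the two agree. -/
theorem euler_of_mem {c : ι → ℕ} {m : ℕ} {x : Pol 𝕜 q} (hx : x ∈ homog c m) :
    euler c x = (m : 𝕜) • x := by
  let ε : AddMonoidAlgebra (Pol 𝕜 q) ℕ →ₗ[𝕜] Pol 𝕜 q :=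
    Finsupp.lsum 𝕜 (fun m : ℕ => (m : 𝕜) • (LinearMap.id : Pol 𝕜 q →ₗ[𝕜] Pol 𝕜 q)) ∘ₗ
      (AddMonoidAlgebra.coeffLinearEquiv 𝕜).toLinearMap
  let ε' : AddMonoidAlgebra (Pol 𝕜 q) ℕ →ₗ[𝕜] Pol 𝕜 q :=
    Finsupp.lsum 𝕜 (fun _ : ℕ => (LinearMap.id : Pol 𝕜 q →ₗ[𝕜] Pol 𝕜 q)) ∘ₗ
      (AddMonoidAlgebra.coeffLinearEquiv 𝕜).toLinearMap
  have hε : ∀ m (x : Pol 𝕜 q), ε (AddMonoidAlgebra.single m x) = (m : 𝕜) • x := by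
    intro m x
    exact Finsupp.sum_single_index (by simp)
  have hε' : ∀ m (x : Pol 𝕜 q), ε' (AddMonoidAlgebra.single m x) = x := by
    intro m x
    exact Finsupp.sum_single_index (by simp)
  have hmul' : ∀ (i : ι) (y : AddMonoidAlgebra (Pol 𝕜 q) ℕ),
      ε' (AddMonoidAlgebra.single (c i) (X q i) * y) = X q i * ε' y := by
    intro i y
    induction y using AddMonoidAlgebra.induction_linear with
    | zero => simp
    | add y z hy hz => rw [mul_add, map_add, hy, hz, map_add, mul_add]
    | single m r => rw [AddMonoidAlgebra.single_mul_single, hε', hε']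
  have hmul : ∀ (i : ι) (y : AddMonoidAlgebra (Pol 𝕜 q) ℕ),
      ε (AddMonoidAlgebra.single (c i) (X q i) * y) =
        (c i : 𝕜) • (X q i * ε' y) + X q i * ε y := by
    intro i y
    induction y using AddMonoidAlgebra.induction_linear with
    | zero => simp
    | add y z hy hz =>
      rw [mul_add, map_add, hy, hz, map_add, mul_add, map_add, mul_add, smul_add]
      abel
    | single m r =>
      rw [AddMonoidAlgebra.single_mul_single, hε, hε, hε', mul_smul_comm, ← add_smul,
        Nat.cast_add]
  have key : ∀ x : Pol 𝕜 q, ε' (gradeHom c x) = x ∧ ε (gradeHom c x) = euler c x := by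
    intro x
    induction x using Pol.induction with
    | one =>
      rw [map_one (gradeHom c), AddMonoidAlgebra.one_def, hε, hε']
      simp [euler_apply]
    | X_mul i x hx =>
      rw [map_mul (gradeHom c), gradeHom_X, hmul, hmul', hx.1, hx.2, euler_X_mul]
      exact ⟨rfl, rfl⟩
    | add x y hx hy => simp only [map_add, hx, hy, and_self]
    | smul r x hx => simp only [map_smul, hx, and_self]
  rw [← (key x).2, mem_homog.1 hx, hε]

end Calculus

/-! ### The Gaussian integral Φ and integration by parts. -/

section Gaussian

variable {𝕜 : Type*} [Field 𝕜] {ι : Type*} {q : ι → ℤ}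

/-- `D` is a graded-symmetric matrix of degree `0`, supported on the variables of count `1`. -/
structure IsPropagator (q : ι → ℤ) (c : ι → ℕ) (D : ι → ι → 𝕜) : Prop where
  count : ∀ i j, D i j ≠ 0 → c i = 1 ∧ c j = 1
  degree : ∀ i j, D i j ≠ 0 → q i + q j = 0
  symm : ∀ i j, D i j = (-1 : 𝕜) ^ (q i * q j) * D j i

variable {c : ι → ℕ} {D : ι → ι → 𝕜}

theorem neg_one_zpow_eq_of_add_eq_zero {a b : ℤ} (h : a + b = 0) (k : ℤ) :
    (-1 : 𝕜) ^ (a * k) = (-1 : 𝕜) ^ (b * k) := by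
  have : a * k = -(b * k) := by rw [show a = -b by lia]; ring
  rw [this, zpow_neg, ← inv_zpow]
  simp

/-- A nonzero D^{kl} joins variables of opposite degree, hence of equal parity. Contraction with
index l is therefore a derivation whose sign depends on l alone. -/
theorem IsPropagator.sign_smul (hD : IsPropagator q c D) (k l i : ι) :
    D k l * (-1 : 𝕜) ^ (q k * q i) = D k l * (-1 : 𝕜) ^ (q l * q i) := by
  by_cases h : D k l = 0
  · simp [h]
  · rw [neg_one_zpow_eq_of_add_eq_zero (hD.degree k l h)]

theorem IsPropagator.contract_X_mul (hD : IsPropagator q c D) (l i : ι) (x : Pol 𝕜 q) :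
    contract D l (X q i * x) =
      D i l • x + (-1 : 𝕜) ^ (q l * q i) • (X q i * contract D l x) := by
  have h : ∀ k, D k l • polDL k (X q i * x) = (D k l * delta 𝕜 k i) • x +
      ((-1 : 𝕜) ^ (q l * q i) • LinearMap.mulLeft 𝕜 (X q i)) (D k l • polDL k x) := by
    intro k
    rw [polDL_X_mul, smul_add, smul_smul, smul_smul, hD.sign_smul]
    simp [smul_smul]
  rw [contract_apply, finsum_congr h, finsum_add_distrib, ← map_finsum]
  · congr 1
    rw [finsum_eq_single _ i fun k hk => by rw [delta_of_ne _ hk]; simp]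
    simp [delta_self]
  · exact hasFiniteSupport_of_polDL x fun k hk => by simp [hk]
  · refine (Set.finite_singleton i).subset fun k hk => ?_
    by_contra hc
    exact hk (by simp [delta_of_ne _ hc])
  · exact hasFiniteSupport_of_polDL x fun k hk => by simp [hk]

theorem IsPropagator.contract_mul (hD : IsPropagator q c D) (l : ι) (x y : Pol 𝕜 q) :
    contract D l (x * y) = contract D l x * y + sgn (q l) x * contract D l y := by
  induction x using Pol.induction with
  | one => simp [contract_apply]
  | X_mul i x hx =>
    rw [mul_assoc, hD.contract_X_mul, hx, hD.contract_X_mul, map_mul, sgn_X, mul_add, smul_add,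
      add_mul, smul_mul_assoc, smul_mul_assoc, smul_mul_assoc, mul_assoc, smul_mul_assoc,
      mul_assoc, add_assoc]
  | add x y hx hy => simp only [add_mul, map_add, hx, hy]; abel
  | smul r x hx => simp only [smul_mul_assoc, map_smul, hx, smul_add]

theorem IsPropagator.contract_polDL (hD : IsPropagator q c D) (l j : ι) (x : Pol 𝕜 q) :
    contract D l (polDL j x) = (-1 : 𝕜) ^ (q l * q j) • polDL j (contract D l x) := by
  rw [contract_apply, contract_apply, map_finsum, smul_finsum']
  · refine finsum_congr fun k => ?_
    rw [polDL_comm, map_smul, smul_smul, smul_smul, hD.sign_smul, mul_comm]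
  all_goals exact hasFiniteSupport_of_polDL x fun k hk => by simp [hk]

/-- The two derivatives in each term have equal parity, so the signs from passing ∂_j across them
cancel. -/
theorem IsPropagator.secondOrder_polDL (hD : IsPropagator q c D) (j : ι) (x : Pol 𝕜 q) :
    secondOrder D (polDL j x) = polDL j (secondOrder D x) := by
  rw [secondOrder_apply, secondOrder_apply, map_finsum]
  · refine finsum_congr fun l => ?_
    rw [polDL_comm, map_smul, hD.contract_polDL, smul_smul, neg_one_zpow_mul_self, one_smul]
  · exact hasFiniteSupport_of_polDL x fun k hk => by simp [hk]

theorem IsPropagator.secondOrder_contract (hD : IsPropagator q c D) (l : ι) (x : Pol 𝕜 q) :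
    secondOrder D (contract D l x) = contract D l (secondOrder D x) := by
  rw [contract_apply, contract_apply, map_finsum]
  · exact finsum_congr fun k => by rw [map_smul, hD.secondOrder_polDL]
  · exact hasFiniteSupport_of_polDL x fun k hk => by simp [hk]

/-- Either derivative may hit x_i; graded symmetry of D makes the two contributions equal, whence
the factor 2. -/
theorem IsPropagator.secondOrder_X_mul (hD : IsPropagator q c D) (i : ι) (x : Pol 𝕜 q) :
    secondOrder D (X q i * x) = X q i * secondOrder D x + (2 : 𝕜) • contract D i x := by
  have h : ∀ l, contract D l (polDL l (X q i * x)) = delta 𝕜 l i • contract D l x +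
      (D l i • polDL l x + LinearMap.mulLeft 𝕜 (X q i) (contract D l (polDL l x))) := by
    intro l
    rw [polDL_X_mul, map_add, map_smul, map_smul, hD.contract_X_mul, smul_add, smul_smul, smul_smul,
      neg_one_zpow_mul_self, one_smul, ← hD.symm l i, LinearMap.mulLeft_apply]
  rw [secondOrder_apply, finsum_congr h, finsum_add_distrib, finsum_add_distrib, ← map_finsum]
  · rw [finsum_eq_single _ i fun k hk => by rw [delta_of_ne _ hk]; simp, delta_self, one_smul,
      ← contract_apply, LinearMap.mulLeft_apply, ← secondOrder_apply, two_smul]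
    abel
  · exact hasFiniteSupport_of_polDL x fun k hk => by simp [hk]
  · exact hasFiniteSupport_of_polDL x fun k hk => by simp [hk]
  · exact hasFiniteSupport_of_polDL x fun k hk => by simp [hk]
  · refine (Set.finite_singleton i).subset fun k hk => ?_
    by_contra hc
    exact hk (by simp [delta_of_ne _ hc])
  · exact hasFiniteSupport_of_polDL x fun k hk => by simp [hk]

theorem IsPropagator.contract_eq_zero (hD : IsPropagator q c D) {l : ι} (hl : c l ≠ 1)
    (x : Pol 𝕜 q) : contract D l x = 0 := by
  rw [contract_apply]
  refine finsum_eq_zero_of_forall_eq_zero fun k => ?_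
  rw [show D k l = 0 by by_contra h; exact hl (hD.count k l h).2, zero_smul]

theorem IsPropagator.contract_mem_homog (hD : IsPropagator q c D) (l : ι) {m : ℕ} {x : Pol 𝕜 q}
    (hx : x ∈ homog c (m + 1)) : contract D l x ∈ homog c m := by
  refine finsum_mem_submodule _ fun k => ?_
  by_cases h : D k l = 0
  · simp [h]
  · exact Submodule.smul_mem _ _ (polDL_mem_homog k (by rw [(hD.count k l h).1]) hx)

theorem IsPropagator.contract_of_mem_zero (hD : IsPropagator q c D) (l : ι) {x : Pol 𝕜 q}
    (hx : x ∈ homog c 0) : contract D l x = 0 := by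
  refine finsum_eq_zero_of_forall_eq_zero fun k => ?_
  by_cases h : D k l = 0
  · simp [h]
  · simp [polDL_eq_zero k (by rw [(hD.count k l h).1]; exact one_pos) hx]

theorem IsPropagator.secondOrder_mem_homog (hD : IsPropagator q c D) {m : ℕ} {x : Pol 𝕜 q}
    (hx : x ∈ homog c (m + 2)) : secondOrder D x ∈ homog c m := by
  refine finsum_mem_submodule _ fun l => ?_
  by_cases hl : c l = 1
  · exact hD.contract_mem_homog l (polDL_mem_homog l (by rw [hl]) hx)
  · simp [hD.contract_eq_zero hl]

theorem IsPropagator.secondOrder_of_mem_lt (hD : IsPropagator q c D) {m : ℕ} (hm : m < 2)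
    {x : Pol 𝕜 q} (hx : x ∈ homog c m) : secondOrder D x = 0 := by
  refine finsum_eq_zero_of_forall_eq_zero fun l => ?_
  by_cases hl : c l = 1
  · interval_cases m
    · simp [polDL_eq_zero l (by rw [hl]; exact one_pos) hx]
    · exact hD.contract_of_mem_zero l (polDL_mem_homog l (by rw [hl]) hx)
  · simp [hD.contract_eq_zero hl]

theorem lowersDegree_secondOrder_invCount (c : ι → ℕ) (D : ι → ι → 𝕜) :
    LowersDegree (secondOrder (q := q) D ∘ₗ invCount c) := fun _ _ hx =>
  lowersDegree_secondOrder D _ _ (invCount_mem_degIn c hx)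

variable {A : Type*} [Ring A] [Algebra 𝕜 A]

/-- The Gaussian integral over the variables of positive count, with propagator `D`. It is given by
`ρ ∑ n, (∑ D^{kl} ∂_k ∂_l #⁻¹)^n`. -/
def gaussian (c : ι → ℕ) (D : ι → ι → 𝕜) (ρ : Pol 𝕜 q →ₐ[𝕜] A) : Pol 𝕜 q →ₗ[𝕜] A :=
  geomSum (lowersDegree_secondOrder_invCount c D) ρ.toLinearMap

/-- By Euler's identity m x lies in the ideal of the variables of positive count, which ρ kills;
characteristic 0 removes the factor m. -/
theorem map_of_mem_homog_pos [CharZero 𝕜] {ρ : Pol 𝕜 q →ₐ[𝕜] A} (hρ : ∀ i, c i ≠ 0 → ρ (X q i) = 0)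
    {m : ℕ} (hm : m ≠ 0) {x : Pol 𝕜 q} (hx : x ∈ homog c m) : ρ x = 0 := by
  have h : ρ ((m : 𝕜) • x) = 0 := by
    rw [← euler_of_mem hx, euler_apply]
    refine (map_finsum ρ (hasFiniteSupport_of_polDL x fun k hk => by simp [hk])).trans ?_
    refine finsum_eq_zero_of_forall_eq_zero fun i => ?_
    by_cases hi : c i = 0
    · simp [hi]
    · simp [hρ i hi]
  rw [map_smul, smul_eq_zero] at h
  exact h.resolve_left (by exact_mod_cast hm)

theorem gaussian_eq_add (ρ : Pol 𝕜 q →ₐ[𝕜] A) (x : Pol 𝕜 q) :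
    gaussian c D ρ x = ρ x + gaussian c D ρ (secondOrder D (invCount c x)) :=
  geomSum_eq_add _ _ _

/-- For x of count m > 0, splitting off the first term of the series gives Φ(m x) = ρ(m x) + Φ(Δ_D
x) with Δ_D = `secondOrder D`, and ρ(m x) vanishes. -/
theorem IsPropagator.gaussian_euler [CharZero 𝕜] (hD : IsPropagator q c D) {ρ : Pol 𝕜 q →ₐ[𝕜] A}
    (hρ : ∀ i, c i ≠ 0 → ρ (X q i) = 0) (x : Pol 𝕜 q) :
    gaussian c D ρ (euler c x) = gaussian c D ρ (secondOrder D x) := by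
  induction x using Pol.induction_homog c with
  | mem m x hx =>
    rw [euler_of_mem hx]
    rcases Nat.eq_zero_or_pos m with rfl | hm
    · rw [hD.secondOrder_of_mem_lt (by lia) hx]
      simp
    · rw [map_smul, gaussian_eq_add, map_of_mem_homog_pos hρ hm.ne' hx, invCount_of_mem hx, zero_add,
        map_smul, map_smul, smul_smul, mul_inv_cancel₀ (by exact_mod_cast hm.ne'), one_smul]
  | add x y hx hy => simp only [map_add, hx, hy]

/-- Integration by parts. -/
theorem IsPropagator.gaussian_X_mul [CharZero 𝕜] (hD : IsPropagator q c D) {ρ : Pol 𝕜 q →ₐ[𝕜] A}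
    (hρ : ∀ i, c i ≠ 0 → ρ (X q i) = 0) {i : ι} (hi : c i = 1) (x : Pol 𝕜 q) :
    gaussian c D ρ (X q i * x) = gaussian c D ρ (contract D i x) := by
  induction x using Pol.induction_homog c with
  | mem m x hx =>
    induction m using Nat.strong_induction_on generalizing x with
    | _ m ih =>
      -- Δ_D x has count m - 2, so the induction hypothesis applies to it; Δ_D commutes with the
      -- contraction.
      have h1 : gaussian c D ρ (X q i * secondOrder D x) =
          gaussian c D ρ (secondOrder D (contract D i x)) := by
        rw [hD.secondOrder_contract]
        rcases Nat.lt_or_ge m 2 with hm | hm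
        · rw [hD.secondOrder_of_mem_lt hm hx]
          simp
        · obtain ⟨m, rfl⟩ := Nat.exists_eq_add_of_le' hm
          exact ih m (by lia) _ (hD.secondOrder_mem_homog hx)
      -- Write D_i for the contraction. Expanding both sides gives (m+1) Φ(x_i x) = (m-1) Φ(D_i x) +
      -- 2 Φ(D_i x) for m ≥ 1, and m + 1 is cancelled; for m = 0 the contraction vanishes.
      have h2 := hD.gaussian_euler hρ (X q i * x)
      rw [euler_X_mul, hi, euler_of_mem hx, hD.secondOrder_X_mul, map_add, map_add, h1,
        ← hD.gaussian_euler hρ, mul_smul_comm, map_smul, map_smul, map_smul] at h2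
      rcases m with _ | m
      · rw [hD.contract_of_mem_zero i hx] at h2 ⊢
        simpa using h2
      · rw [euler_of_mem (hD.contract_mem_homog i hx), map_smul, ← add_smul, ← add_smul] at h2
        have h3 : (((1 : ℕ) : 𝕜) + ((m + 1 : ℕ) : 𝕜)) = ((m + 2 : ℕ) : 𝕜) := by push_cast; ring
        have h4 : ((m : 𝕜) + 2) = ((m + 2 : ℕ) : 𝕜) := by push_cast; ring
        rw [h3, h4] at h2
        exact smul_right_injective _ (by exact_mod_cast (by lia : m + 2 ≠ 0)) h2
  | add x y hx hy => rw [mul_add, map_add, map_add, map_add, hx, hy]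

/-- Integration by parts, summed over all variables: the second-order part of the Gaussian integral
of a product. -/
theorem IsPropagator.gaussian_euler_mul [CharZero 𝕜] (hD : IsPropagator q c D)
    {ρ : Pol 𝕜 q →ₐ[𝕜] A} (hρ : ∀ i, c i ≠ 0 → ρ (X q i) = 0) (hc : ∀ i, c i ≤ 1) (x y : Pol 𝕜 q) :
    gaussian c D ρ (euler c x * y) = gaussian c D ρ (secondOrder D x * y) +
      gaussian c D ρ (∑ᶠ i, sgn (q i) (polDL i x) * contract D i y) := by
  have hf : ∀ (f : ι → Pol 𝕜 q →ₗ[𝕜] Pol 𝕜 q),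
      (fun i => f i (polDL i x)).HasFiniteSupport := fun f =>
    hasFiniteSupport_of_polDL x fun k hk => by simp [hk]
  rw [euler_apply, finsum_mul' _ _ (hasFiniteSupport_of_polDL x fun k hk => by simp [hk]),
    map_finsum _ (hasFiniteSupport_of_polDL x fun k hk => by simp [hk]), secondOrder_apply,
    finsum_mul' _ _ (hf _), ← map_add, ← finsum_add_distrib
      (hasFiniteSupport_of_polDL x fun k hk => by simp [hk])
      (hasFiniteSupport_of_polDL x fun k hk => by simp [hk]),
    map_finsum _ (hasFiniteSupport_of_polDL x fun k hk => by simp [hk])]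
  refine finsum_congr fun i => ?_
  rcases Nat.le_one_iff_eq_zero_or_eq_one.1 (hc i) with hi | hi
  · have h0 : c i ≠ 1 := by lia
    simp [hi, hD.contract_eq_zero h0]
  · rw [hi, Nat.cast_one, one_smul, mul_assoc, hD.gaussian_X_mul hρ hi, hD.contract_mul]

theorem secondOrder_mul_right {h : Pol 𝕜 q} (hh : ∀ i, c i = 1 → polDL i h = 0)
    (hD : IsPropagator q c D) (x : Pol 𝕜 q) :
    secondOrder D (x * h) = secondOrder D x * h := by
  have h1 : ∀ l, contract D l h = 0 := fun l => finsum_eq_zero_of_forall_eq_zero fun k => by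
    by_cases hk : D k l = 0
    · simp [hk]
    · simp [hh k (hD.count k l hk).1]
  rw [secondOrder_apply, secondOrder_apply, finsum_mul' _ _
    (hasFiniteSupport_of_polDL x fun k hk => by simp [hk])]
  refine finsum_congr fun l => ?_
  by_cases hl : c l = 1
  · rw [polDL_mul, hh l hl, mul_zero, add_zero, hD.contract_mul, h1, mul_zero, add_zero]
  · rw [hD.contract_eq_zero hl, hD.contract_eq_zero hl, zero_mul]

theorem invCount_mul_right {h : Pol 𝕜 q} (hh : h ∈ homog c 0) (x : Pol 𝕜 q) :
    invCount c (x * h) = invCount c x * h := by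
  induction x using Pol.induction_homog c with
  | mem m x hx =>
    rw [invCount_of_mem hx, invCount_of_mem (m := m) (by simpa using mul_mem_homog hx hh),
      smul_mul_assoc]
  | add x y hx hy => simp only [add_mul, map_add, hx, hy]

/-- A factor of count 0 behaves as a constant: neither the counting operator nor a contraction sees
it. -/
theorem IsPropagator.gaussian_mul_right (hD : IsPropagator q c D) (ρ : Pol 𝕜 q →ₐ[𝕜] A)
    {h : Pol 𝕜 q} (hh : h ∈ homog c 0) (x : Pol 𝕜 q) :
    gaussian c D ρ (x * h) = gaussian c D ρ x * ρ h := by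
  have h1 : ∀ i, c i = 1 → polDL i h = 0 := fun i hi =>
    polDL_eq_zero i (by rw [hi]; exact one_pos) hh
  have hpow : ∀ n : ℕ, ((secondOrder D ∘ₗ invCount c) ^ n) (x * h) =
      ((secondOrder D ∘ₗ invCount c) ^ n) x * h := by
    intro n
    induction n with
    | zero => simp
    | succ n ih =>
      rw [pow_succ', Module.End.mul_apply, ih, Module.End.mul_apply, LinearMap.comp_apply,
        invCount_mul_right hh, secondOrder_mul_right h1 hD, LinearMap.comp_apply]
  rw [gaussian, geomSum_apply, geomSum_apply,
    finsum_mul' _ _ (LowersDegree.hasFiniteSupport (lowersDegree_secondOrder_invCount c D) _ x)]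
  refine finsum_congr fun n => ?_
  rw [hpow]
  simp

end Gaussian

/-! ### Inverses of possibly infinite matrices with finite blocks. -/

section Matrices

variable {𝕜 : Type*} [Field 𝕜]

theorem finsum_eq_finsum_comp {α β N : Type*} [AddCommMonoid N] {f : α → N} (g : β → α)
    (hg : Function.Injective g) (h : ∀ a, a ∉ Set.range g → f a = 0) :
    ∑ᶠ a, f a = ∑ᶠ b, f (g b) := by
  classical
  rw [← finsum_mem_range hg]
  refine finsum_congr fun a => ?_
  by_cases ha : a ∈ Set.range g
  · rw [finsum_eq_if, if_pos ha]
  · rw [finsum_eq_if, if_neg ha, h a ha]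

theorem delta_comm {α : Type*} (i j : α) : delta 𝕜 i j = delta 𝕜 j i := by
  by_cases h : i = j
  · rw [h]
  · rw [delta_of_ne _ h, delta_of_ne _ (Ne.symm h)]

/-- `N` is a two-sided inverse of the matrix `M`. -/
def IsMatrixInverse {α β : Type*} (M : α → β → 𝕜) (N : β → α → 𝕜) : Prop :=
  (∀ i k, ∑ᶠ j, M i j * N j k = delta 𝕜 i k) ∧ (∀ j l, ∑ᶠ i, N j i * M i l = delta 𝕜 j l)

theorem invMatrix_eq_zero_or {α β : Type*} (M : α → β → 𝕜) :
    invMatrix M = 0 ∨ IsMatrixInverse M (invMatrix M) := by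
  classical
  by_cases h : ∃ N : β → α → 𝕜,
      (∀ i k, ∑ᶠ j, M i j * N j k = delta 𝕜 i k) ∧ (∀ j l, ∑ᶠ i, N j i * M i l = delta 𝕜 j l)
  · right
    rw [invMatrix, dif_pos h]
    exact h.choose_spec
  · left
    rw [invMatrix, dif_neg h]

open Classical in
/-- Inverses of a matrix that is block diagonal with finite blocks. -/
theorem IsMatrixInverse.eq_ite {α β T : Type*} {M : α → β → 𝕜} {N N' : β → α → 𝕜}
    (hN : IsMatrixInverse M N) (hN' : IsMatrixInverse M N') (s : α → T) (u : β → T)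
    (hM : ∀ i j, M i j ≠ 0 → s i = u j) (hs : ∀ τ, {i | s i = τ}.Finite)
    (hu : ∀ τ, {j | u j = τ}.Finite) (j : β) (k : α) :
    N j k = if s k = u j then N' j k else 0 := by
  -- Associativity (N' M) N = N' (M N) is not automatic for infinite sums. The finite blocks of M
  -- confine the two middle indices to the finite sets F and L.
  set F := (hs (u j)).toFinset with hF
  set L := (hu (u j)).toFinset with hL
  have hM' : ∀ i l, s i ≠ u l → M i l = 0 := fun i l h => by
    by_contra hc; exact h (hM i l hc)
  have h1 : ∀ l ∈ L, delta 𝕜 j l = ∑ i ∈ F, N' j i * M i l := by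
    intro l hl
    rw [← hN'.2 j l]
    refine finsum_eq_sum_of_forall _ fun i hi => ?_
    rw [hM' i l, mul_zero]
    rw [hL, Set.Finite.mem_toFinset] at hl
    rw [hF, Set.Finite.mem_toFinset] at hi
    rwa [show u l = u j from hl]
  have h2 : ∀ i ∈ F, delta 𝕜 i k = ∑ l ∈ L, M i l * N l k := by
    intro i hi
    rw [← hN.1 i k]
    refine finsum_eq_sum_of_forall _ fun l hl => ?_
    rw [hM' i l, zero_mul]
    rw [hL, Set.Finite.mem_toFinset] at hl
    rw [hF, Set.Finite.mem_toFinset] at hi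
    rw [show s i = u j from hi]
    exact fun h => hl h.symm
  have h3 : N j k = ∑ l ∈ L, delta 𝕜 j l * N l k := by
    rw [Finset.sum_eq_single j]
    · simp [delta_self]
    · intro l _ hl
      rw [delta_of_ne _ hl.symm, zero_mul]
    · intro hj
      exact absurd (by simp [hL]) hj
  rw [h3, Finset.sum_congr rfl fun l hl => by rw [h1 l hl, Finset.sum_mul], Finset.sum_comm]
  have h4 : ∀ i ∈ F, ∑ l ∈ L, N' j i * M i l * N l k = N' j i * delta 𝕜 i k := by
    intro i hi
    rw [h2 i hi, Finset.mul_sum]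
    exact Finset.sum_congr rfl fun l _ => mul_assoc _ _ _
  rw [Finset.sum_congr rfl h4]
  split_ifs with h
  · rw [Finset.sum_eq_single k]
    · simp [delta_self]
    · intro i _ hi
      rw [delta_of_ne _ hi, mul_zero]
    · intro hk
      exact absurd (by simp [hF, h]) hk
  · refine Finset.sum_eq_zero fun i hi => ?_
    rw [delta_of_ne, mul_zero]
    rintro rfl
    exact h (by simpa [hF] using hi)

theorem IsMatrixInverse.support {α β T : Type*} {M : α → β → 𝕜} {N : β → α → 𝕜}
    (hN : IsMatrixInverse M N) (s : α → T) (u : β → T)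
    (hM : ∀ i j, M i j ≠ 0 → s i = u j) (hs : ∀ τ, {i | s i = τ}.Finite)
    (hu : ∀ τ, {j | u j = τ}.Finite) {j : β} {k : α} (h : N j k ≠ 0) : s k = u j := by
  by_contra hc
  exact h (by rw [hN.eq_ite hN s u hM hs hu, if_neg hc])

/-- By `IsMatrixInverse.eq_ite` both inverses equal the block-diagonal part of N'. -/
theorem IsMatrixInverse.unique {α β T : Type*} {M : α → β → 𝕜} {N N' : β → α → 𝕜}
    (hN : IsMatrixInverse M N) (hN' : IsMatrixInverse M N') (s : α → T) (u : β → T)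
    (hM : ∀ i j, M i j ≠ 0 → s i = u j) (hs : ∀ τ, {i | s i = τ}.Finite)
    (hu : ∀ τ, {j | u j = τ}.Finite) (j : β) (k : α) : N j k = N' j k := by
  rw [hN.eq_ite hN' s u hM hs hu, eq_comm]
  exact hN'.eq_ite hN' s u hM hs hu j k

end Matrices

/-! ### The matrices of ω and Q for a Hodge decomposition; symmetry of the propagator. -/

section Hodge

variable {𝕜 V : Type*} [Field 𝕜] [AddCommGroup V] [Module 𝕜 V]

theorem exists_ne_zero_of_finsum {α N : Type*} [AddCommMonoid N] {f : α → N}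
    (h : ∑ᶠ a, f a ≠ 0) : ∃ a, f a ≠ 0 := by
  by_contra hc
  push Not at hc
  exact h (finsum_eq_zero_of_forall_eq_zero hc)

theorem finite_of_linearIndependent {κ : Type*} {𝒱 : ℤ → Submodule 𝕜 V}
    (hfin : ∀ k, FiniteDimensional 𝕜 (𝒱 k)) {v : κ → V} (hv : LinearIndependent 𝕜 v) {d : κ → ℤ}
    (hd : ∀ i, v i ∈ 𝒱 (d i)) (k : ℤ) : {i | d i = k}.Finite := by
  have := hfin k
  let w : {i // d i = k} → 𝒱 k := fun i => ⟨v i, by have := hd i; rwa [i.2] at this⟩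
  have hw : LinearIndependent 𝕜 w := by
    refine LinearIndependent.of_comp (𝒱 k).subtype ?_
    exact hv.comp _ Subtype.val_injective
  exact Set.finite_coe_iff.1 hw.finite

/-- Coordinates of a homogeneous vector with respect to a homogeneous basis of a subspace. -/
theorem repr_eq_zero_of_degree_ne {κ : Type*} {𝒱 : ℤ → Submodule 𝕜 V}
    (h𝒱 : DirectSum.IsInternal 𝒱) {B : Submodule 𝕜 V} (b : Module.Basis κ 𝕜 B) {d : κ → ℤ}
    (hd : ∀ i, (b i : V) ∈ 𝒱 (d i)) {n : ℤ} {x : B} (hx : (x : V) ∈ 𝒱 n) {i : κ} (hi : d i ≠ n) :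
    b.repr x i = 0 := by
  classical
  -- The projection to degree d i kills x but keeps the terms of degree d i in its expansion; by
  -- linear independence their coefficients vanish.
  let π : V →ₗ[𝕜] V := (𝒱 (d i)).subtype ∘ₗ DirectSum.component 𝕜 ℤ (fun k => 𝒱 k) (d i) ∘ₗ
    (LinearEquiv.ofBijective (DirectSum.coeLinearMap 𝒱) h𝒱).symm.toLinearMap
  have hπ : ∀ k (y : V), y ∈ 𝒱 k → π y = if k = d i then y else 0 := by
    intro k y hy
    split_ifs with h
    · subst h
      exact congrArg Subtype.val (h𝒱.ofBijective_coeLinearMap_of_mem hy)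
    · exact congrArg Subtype.val (h𝒱.ofBijective_coeLinearMap_of_mem_ne h hy)
  have hb : LinearIndependent 𝕜 fun k => (b k : V) :=
    b.linearIndependent.map' B.subtype (by simp)
  have key : ∀ r : κ →₀ 𝕜, π (Finsupp.linearCombination 𝕜 (fun k => (b k : V)) r) =
      Finsupp.linearCombination 𝕜 (fun k => (b k : V)) (r.filter fun k => d k = d i) := by
    intro r
    induction r using Finsupp.induction_linear with
    | zero => rw [map_zero, map_zero, Finsupp.filter_zero, map_zero]
    | add r r' hr hr' => rw [map_add, map_add, hr, hr', Finsupp.filter_add, map_add]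
    | single k t =>
      rw [Finsupp.linearCombination_single, map_smul, hπ _ _ (hd k)]
      split_ifs with h
      · rw [Finsupp.filter_single_of_pos (fun k => d k = d i) h,
          Finsupp.linearCombination_single]
      · rw [Finsupp.filter_single_of_neg (fun k => d k = d i) h, map_zero, smul_zero]
  have hxr : Finsupp.linearCombination 𝕜 (fun k => (b k : V)) (b.repr x) = x := by
    conv_rhs => rw [← b.linearCombination_repr x]
    rw [Finsupp.linearCombination_apply, Finsupp.linearCombination_apply, Finsupp.sum,
      Finsupp.sum, Submodule.coe_sum]
    rfl
  have h0 := key (b.repr x)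
  rw [hxr, hπ n _ hx, if_neg (Ne.symm hi)] at h0
  have h1 := linearIndependent_iff.1 hb _ h0.symm
  have h2 := DFunLike.congr_fun h1 i
  rwa [Finsupp.filter_apply_pos (fun k => d k = d i) _ rfl] at h2

variable {ιH ιB ιC : Type*}

/-- The propagator `D^{ij} = ∑ k, (-1)^{|γ^i|} ω^{γ^i β^k} (Q⁻¹)_k^j`. -/
def propagator (p : ιH ⊕ ιB ⊕ ιC → ℤ) (ωi : ιH ⊕ ιB ⊕ ιC → ιH ⊕ ιB ⊕ ιC → 𝕜) (Qi : ιB → ιC → 𝕜)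
    (i j : ιC) : 𝕜 :=
  ∑ᶠ k : ιB, (-1 : 𝕜) ^ p (Sum.inr (Sum.inr i)) * ωi (Sum.inr (Sum.inr i)) (Sum.inr (Sum.inl k)) *
    Qi k j

/-- The properties of the inverse matrices of `ω` and of `Q : C → B` for a Hodge decomposition. -/
structure IsHodgeMatrices (p : ιH ⊕ ιB ⊕ ιC → ℤ) (ωi : ιH ⊕ ιB ⊕ ιC → ιH ⊕ ιB ⊕ ιC → 𝕜)
    (Qi : ιB → ιC → 𝕜) : Prop where
  degree : ∀ i j, ωi i j ≠ 0 → p i + p j = -1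
  antisymm : ∀ i j, ωi j i = -ωi i j
  finite : ∀ i, {j | ωi i j ≠ 0}.Finite
  block_H : ∀ i x, ωi (Sum.inl i) (Sum.inr x) = 0
  block_B : ∀ i j, ωi (Sum.inr (Sum.inl i)) (Sum.inr (Sum.inl j)) = 0
  block_C : ∀ i j, ωi (Sum.inr (Sum.inr i)) (Sum.inr (Sum.inr j)) = 0
  degree_Q : ∀ k j, Qi k j ≠ 0 → p (Sum.inr (Sum.inr j)) = p (Sum.inr (Sum.inl k)) + 1
  finite_Q : ∀ k, {j | Qi k j ≠ 0}.Finite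
  finite_Q' : ∀ j, {k | Qi k j ≠ 0}.Finite
  symm : ∀ i j, propagator p ωi Qi i j =
    (-1 : 𝕜) ^ (p (Sum.inr (Sum.inr i)) * p (Sum.inr (Sum.inr j))) * propagator p ωi Qi j i

/-- The blocks of `V = H ⊕ B ⊕ C`. -/
def block : ιH ⊕ ιB ⊕ ιC → ℕ := Sum.elim (fun _ => 0) (Sum.elim (fun _ => 1) (fun _ => 2))

/-- The block that is dual under the symplectic form. -/
def dualBlock : ιH ⊕ ιB ⊕ ιC → ℕ := Sum.elim (fun _ => 0) (Sum.elim (fun _ => 2) (fun _ => 1))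

theorem linearIndependent_coe {κ : Type*} {B : Submodule 𝕜 V} (b : Module.Basis κ 𝕜 B) :
    LinearIndependent 𝕜 fun k => (b k : V) :=
  b.linearIndependent.map' B.subtype (by simp)

variable {𝒱 : ℤ → Submodule 𝕜 V} {ω : V →ₗ[𝕜] V →ₗ[𝕜] 𝕜} {Q : V →ₗ[𝕜] V} {H C : Submodule 𝕜 V}
  {a : Module.Basis ιH 𝕜 H} {b : Module.Basis ιB 𝕜 (LinearMap.range Q)} {c : Module.Basis ιC 𝕜 C}
  {d : ιH ⊕ ιB ⊕ ιC → ℤ}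

theorem finite_degree_fiber (hfin : ∀ k, FiniteDimensional 𝕜 (𝒱 k))
    (hd : ∀ i, assemble a b c i ∈ 𝒱 (d i)) (k : ℤ) : {i | d i = k}.Finite := by
  have hH := finite_of_linearIndependent hfin (linearIndependent_coe a)
    (d := fun i => d (Sum.inl i)) (fun i => hd (Sum.inl i)) k
  have hB := finite_of_linearIndependent hfin (linearIndependent_coe b)
    (d := fun i => d (Sum.inr (Sum.inl i))) (fun i => hd (Sum.inr (Sum.inl i))) k
  have hC := finite_of_linearIndependent hfin (linearIndependent_coe c)
    (d := fun i => d (Sum.inr (Sum.inr i))) (fun i => hd (Sum.inr (Sum.inr i))) k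
  refine ((hH.image Sum.inl).union ((hB.image (Sum.inr ∘ Sum.inl)).union
    (hC.image (Sum.inr ∘ Sum.inr)))).subset ?_
  rintro (i | i | i) hi
  · exact Or.inl ⟨i, hi, rfl⟩
  · exact Or.inr (Or.inl ⟨i, hi, rfl⟩)
  · exact Or.inr (Or.inr ⟨i, hi, rfl⟩)

/-- When i + j = 1 the product i j is even, so graded antisymmetry becomes plain antisymmetry. -/
theorem omega_swap (hV : IsDGSymplectic 𝒱 ω Q) {i j : ℤ} {x y : V} (hx : x ∈ 𝒱 i) (hy : y ∈ 𝒱 j) :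
    ω x y = -ω y x := by
  by_cases h : i + j = 1
  · rw [hV.antisymm i j x hx y hy, neg_one_zpow_even, one_mul]
    have := Int.even_mul_succ_self i
    rw [show j = 1 - i by lia]
    grind
  · rw [hV.degree i j x hx y hy h, hV.degree j i y hy x hx (by lia), neg_zero]

/-- Labels under which the matrix of ω is block diagonal with finite blocks: ω pairs degree d with 1
- d, H with H, and B with C. -/
theorem omega_block (hV : IsDGSymplectic 𝒱 ω Q) (hHodge : IsHodgeDecomposition ω Q H C)
    (hd : ∀ i, assemble a b c i ∈ 𝒱 (d i)) (i j : ιH ⊕ ιB ⊕ ιC)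
    (h : ω (assemble a b c i) (assemble a b c j) ≠ 0) :
    (1 - d i, dualBlock i) = (d j, block j) := by
  refine Prod.ext ?_ ?_
  · by_contra hc
    exact h (hV.degree _ _ _ (hd i) _ (hd j) (by simp at hc; lia))
  · have hsw := omega_swap hV (hd i) (hd j)
    have hB : ∀ k, (b k : V) ∈ LinearMap.range Q ⊔ C := fun k =>
      Submodule.mem_sup_left (b k).2
    have hC : ∀ k, (c k : V) ∈ LinearMap.range Q ⊔ C := fun k =>
      Submodule.mem_sup_right (c k).2
    rcases i with i | i | i <;> rcases j with j | j | j <;> try rfl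
    · exact absurd (hHodge.orthogonal _ (a i).2 _ (hB j)) h
    · exact absurd (hHodge.orthogonal _ (a i).2 _ (hC j)) h
    · exact absurd (hsw.trans (neg_eq_zero.2 (hHodge.orthogonal _ (a j).2 _ (hB i)))) h
    · exact absurd (hHodge.lagrangian_B _ (b i).2 _ (b j).2) h
    · exact absurd (hsw.trans (neg_eq_zero.2 (hHodge.orthogonal _ (a j).2 _ (hC i)))) h
    · exact absurd (hHodge.lagrangian_C _ (c i).2 _ (c j).2) h

theorem matrixQ_degree (h𝒱 : DirectSum.IsInternal 𝒱) (hV : IsDGSymplectic 𝒱 ω Q)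
    (hd : ∀ i, assemble a b c i ∈ 𝒱 (d i)) (i : ιC) (k : ιB) (h : matrixQ Q b c i k ≠ 0) :
    d (Sum.inr (Sum.inr i)) + 1 = d (Sum.inr (Sum.inl k)) := by
  by_contra hc
  refine h (repr_eq_zero_of_degree_ne h𝒱 b (d := fun k => d (Sum.inr (Sum.inl k)))
    (fun k => hd (Sum.inr (Sum.inl k))) (n := d (Sum.inr (Sum.inr i)) + 1) ?_ (Ne.symm hc))
  exact hV.map_degree _ _ (hd (Sum.inr (Sum.inr i)))

theorem finite_block_fiber (hfin : ∀ k, FiniteDimensional 𝕜 (𝒱 k))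
    (hd : ∀ i, assemble a b c i ∈ 𝒱 (d i)) :
    (∀ τ, {i | (1 - d i, dualBlock i) = τ}.Finite) ∧ ∀ τ, {i | (d i, block i) = τ}.Finite := by
  refine ⟨fun τ => (finite_degree_fiber hfin hd (1 - τ.1)).subset ?_,
    fun τ => (finite_degree_fiber hfin hd τ.1).subset ?_⟩
  · rintro i rfl
    simp
  · rintro i rfl
    simp

theorem omega_inv_support (hfin : ∀ k, FiniteDimensional 𝕜 (𝒱 k)) (hV : IsDGSymplectic 𝒱 ω Q)
    (hHodge : IsHodgeDecomposition ω Q H C) (hd : ∀ i, assemble a b c i ∈ 𝒱 (d i))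
    {N : ιH ⊕ ιB ⊕ ιC → ιH ⊕ ιB ⊕ ιC → 𝕜}
    (hN : IsMatrixInverse (fun i j => ω (assemble a b c i) (assemble a b c j)) N)
    (i j : ιH ⊕ ιB ⊕ ιC) (h : N i j ≠ 0) : (1 - d j, dualBlock j) = (d i, block i) :=
  hN.support _ _ (omega_block hV hHodge hd) (finite_block_fiber hfin hd).1
    (finite_block_fiber hfin hd).2 h

/-- The matrix of ω is antisymmetric, so the negative transpose of N is an inverse too, and inverses
are unique. -/
theorem omega_inv_antisymm (hfin : ∀ k, FiniteDimensional 𝕜 (𝒱 k)) (hV : IsDGSymplectic 𝒱 ω Q)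
    (hHodge : IsHodgeDecomposition ω Q H C) (hd : ∀ i, assemble a b c i ∈ 𝒱 (d i))
    {N : ιH ⊕ ιB ⊕ ιC → ιH ⊕ ιB ⊕ ιC → 𝕜}
    (hN : IsMatrixInverse (fun i j => ω (assemble a b c i) (assemble a b c j)) N)
    (i j : ιH ⊕ ιB ⊕ ιC) : N j i = -N i j := by
  refine hN.unique (N' := fun j i => -N i j) ⟨fun i k => ?_, fun j l => ?_⟩ _ _
    (omega_block hV hHodge hd) (finite_block_fiber hfin hd).1 (finite_block_fiber hfin hd).2 j i
  · have h := hN.2 k i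
    rw [delta_comm, ← h]
    refine finsum_congr fun j => ?_
    beta_reduce
    rw [omega_swap hV (hd i) (hd j)]
    ring
  · have h := hN.1 l j
    rw [delta_comm, ← h]
    refine finsum_congr fun i => ?_
    beta_reduce
    rw [omega_swap hV (hd i) (hd l)]
    ring

theorem propagator_support {p : ιH ⊕ ιB ⊕ ιC → ℤ} {N : ιH ⊕ ιB ⊕ ιC → ιH ⊕ ιB ⊕ ιC → 𝕜}
    {Qi : ιB → ιC → 𝕜} (hN : ∀ i j, N i j ≠ 0 → p i + p j = -1)
    (hQ : ∀ k j, Qi k j ≠ 0 → p (Sum.inr (Sum.inr j)) = p (Sum.inr (Sum.inl k)) + 1) {i j : ιC}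
    (h : propagator p N Qi i j ≠ 0) :
    p (Sum.inr (Sum.inr i)) + p (Sum.inr (Sum.inr j)) = 0 := by
  obtain ⟨k, hk⟩ := exists_ne_zero_of_finsum h
  have h1 := hN _ _ (right_ne_zero_of_mul (left_ne_zero_of_mul hk))
  have h2 := hQ _ _ (right_ne_zero_of_mul hk)
  lia

/-- The propagator is graded-symmetric. -/
theorem propagator_symm (hV : IsDGSymplectic 𝒱 ω Q) (hd : ∀ i, assemble a b c i ∈ 𝒱 (d i))
    {p : ιH ⊕ ιB ⊕ ιC → ℤ} (hp : ∀ i, p i = -d i) {N : ιH ⊕ ιB ⊕ ιC → ιH ⊕ ιB ⊕ ιC → 𝕜}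
    (hN : IsMatrixInverse (fun i j => ω (assemble a b c i) (assemble a b c j)) N)
    (hNdeg : ∀ i j, N i j ≠ 0 → p i + p j = -1) (hNfin : ∀ i, {j | N i j ≠ 0}.Finite)
    (hNsup : ∀ (i : ιC) j, N (Sum.inr (Sum.inr i)) j ≠ 0 → ∃ k, j = Sum.inr (Sum.inl k))
    {Qi : ιB → ιC → 𝕜} (hQ : IsMatrixInverse (matrixQ Q b c) Qi)
    (hQdeg : ∀ k j, Qi k j ≠ 0 → p (Sum.inr (Sum.inr j)) = p (Sum.inr (Sum.inl k)) + 1)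
    (hQfin : ∀ k, {j | Qi k j ≠ 0}.Finite) (i j : ιC) :
    propagator p N Qi i j =
      (-1 : 𝕜) ^ (p (Sum.inr (Sum.inr i)) * p (Sum.inr (Sum.inr j))) * propagator p N Qi j i := by
  classical
  set γ : ιC → ιH ⊕ ιB ⊕ ιC := fun i => Sum.inr (Sum.inr i) with hγ
  set β : ιB → ιH ⊕ ιB ⊕ ιC := fun i => Sum.inr (Sum.inl i) with hβ
  have hβinj : Function.Injective β := fun x y h => Sum.inl_injective (Sum.inr_injective h)
  have hNβ : ∀ i, {k | N (γ i) (β k) ≠ 0}.Finite := fun i =>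
    (hNfin (γ i)).preimage hβinj.injOn
  -- preimages of the basis of `B`
  let z : ιB → V := fun k => ∑ᶠ j, Qi k j • (c j : V)
  have hfz : ∀ k, (fun j => Qi k j • (c j : V)).HasFiniteSupport := fun k =>
    (hQfin k).subset fun j hj h => hj (by simp [h])
  have hQz : ∀ k, Q (z k) = b k := by
    intro k
    have h1 : ∑ᶠ j, Qi k j • Q.rangeRestrict (c j) = b k := by
      apply b.repr.injective
      have hf : (fun j => Qi k j • Q.rangeRestrict (c j : V)).HasFiniteSupport :=
        (hQfin k).subset fun j hj h => hj (by simp [h])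
      ext m
      have h2 := map_finsum ((Finsupp.lapply (R := 𝕜) m) ∘ₗ b.repr.toLinearMap) hf
      refine h2.trans ?_
      rw [b.repr_self]
      have h3 := hQ.2 k m
      rw [delta] at h3
      rw [Finsupp.single_apply, ← h3]
      exact finsum_congr fun j => by simp [matrixQ]
    rw [← h1]
    refine (map_finsum Q (hfz k)).trans ?_
    refine Eq.trans ?_ (map_finsum (LinearMap.range Q).subtype
      ((hQfin k).subset fun j hj h => hj (by simp [h]))).symm
    exact finsum_congr fun j => by simp
  -- The vectors y_i of C are chosen so that ω(Q y_i, c_j) = ± δ_{ij}; their coordinates in the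
  -- basis c are the rows of the propagator.
  let y : ιC → V := fun i => ∑ᶠ k, ((-1 : 𝕜) ^ p (γ i) * N (γ i) (β k)) • z k
  have hfy : ∀ i, (fun k => ((-1 : 𝕜) ^ p (γ i) * N (γ i) (β k)) • z k).HasFiniteSupport :=
    fun i => (hNβ i).subset fun k hk h => hk (by simp [h])
  have hQy : ∀ i, Q (y i) = ∑ᶠ k, ((-1 : 𝕜) ^ p (γ i) * N (γ i) (β k)) • (b k : V) := by
    intro i
    refine (map_finsum Q (hfy i)).trans (finsum_congr fun k => ?_)
    rw [map_smul, hQz]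
  have hfy' : ∀ i, (fun k => ((-1 : 𝕜) ^ p (γ i) * N (γ i) (β k)) • (b k : V)).HasFiniteSupport :=
    fun i => (hNβ i).subset fun k hk h => hk (by simp [h])
  have hωy : ∀ i j, ω (Q (y i)) (c j) = (-1 : 𝕜) ^ p (γ i) * delta 𝕜 i j := by
    intro i j
    rw [hQy]
    refine (map_finsum (ω.flip (c j)) (hfy' i)).trans ?_
    have h1 := hN.2 (γ i) (γ j)
    rw [finsum_eq_finsum_comp β hβinj] at h1
    · have h2 : delta 𝕜 (γ i) (γ j) = delta 𝕜 i j := by simp [delta, hγ]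
      rw [← h2, ← h1, mul_finsum']
      · refine finsum_congr fun k => ?_
        simp [assemble, hβ, hγ, mul_assoc]
      · exact (hNβ i).subset fun k hk h => hk (by simp [h])
    · intro x hx
      by_contra hc
      obtain ⟨k, rfl⟩ := hNsup i x (left_ne_zero_of_mul hc)
      exact hx ⟨k, rfl⟩
  -- the coordinates of `y`
  have hyD : ∀ i, y i = ∑ᶠ j, propagator p N Qi i j • (c j : V) ∧
      (fun j => propagator p N Qi i j • (c j : V)).HasFiniteSupport := by
    intro i
    set U := ((hNβ i).biUnion fun k _ => hQfin k) with hU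
    have hsup : ∀ k j, ((-1 : 𝕜) ^ p (γ i) * N (γ i) (β k)) • Qi k j • (c j : V) ≠ 0 →
        k ∈ {k | N (γ i) (β k) ≠ 0} ∧ j ∈ ⋃ k ∈ {k | N (γ i) (β k) ≠ 0}, {j | Qi k j ≠ 0} := by
      intro k j h
      have h1 : N (γ i) (β k) ≠ 0 := fun h0 => h (by simp [h0])
      refine ⟨h1, Set.mem_biUnion (x := k) h1 fun h0 => h (by simp [h0])⟩
    constructor
    · have h1 : y i = ∑ᶠ k, ∑ᶠ j, ((-1 : 𝕜) ^ p (γ i) * N (γ i) (β k)) • Qi k j • (c j : V) :=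
        finsum_congr fun k => smul_finsum' _ (hfz k)
      rw [h1, finsum_comm_of_finite (hNβ i) U hsup]
      refine finsum_congr fun j => ?_
      rw [propagator, finsum_smul']
      · exact finsum_congr fun k => smul_smul _ _ _
      · exact (hNβ i).subset fun k hk h => hk (by simp only [hγ, hβ] at h; simp [h])
    · refine U.subset fun j hj => ?_
      have h1 : propagator p N Qi i j ≠ 0 := fun h0 => hj (by simp [h0])
      obtain ⟨k, hk⟩ := exists_ne_zero_of_finsum h1
      exact Set.mem_biUnion (x := k) (right_ne_zero_of_mul (left_ne_zero_of_mul hk))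
        (right_ne_zero_of_mul hk)
  have hωyy : ∀ i m, ω (Q (y i)) (y m) = (-1 : 𝕜) ^ p (γ i) * propagator p N Qi m i := by
    intro i m
    rw [(hyD m).1]
    refine (map_finsum (ω (Q (y i))) (hyD m).2).trans ?_
    rw [finsum_eq_single _ i]
    · rw [map_smul, hωy, delta_self]
      simp [mul_comm]
    · intro j hj
      rw [map_smul, hωy, delta_of_ne _ hj.symm]
      simp
  have hydeg : ∀ i, y i ∈ 𝒱 (-d (γ i)) := by
    intro i
    rw [(hyD i).1]
    refine finsum_mem_submodule _ fun j => ?_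
    by_cases h : propagator p N Qi i j = 0
    · simp [h]
    · have h1 := propagator_support hNdeg hQdeg h
      rw [hp, hp] at h1
      have h2 := hd (γ j)
      rw [show -d (γ i) = d (γ j) by simp only [hγ]; lia]
      exact Submodule.smul_mem _ _ h2
  -- Compatibility of ω with Q and antisymmetry of ω make ω(Q-,-) graded-symmetric; by `hωyy` its
  -- values on the y_i are, up to sign, the entries of the propagator.
  have hsymm : ∀ i m, ω (Q (y i)) (y m) =
      (-1 : 𝕜) ^ (d (γ i) * d (γ m)) * ω (Q (y m)) (y i) := by
    intro i m
    have h1 := hV.compat _ _ (hydeg i) (y m)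
    have h2 := hV.antisymm _ _ _ (hydeg i) _ (hV.map_degree _ _ (hydeg m))
    rw [h2] at h1
    have h3 : (-1 : 𝕜) ^ (-d (γ i)) * (-1 : 𝕜) ^ (-d (γ i) * (-d (γ m) + 1)) =
        (-1 : 𝕜) ^ (d (γ i) * d (γ m)) := by
      rw [← neg_one_zpow_add, show -d (γ i) + -d (γ i) * (-d (γ m) + 1) =
        d (γ i) * d (γ m) + (-d (γ i) + -d (γ i)) by ring, neg_one_zpow_add,
        neg_one_zpow_even ⟨_, rfl⟩, mul_one]
    rw [← h3]
    linear_combination h1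
  have h1 := hsymm j i
  rw [hωyy, hωyy] at h1
  -- The degree relation needed to compare the remaining signs holds only when some entry is
  -- nonzero.
  by_cases h0 : propagator p N Qi i j = 0 ∧ propagator p N Qi j i = 0
  · rw [h0.1, h0.2, mul_zero]
  · have h2 : p (γ i) + p (γ j) = 0 := by
      rcases not_and_or.1 h0 with h | h
      · exact propagator_support hNdeg hQdeg h
      · rw [add_comm]; exact propagator_support hNdeg hQdeg h
    have h3 : (-1 : 𝕜) ^ p (γ j) = (-1 : 𝕜) ^ p (γ i) := by
      have := neg_one_zpow_eq_of_add_eq_zero (𝕜 := 𝕜) h2 1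
      rw [mul_one, mul_one] at this
      exact this.symm
    have h4 : p (γ i) * p (γ j) = d (γ j) * d (γ i) := by rw [hp, hp]; ring
    rw [h3] at h1
    have h5 : (-1 : 𝕜) ^ p (γ i) ≠ 0 := zpow_ne_zero _ (by simp)
    apply mul_left_cancel₀ h5
    rw [h1]
    change _ = _ * ((-1 : 𝕜) ^ (p (γ i) * p (γ j)) * _)
    rw [h4]
    ring

/-- `invMatrix` is a true inverse or 0, and each listed property also holds for 0, so the argument
does not depend on existence of the inverses. -/
theorem isHodgeMatrices (h𝒱 : DirectSum.IsInternal 𝒱) (hfin : ∀ k, FiniteDimensional 𝕜 (𝒱 k))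
    (hV : IsDGSymplectic 𝒱 ω Q) (hHodge : IsHodgeDecomposition ω Q H C)
    (hd : ∀ i, assemble a b c i ∈ 𝒱 (d i)) {p : ιH ⊕ ιB ⊕ ιC → ℤ} (hp : ∀ i, p i = -d i) :
    IsHodgeMatrices p (invMatrix fun i j => ω (assemble a b c i) (assemble a b c j))
      (invMatrix (matrixQ Q b c)) := by
  have hN := invMatrix_eq_zero_or fun i j => ω (assemble a b c i) (assemble a b c j)
  have hQ := invMatrix_eq_zero_or (matrixQ Q b c)
  set N := invMatrix fun i j => ω (assemble a b c i) (assemble a b c j)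
  set Qi := invMatrix (matrixQ Q b c)
  have hsup : ∀ i j, N i j ≠ 0 → (1 - d j, dualBlock j) = (d i, block i) := by
    intro i j h
    rcases hN with hN | hN
    · exact absurd (by rw [hN]; rfl) h
    · exact omega_inv_support hfin hV hHodge hd hN i j h
  have hQsup : ∀ k j, Qi k j ≠ 0 → d (Sum.inr (Sum.inr j)) + 1 = d (Sum.inr (Sum.inl k)) := by
    intro k j h
    rcases hQ with hQ | hQ
    · exact absurd (by rw [hQ]; rfl) h
    · refine hQ.support (fun j => d (Sum.inr (Sum.inr j)) + 1) (fun k => d (Sum.inr (Sum.inl k)))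
        (matrixQ_degree h𝒱 hV hd) (fun τ => ?_) (fun τ => ?_) h
      · refine ((finite_degree_fiber hfin hd (τ - 1)).preimage
          (Sum.inr_injective.comp Sum.inr_injective).injOn).subset fun j hj => ?_
        have : d (Sum.inr (Sum.inr j)) + 1 = τ := hj
        change d (Sum.inr (Sum.inr j)) = τ - 1
        lia
      · exact (finite_degree_fiber hfin hd τ).preimage
          (Sum.inr_injective.comp Sum.inl_injective).injOn
  have hdeg : ∀ i j, N i j ≠ 0 → p i + p j = -1 := by
    intro i j h
    have := congrArg Prod.fst (hsup i j h)
    rw [hp, hp]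
    simp only at this
    lia
  have hQdeg : ∀ k j, Qi k j ≠ 0 → p (Sum.inr (Sum.inr j)) = p (Sum.inr (Sum.inl k)) + 1 := by
    intro k j h
    have := hQsup k j h
    rw [hp, hp]
    lia
  have hfinN : ∀ i, {j | N i j ≠ 0}.Finite := fun i =>
    (finite_degree_fiber hfin hd (1 - d i)).subset fun j hj => by
      have := congrArg Prod.fst (hsup i j hj)
      simp only at this
      change d j = 1 - d i
      lia
  have hfinQ : ∀ k, {j | Qi k j ≠ 0}.Finite := fun k =>
    ((finite_degree_fiber hfin hd (d (Sum.inr (Sum.inl k)) - 1)).preimage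
      (Sum.inr_injective.comp Sum.inr_injective).injOn).subset fun j hj => by
      have := hQsup k j hj
      change d (Sum.inr (Sum.inr j)) = d (Sum.inr (Sum.inl k)) - 1
      lia
  have hfinQ' : ∀ j, {k | Qi k j ≠ 0}.Finite := fun j =>
    ((finite_degree_fiber hfin hd (d (Sum.inr (Sum.inr j)) + 1)).preimage
      (Sum.inr_injective.comp Sum.inl_injective).injOn).subset fun k hk => (hQsup k j hk).symm
  have hblk : ∀ i j, dualBlock j ≠ block i → N i j = 0 := fun i j h => by
    by_contra hc
    exact h (congrArg Prod.snd (hsup i j hc))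
  refine ⟨hdeg, fun i j => ?_, hfinN, ?_, ?_, ?_, hQdeg, hfinQ, hfinQ', fun i j => ?_⟩
  · rcases hN with hN | hN
    · rw [hN]; simp
    · exact omega_inv_antisymm hfin hV hHodge hd hN i j
  · rintro i (x | x) <;> exact hblk _ _ (by simp [dualBlock, block])
  · exact fun i j => hblk _ _ (by simp [dualBlock, block])
  · exact fun i j => hblk _ _ (by simp [dualBlock, block])
  · rcases hN with hN | hN
    · simp [propagator, hN]
    rcases hQ with hQ | hQ
    · simp [propagator, hQ]
    refine propagator_symm hV hd hp hN hdeg hfinN ?_ hQ hQdeg hfinQ i j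
    rintro i (j | j | j) h
    · exact absurd (hblk _ _ (by simp [dualBlock, block])) h
    · exact ⟨j, rfl⟩
    · exact absurd (hblk _ _ (by simp [dualBlock, block])) h

end Hodge

/-! ### The identity exp(log(1 + X)) = 1 + X. -/

section PowerSeriesExp

open PowerSeries in
-- The composite u satisfies (1 + X) u' = u and u(0) = 1, which determines its coefficients
-- recursively.
theorem exp_subst_log (𝕜 : Type*) [Field 𝕜] [CharZero 𝕜] :
    (exp 𝕜).subst (log 𝕜) = 1 + PowerSeries.X := by
  set u : PowerSeries 𝕜 := (exp 𝕜).subst (log 𝕜) with hu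
  have h1 : derivative 𝕜 u = u * derivative 𝕜 (log 𝕜) := by
    rw [hu, derivative_subst HasSubst.log, derivative_exp]
  have h2 : (1 + PowerSeries.X) * derivative 𝕜 (log 𝕜) = 1 := by
    rw [deriv_log]
    ext n
    rcases n with _ | n
    · simp [add_mul]
    · simp [add_mul, coeff_succ_X_mul, coeff_one, pow_succ]
  have h3 : (1 + PowerSeries.X) * derivative 𝕜 u = u := by
    rw [h1, mul_left_comm, h2, mul_one]
  have h4 : ∀ n : ℕ, coeff (n + 1) u * (n + 1) = (1 - n) * coeff n u := by
    intro n
    have h := congrArg (coeff n) h3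
    rcases n with _ | n
    · rw [add_mul, one_mul, map_add, coeff_derivative] at h
      simp at h
      simpa using h
    · rw [add_mul, one_mul, map_add, coeff_succ_X_mul, coeff_derivative, coeff_derivative] at h
      push_cast at h ⊢
      linear_combination h
  have h0 : coeff 0 u = 1 := by
    rw [coeff_zero_eq_constantCoeff]
    change constantCoeff ((exp 𝕜).subst (log 𝕜)) = 1
    rw [← coeff_zero_eq_constantCoeff_apply, coeff_subst' HasSubst.log,
      finsum_eq_single _ 0 fun n hn => by simp [hn]]
    simp
  have hu1 : coeff 1 u = 1 := by simpa [h0] using h4 0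
  -- The factor 1 - n of the recursion vanishes at n = 1, which kills every coefficient from index 2
  -- on.
  have hu2 : ∀ n, coeff (n + 2) u = 0 := by
    intro n
    induction n with
    | zero => simpa [hu1] using h4 1
    | succ n ih =>
      have h := h4 (n + 2)
      rw [ih, mul_zero] at h
      refine (mul_eq_zero.1 h).resolve_right ?_
      push_cast
      exact_mod_cast (by lia : n + 2 + 1 ≠ 0)
  ext n
  rcases n with _ | _ | n
  · simpa using h0
  · simpa [coeff_one] using hu1
  · rw [hu2 n]
    simp [coeff_one, coeff_X]

end PowerSeriesExp

/-! ### Evaluation of power series in a filtered algebra. -/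

section FilteredRing

variable {𝕜 A : Type*} [Field 𝕜] [Ring A] [Algebra 𝕜 A]

/-- A separated multiplicative decreasing filtration of an algebra. -/
structure IsFiltration (𝕜 : Type*) {A : Type*} [Field 𝕜] [Ring A] [Algebra 𝕜 A]
    (𝓕 : ℕ → AddSubgroup A) : Prop where
  anti : ∀ m n, m ≤ n → 𝓕 n ≤ 𝓕 m
  mul : ∀ m n x y, x ∈ 𝓕 m → y ∈ 𝓕 n → x * y ∈ 𝓕 (m + n)
  algebraMap : ∀ r : 𝕜, algebraMap 𝕜 A r ∈ 𝓕 0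
  separated : ∀ x, (∀ n, x ∈ 𝓕 n) → x = 0

/-- The series `φ` converges to `G` at `F`. -/
def IsEval (𝓕 : ℕ → AddSubgroup A) (φ : PowerSeries 𝕜) (F G : A) : Prop :=
  ∀ N, G - Polynomial.aeval F (PowerSeries.trunc N φ) ∈ 𝓕 N

variable {𝓕 : ℕ → AddSubgroup A} {F G G' : A} {φ ψ : PowerSeries 𝕜}

namespace IsFiltration

theorem pow_mem (h𝓕 : IsFiltration 𝕜 𝓕) (hF : F ∈ 𝓕 1) (n : ℕ) : F ^ n ∈ 𝓕 n := by
  induction n with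
  | zero => simpa using h𝓕.algebraMap 1
  | succ n ih =>
    rw [pow_succ]
    exact h𝓕.mul _ _ _ _ ih hF

theorem aeval_mem (h𝓕 : IsFiltration 𝕜 𝓕) (hF : F ∈ 𝓕 1) {f : Polynomial 𝕜} {N : ℕ}
    (hf : ∀ n < N, f.coeff n = 0) : Polynomial.aeval F f ∈ 𝓕 N := by
  rw [Polynomial.aeval_eq_sum_range]
  refine sum_mem fun n _ => ?_
  rcases lt_or_ge n N with h | h
  · rw [hf n h, zero_smul]
    exact zero_mem _
  · rw [Algebra.smul_def]
    refine h𝓕.anti _ _ h ?_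
    simpa using h𝓕.mul _ _ _ _ (h𝓕.algebraMap _) (h𝓕.pow_mem hF n)

end IsFiltration

namespace IsEval

theorem unique (h𝓕 : IsFiltration 𝕜 𝓕) (hG : IsEval 𝓕 φ F G) (hG' : IsEval 𝓕 φ F G') : G = G' :=
  sub_eq_zero.1 (h𝓕.separated _ fun N => by simpa using sub_mem (hG N) (hG' N))

theorem mem (h𝓕 : IsFiltration 𝕜 𝓕) (hF : F ∈ 𝓕 1) (hG : IsEval 𝓕 φ F G) {N : ℕ}
    (hφ : ∀ n < N, PowerSeries.coeff n φ = 0) : G ∈ 𝓕 N := by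
  have h : Polynomial.aeval F (PowerSeries.trunc N φ) ∈ 𝓕 N :=
    h𝓕.aeval_mem hF fun n hn => by rw [PowerSeries.coeff_trunc, if_pos hn, hφ n hn]
  simpa using add_mem (hG N) h

theorem coe (h𝓕 : IsFiltration 𝕜 𝓕) (hF : F ∈ 𝓕 1) (f : Polynomial 𝕜) :
    IsEval 𝓕 (f : PowerSeries 𝕜) F (Polynomial.aeval F f) := by
  intro N
  rw [← map_sub]
  refine h𝓕.aeval_mem hF fun n hn => ?_
  rw [Polynomial.coeff_sub, PowerSeries.coeff_trunc, if_pos hn, Polynomial.coeff_coe, sub_self]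

theorem one (h𝓕 : IsFiltration 𝕜 𝓕) (hF : F ∈ 𝓕 1) : IsEval 𝓕 (1 : PowerSeries 𝕜) F 1 := by
  simpa using coe h𝓕 hF 1

theorem X (h𝓕 : IsFiltration 𝕜 𝓕) (hF : F ∈ 𝓕 1) : IsEval 𝓕 (PowerSeries.X : PowerSeries 𝕜) F F := by
  simpa using coe h𝓕 hF Polynomial.X

theorem zero : IsEval 𝓕 (0 : PowerSeries 𝕜) F 0 := by
  intro N
  simp [zero_mem]

theorem add (hG : IsEval 𝓕 φ F G) (hG' : IsEval 𝓕 ψ F G') : IsEval 𝓕 (φ + ψ) F (G + G') := by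
  intro N
  rw [map_add, map_add, add_sub_add_comm]
  exact add_mem (hG N) (hG' N)

theorem mul (h𝓕 : IsFiltration 𝕜 𝓕) (hF : F ∈ 𝓕 1) (hG : IsEval 𝓕 φ F G)
    (hG' : IsEval 𝓕 ψ F G') : IsEval 𝓕 (φ * ψ) F (G * G') := by
  intro N
  have h2 := h𝓕.mul _ _ _ _ (hG N) (hG'.mem h𝓕 hF (N := 0) (by simp))
  have h3 := h𝓕.mul _ _ _ _ (h𝓕.aeval_mem (f := PowerSeries.trunc N φ) (N := 0) hF (by simp))
    (hG' N)
  have h4 : Polynomial.aeval F (PowerSeries.trunc N (φ * ψ) -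
      PowerSeries.trunc N φ * PowerSeries.trunc N ψ) ∈ 𝓕 N :=
    h𝓕.aeval_mem hF fun n hn => by
      rw [Polynomial.coeff_sub, PowerSeries.coeff_trunc, if_pos hn,
        PowerSeries.coeff_mul_eq_coeff_trunc_mul_trunc₂ φ ψ hn hn, ← Polynomial.coe_mul,
        Polynomial.coeff_coe, sub_self]
  rw [add_zero] at h2
  rw [zero_add] at h3
  have h := sub_mem (add_mem h2 h3) h4
  rw [map_sub, map_mul (Polynomial.aeval F)] at h
  convert h using 1
  noncomm_ring

theorem smul (h𝓕 : IsFiltration 𝕜 𝓕) (r : 𝕜) (hG : IsEval 𝓕 φ F G) :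
    IsEval 𝓕 (r • φ) F (r • G) := by
  intro N
  have h2 : PowerSeries.trunc N (r • φ) = r • PowerSeries.trunc N φ := by
    ext n
    simp [PowerSeries.coeff_trunc]
  rw [h2, map_smul, ← smul_sub, Algebra.smul_def]
  simpa using h𝓕.mul _ _ _ _ (h𝓕.algebraMap r) (hG N)

theorem pow (h𝓕 : IsFiltration 𝕜 𝓕) (hF : F ∈ 𝓕 1) (hG : IsEval 𝓕 φ F G) (n : ℕ) :
    IsEval 𝓕 (φ ^ n) F (G ^ n) := by
  induction n with
  | zero => simpa using one h𝓕 hF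
  | succ n ih => rw [pow_succ, pow_succ]; exact ih.mul h𝓕 hF hG

theorem sum {s : Finset ℕ} {φ : ℕ → PowerSeries 𝕜} {G : ℕ → A}
    (h : ∀ n ∈ s, IsEval 𝓕 (φ n) F (G n)) : IsEval 𝓕 (∑ n ∈ s, φ n) F (∑ n ∈ s, G n) := by
  classical
  induction s using Finset.induction_on with
  | empty => simpa using zero
  | insert a s ha ih =>
    rw [Finset.sum_insert ha, Finset.sum_insert ha]
    exact (h a (by simp)).add (ih fun n hn => h n (by simp [hn]))

/-- Modulo 𝓕 N only the terms n < N of φ matter, both at G and, as ψ has no constant term, in the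
composite series; on this finite sum the two evaluations agree. -/
theorem subst (h𝓕 : IsFiltration 𝕜 𝓕) (hF : F ∈ 𝓕 1) (hψ : PowerSeries.constantCoeff ψ = 0)
    (hG : IsEval 𝓕 ψ F G) {E E' : A} (hE : IsEval 𝓕 φ G E) (hE' : IsEval 𝓕 (φ.subst ψ) F E') :
    E = E' := by
  have hs : PowerSeries.HasSubst ψ := PowerSeries.HasSubst.of_constantCoeff_zero' hψ
  refine sub_eq_zero.1 (h𝓕.separated _ fun N => ?_)
  have h1 := hE N
  have h0 : Polynomial.aeval G (PowerSeries.trunc N φ) =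
      ∑ n ∈ Finset.range N, PowerSeries.coeff n φ • G ^ n := by
    rw [Polynomial.aeval_def, PowerSeries.eval₂_trunc_eq_sum_range]
    exact Finset.sum_congr rfl fun n _ => (Algebra.smul_def _ _).symm
  rw [h0] at h1
  have h2 : IsEval 𝓕 (∑ n ∈ Finset.range N, PowerSeries.coeff n φ • ψ ^ n) F
      (∑ n ∈ Finset.range N, PowerSeries.coeff n φ • G ^ n) :=
    sum fun n _ => (hG.pow h𝓕 hF n).smul h𝓕 _
  have h3 := (hE'.add (h2.smul h𝓕 (-1))).mem h𝓕 hF (N := N) fun m hm => by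
    rw [map_add, map_smul, map_sum, PowerSeries.coeff_subst' hs,
      finsum_eq_sum_of_forall (Finset.range N)]
    · simp
    · intro n hn
      have h : PowerSeries.coeff m (ψ ^ n) = 0 := by
        refine PowerSeries.coeff_of_lt_order _ (lt_of_lt_of_le ?_
          (PowerSeries.le_order_pow_of_constantCoeff_eq_zero n hψ))
        simp at hn
        exact_mod_cast hm.trans_le hn
      rw [h, smul_zero]
  have h := sub_mem h1 h3
  rw [neg_smul, one_smul] at h
  convert h using 1
  abel

end IsEval

theorem neg_one_pow_smul_pow (F : A) (n : ℕ) : (-1 : 𝕜) ^ n • F ^ n = (-F) ^ n := by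
  rw [neg_pow F, Algebra.smul_def, map_pow, map_neg, map_one]

end FilteredRing

/-! ### The weight filtration; exponential and logarithm of formal sums. -/

section Filtration

variable {𝕜 : Type*} [Field 𝕜] {ι : Type*} {p : ι → ℤ}

/-- The formal sums all of whose parts have weight at least `w`. -/
def fil (𝕜 : Type*) [Field 𝕜] {ι : Type*} (p : ι → ℤ) (w : ℤ) : AddSubgroup (Formal 𝕜 p) where
  carrier := {F | ∀ v < w, F.coeff v = 0}
  add_mem' {F G} hF hG v hv := by rw [HahnSeries.coeff_add, hF v hv, hG v hv, add_zero]
  zero_mem' v _ := HahnSeries.coeff_zero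
  neg_mem' {F} hF v hv := by rw [HahnSeries.coeff_neg, hF v hv, neg_zero]

theorem smul_mem_fil {w : ℤ} (r : 𝕜) {F : Formal 𝕜 p} (hF : F ∈ fil 𝕜 p w) :
    r • F ∈ fil 𝕜 p w := fun v hv => by
  rw [HahnSeries.coeff_smul, hF v hv, smul_zero]

theorem fil_mono {v w : ℤ} (h : v ≤ w) : fil 𝕜 p w ≤ fil 𝕜 p v := fun _ hF u hu =>
  hF u (hu.trans_le h)

theorem exists_mem_fil (F : Formal 𝕜 p) : ∃ w, F ∈ fil 𝕜 p w :=
  ⟨F.order, fun _ hv => HahnSeries.coeff_eq_zero_of_lt_order hv⟩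

theorem coeff_mul_eq_finsum (F G : Formal 𝕜 p) (w : ℤ) :
    (F * G).coeff w = ∑ᶠ u, F.coeff u * G.coeff (w - u) := by
  rw [HahnSeries.coeff_mul]
  set s := Finset.antidiagonal F.isPWO_support G.isPWO_support w
  have h : ∀ x ∈ s, x.2 = w - x.1 := fun x hx => by
    have := (Finset.mem_antidiagonal.1 hx).2.2
    lia
  rw [Finset.sum_congr rfl fun x hx => by rw [h x hx]]
  classical
  rw [← Finset.sum_image (f := fun u => F.coeff u * G.coeff (w - u)) (g := Prod.fst)]
  · refine (finsum_eq_sum_of_forall _ fun u hu => ?_).symm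
    by_contra hc
    refine hu (Finset.mem_image.2 ⟨(u, w - u), Finset.mem_antidiagonal.2 ⟨?_, ?_, ?_⟩, rfl⟩)
    · exact left_ne_zero_of_mul hc
    · exact right_ne_zero_of_mul hc
    · simp
  · intro x hx y hy hxy
    exact Prod.ext hxy (by rw [h x hx, h y hy, hxy])

theorem finite_conv {A B : Type*} [Zero A] [Zero B] {f : ℤ → A} {g : ℤ → B} {a b : ℤ}
    (hf : ∀ v < a, f v = 0) (hg : ∀ v < b, g v = 0) (w : ℤ) :
    {u | f u ≠ 0 ∧ g (w - u) ≠ 0}.Finite := by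
  refine (Set.finite_Icc a (w - b)).subset fun u hu => ⟨?_, ?_⟩
  · by_contra hc
    exact hu.1 (hf u (by lia))
  · by_contra hc
    exact hu.2 (hg _ (by lia))

theorem finite_conv_formal {q : ι → ℤ} (F : Formal 𝕜 p) (G : Formal 𝕜 q) (w : ℤ) :
    {u | F.coeff u ≠ 0 ∧ G.coeff (w - u) ≠ 0}.Finite := by
  obtain ⟨a, ha⟩ := exists_mem_fil F
  obtain ⟨b, hb⟩ := exists_mem_fil G
  exact finite_conv ha hb w

theorem mul_mem_fil {a b : ℤ} {F G : Formal 𝕜 p} (hF : F ∈ fil 𝕜 p a) (hG : G ∈ fil 𝕜 p b) :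
    F * G ∈ fil 𝕜 p (a + b) := by
  intro v hv
  rw [coeff_mul_eq_finsum]
  refine finsum_eq_zero_of_forall_eq_zero fun u => ?_
  rcases lt_or_ge u a with hu | hu
  · rw [hF u hu, zero_mul]
  · rw [hG (v - u) (by lia), mul_zero]

theorem one_mem_fil : (1 : Formal 𝕜 p) ∈ fil 𝕜 p 0 := by
  intro v hv
  rw [HahnSeries.coeff_one, if_neg hv.ne]

theorem pow_mem_fil {F : Formal 𝕜 p} (hF : F ∈ fil 𝕜 p 1) (n : ℕ) : F ^ n ∈ fil 𝕜 p n := by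
  induction n with
  | zero => simpa using one_mem_fil
  | succ n ih =>
    rw [pow_succ]
    exact_mod_cast mul_mem_fil ih hF

theorem summable_of_fil {α : Type*} {x : α → Formal 𝕜 p} {w₀ : ℤ} (h : ∀ a, x a ∈ fil 𝕜 p w₀)
    (hfin : ∀ w, {a | (x a).coeff w ≠ 0}.Finite) : Summable x := by
  refine ⟨Set.isPWO_iff_isWF.2 (BddBelow.isWF ⟨w₀, fun v hv => ?_⟩), hfin⟩
  obtain ⟨a, ha⟩ := Set.mem_iUnion.1 hv
  by_contra hc
  exact ha (h a v (by lia))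

theorem coeff_formalSum {α : Type*} {x : α → Formal 𝕜 p} (h : Summable x) (w : ℤ) :
    (formalSum x).coeff w = ∑ᶠ a, (x a).coeff w := by
  rw [formalSum, dif_pos h, HahnSeries.SummableFamily.coeff_hsum]
  rfl

theorem summable_nat {x : ℕ → Formal 𝕜 p} {w₀ : ℤ} (h : ∀ n, x n ∈ fil 𝕜 p w₀)
    (hfin : ∀ w, ∃ N, ∀ n, N ≤ n → (x n).coeff w = 0) : Summable x := by
  refine summable_of_fil h fun w => ?_
  obtain ⟨N, hN⟩ := hfin w
  refine (Set.finite_lt_nat N).subset fun n hn => ?_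
  by_contra hc
  exact hn (hN n (by simpa using hc))

theorem summable_of_mem_fil_nat {x : ℕ → Formal 𝕜 p} (h : ∀ n : ℕ, x n ∈ fil 𝕜 p n) :
    Summable x :=
  summable_nat (w₀ := 0) (fun n => fil_mono (by simp) (h n)) fun w =>
    ⟨(w + 1).toNat, fun n hn => h n w (by lia)⟩

theorem formalSum_sub_mem_fil {x : ℕ → Formal 𝕜 p} (h : ∀ n : ℕ, x n ∈ fil 𝕜 p n) (N : ℕ) :
    formalSum x - ∑ n ∈ Finset.range N, x n ∈ fil 𝕜 p N := by
  intro w hw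
  rw [HahnSeries.coeff_sub, coeff_formalSum (summable_of_mem_fil_nat h),
    HahnSeries.coeff_sum, finsum_eq_sum_of_forall (Finset.range N), sub_self]
  intro n hn
  exact h n w (by simp at hn; lia)

theorem formalSum_congr {α : Type*} {x y : α → Formal 𝕜 p} (h : ∀ a, x a = y a) :
    formalSum x = formalSum y := by
  rw [funext h]

/-- Substitution of a formal sum of positive weight into a power series. -/
def evalSeries (φ : PowerSeries 𝕜) (F : Formal 𝕜 p) : Formal 𝕜 p :=
  formalSum fun n : ℕ => PowerSeries.coeff n φ • F ^ n

variable {F : Formal 𝕜 p}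

theorem isFiltration_fil : IsFiltration 𝕜 (A := Formal 𝕜 p) (fun n : ℕ => fil 𝕜 p n) where
  anti m n h := fil_mono (by exact_mod_cast h)
  mul m n x y hx hy := by exact_mod_cast mul_mem_fil hx hy
  algebraMap r v hv := by
    rw [HahnSeries.algebraMap_apply, HahnSeries.C_apply, HahnSeries.coeff_single_of_ne]
    exact_mod_cast hv.ne
  separated x h := by
    ext w
    exact h (w + 1).toNat w (by lia)

theorem smul_pow_mem_fil (hF : F ∈ fil 𝕜 p 1) (c : ℕ → 𝕜) (n : ℕ) : c n • F ^ n ∈ fil 𝕜 p n :=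
  smul_mem_fil _ (pow_mem_fil hF n)

theorem isEval_evalSeries (hF : F ∈ fil 𝕜 p 1) (φ : PowerSeries 𝕜) :
    IsEval (A := Formal 𝕜 p) (fun n : ℕ => fil 𝕜 p n) φ F (evalSeries φ F) := by
  intro N
  have h := formalSum_sub_mem_fil (smul_pow_mem_fil hF fun n => PowerSeries.coeff n φ) N
  have h2 : Polynomial.aeval F (PowerSeries.trunc N φ) =
      ∑ n ∈ Finset.range N, PowerSeries.coeff n φ • F ^ n := by
    rw [Polynomial.aeval_def, PowerSeries.eval₂_trunc_eq_sum_range]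
    exact Finset.sum_congr rfl fun n _ => (Algebra.smul_def _ _).symm
  rw [h2]
  exact h

variable [CharZero 𝕜]

theorem formalExp_eq (F : Formal 𝕜 p) : formalExp F = evalSeries (PowerSeries.exp 𝕜) F :=
  formalSum_congr fun n => by rw [PowerSeries.coeff_exp]; simp

theorem formalExp_neg_mul (hF : F ∈ fil 𝕜 p 1) : formalExp (-F) * formalExp F = 1 := by
  have h : formalExp (-F) = evalSeries (PowerSeries.evalNegHom (PowerSeries.exp 𝕜)) F :=
    formalSum_congr fun n => by
      rw [PowerSeries.evalNegHom, PowerSeries.coeff_rescale, PowerSeries.coeff_exp,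
        mul_comm ((-1 : 𝕜) ^ n), mul_smul]
      rw [show (algebraMap ℚ 𝕜) (1 / n.factorial) = (n.factorial : 𝕜)⁻¹ by simp]
      exact congrArg _ (neg_one_pow_smul_pow (𝕜 := 𝕜) F n).symm
  rw [h, formalExp_eq]
  have h1 := (isEval_evalSeries hF (PowerSeries.evalNegHom (PowerSeries.exp 𝕜))).mul
    isFiltration_fil hF (isEval_evalSeries hF (PowerSeries.exp 𝕜))
  rw [mul_comm, PowerSeries.exp_mul_exp_neg_eq_one] at h1
  exact h1.unique isFiltration_fil (IsEval.one isFiltration_fil hF)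

/-- An index shift by one: `formalLog` starts at exponent 1, while the power series has an extra
constant coefficient 0. -/
theorem formalLog_eq (hF : F - 1 ∈ fil 𝕜 p 1) :
    formalLog F = evalSeries (PowerSeries.log 𝕜) (F - 1) := by
  ext w
  rw [formalLog, evalSeries, coeff_formalSum, coeff_formalSum
    (summable_of_mem_fil_nat (smul_pow_mem_fil hF _)),
    finsum_eq_finsum_comp Nat.succ Nat.succ_injective (f := fun n : ℕ =>
      (PowerSeries.coeff n (PowerSeries.log 𝕜) • (F - 1) ^ n).coeff w)]
  · refine finsum_congr fun n => ?_
    rw [PowerSeries.coeff_log]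
    simp [pow_succ]
  · intro n hn
    obtain rfl : n = 0 := by
      by_contra hc
      exact hn ⟨n - 1, Nat.succ_pred_eq_of_ne_zero hc⟩
    simp
  · exact summable_of_mem_fil_nat fun n =>
      fil_mono (by push_cast; lia) (smul_mem_fil _ (pow_mem_fil hF (n + 1)))

theorem formalLog_mem_fil (hF : F - 1 ∈ fil 𝕜 p 1) : formalLog F ∈ fil 𝕜 p 1 := by
  rw [formalLog_eq hF]
  refine (isEval_evalSeries hF _).mem isFiltration_fil (N := 1) hF fun n hn => ?_
  obtain rfl : n = 0 := by lia
  simp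

theorem formalExp_formalLog (hF : F - 1 ∈ fil 𝕜 p 1) : formalExp (formalLog F) = F := by
  have h1 : IsEval (A := Formal 𝕜 p) (fun n : ℕ => fil 𝕜 p n) ((PowerSeries.exp 𝕜).subst (PowerSeries.log 𝕜))
      (F - 1) (1 + (F - 1)) := by
    rw [exp_subst_log]
    exact (IsEval.one isFiltration_fil hF).add (IsEval.X isFiltration_fil hF)
  have h2 := isEval_evalSeries (formalLog_mem_fil hF) (PowerSeries.exp 𝕜)
  rw [formalExp_eq]
  rw [formalLog_eq hF] at h2 ⊢
  refine (IsEval.subst isFiltration_fil hF PowerSeries.constantCoeff_log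
    (isEval_evalSeries hF _) h2 h1).trans ?_
  ext w
  simp [HahnSeries.coeff_add]

end Filtration

/-! ### Laplacian, bracket and exponential, weight by weight. -/

section Coefficients

variable {𝕜 : Type*} [Field 𝕜] {ι : Type*} {p : ι → ℤ}

theorem finsum_prod_eq {α β N : Type*} [AddCommMonoid N] {f : α → β → N} {s : Set α}
    {t : Set β} (hs : s.Finite) (ht : t.Finite) (h : ∀ a b, f a b ≠ 0 → a ∈ s ∧ b ∈ t) :
    ∑ᶠ x : α × β, f x.1 x.2 = ∑ᶠ b, ∑ᶠ a, f a b := by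
  rw [finsum_curry (fun x : α × β => f x.1 x.2) ((hs.prod ht).subset fun x hx => h _ _ hx)]
  exact finsum_comm_of_finite hs ht h

theorem coeff_dL (i : ι) (F : Formal 𝕜 p) (w : ℤ) :
    (dL i F).coeff w = polDL i (F.coeff (w + 1)) := by
  rw [dL, HahnSeries.coeff_single_mul, one_mul, sub_neg_eq_add]
  rfl

theorem coeff_dR (i : ι) (F : Formal 𝕜 p) (w : ℤ) :
    (dR i F).coeff w = polDR i (F.coeff (w + 1)) := by
  rw [dR, HahnSeries.coeff_single_mul, one_mul, sub_neg_eq_add]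
  rfl

theorem coeff_hbar_mul (g : ℤ) (F : Formal 𝕜 p) (w : ℤ) :
    (hbar 𝕜 p g * F).coeff w = F.coeff (w - 2 * g) := by
  rw [hbar, HahnSeries.coeff_single_mul, one_mul]

theorem dL_mem_fil {a : ℤ} {F : Formal 𝕜 p} (hF : F ∈ fil 𝕜 p a) (i : ι) :
    dL i F ∈ fil 𝕜 p (a - 1) := fun v hv => by
  rw [coeff_dL, hF _ (by lia), map_zero]

theorem dR_mem_fil {a : ℤ} {F : Formal 𝕜 p} (hF : F ∈ fil 𝕜 p a) (i : ι) :
    dR i F ∈ fil 𝕜 p (a - 1) := fun v hv => by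
  rw [coeff_dR, hF _ (by lia), map_zero]

theorem polDL_polDL_ne_zero {i j : ι} {x : Pol 𝕜 p} (h : polDL i (polDL j x) ≠ 0) :
    polDL i x ≠ 0 ∧ polDL j x ≠ 0 := by
  refine ⟨fun hi => h ?_, fun hj => h (by rw [hj, map_zero])⟩
  rw [polDL_comm, hi, map_zero, smul_zero]

/-- The matrix `(-1)^{|φ^i|} ω^{ij}`. -/
def signed (p : ι → ℤ) (ωi : ι → ι → 𝕜) (i j : ι) : 𝕜 := (-1 : 𝕜) ^ p i * ωi i j

theorem coeff_smul_dL_dL (M : ι → ι → 𝕜) (F : Formal 𝕜 p) (x : ι × ι) (w : ℤ) :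
    (M x.1 x.2 • dL x.1 (dL x.2 F)).coeff w =
      M x.1 x.2 • polDL x.1 (polDL x.2 (F.coeff (w + 2))) := by
  rw [HahnSeries.coeff_smul, coeff_dL, coeff_dL, add_assoc]
  rfl

theorem summable_lap (M : ι → ι → 𝕜) (F : Formal 𝕜 p) :
    Summable fun x : ι × ι => M x.1 x.2 • dL x.1 (dL x.2 F) := by
  obtain ⟨a, ha⟩ := exists_mem_fil F
  refine summable_of_fil (fun x => smul_mem_fil _ (dL_mem_fil (dL_mem_fil ha _) _)) fun w => ?_
  have hJ := finite_polDL_ne_zero (F.coeff (w + 2))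
  refine (hJ.prod hJ).subset fun x hx => ?_
  rw [Set.mem_ofPred_eq, coeff_smul_dL_dL] at hx
  exact polDL_polDL_ne_zero (right_ne_zero_of_smul hx)

theorem coeff_lap (ωi : ι → ι → 𝕜) (F : Formal 𝕜 p) (w : ℤ) :
    (lap ωi F).coeff w = (1 / 2 : 𝕜) • secondOrder (signed p ωi) (F.coeff (w + 2)) := by
  rw [lap, HahnSeries.coeff_smul]
  change (1 / 2 : 𝕜) • (formalSum fun x : ι × ι =>
    signed p ωi x.1 x.2 • dL x.1 (dL x.2 F)).coeff w = _
  rw [coeff_formalSum (summable_lap (signed p ωi) F), secondOrder_apply]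
  congr 1
  rw [finsum_congr fun x => coeff_smul_dL_dL (signed p ωi) F x w]
  have hJ := finite_polDL_ne_zero (F.coeff (w + 2))
  exact finsum_prod_eq (f := fun i j => signed p ωi i j • polDL i (polDL j (F.coeff (w + 2)))) hJ hJ
    fun a b h => polDL_polDL_ne_zero (right_ne_zero_of_smul h)

theorem polDR_of_degree_zero (i : ι) {x : Pol 𝕜 p} (hx : x ∈ homog p 0) :
    polDR i x = (-1 : 𝕜) ^ p i • polDL i x := by
  rw [polDR_eq, sgn_of_mem hx]
  simp

/-- Each derivative lowers the weight by 1. Charging both shifts to F makes the index u that of F/ħ,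
the form needed for F = S_int. -/
theorem coeff_dR_mul_dL {F : Formal 𝕜 p} (hF : ∀ w, F.coeff w ∈ homog p 0) (G : Formal 𝕜 p)
    (i j : ι) (w : ℤ) : (dR i F * dL j G).coeff w =
      ∑ᶠ u, (-1 : 𝕜) ^ p i • (polDL i (F.coeff (u + 2)) * polDL j (G.coeff (w - u))) := by
  rw [coeff_mul_eq_finsum, ← finsum_comp_equiv (Equiv.addRight (1 : ℤ))]
  refine finsum_congr fun u => ?_
  rw [Equiv.coe_addRight, coeff_dR, coeff_dL, polDR_of_degree_zero i (hF _), smul_mul_assoc,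
    show u + 1 + 1 = u + 2 by ring, show w - (u + 1) + 1 = w - u by ring]

theorem finite_bracket (F G : Formal 𝕜 p) (w : ℤ) :
    ∃ (s t : Set ι) (U : Set ℤ), s.Finite ∧ t.Finite ∧ U.Finite ∧ ∀ i j u,
      polDL i (F.coeff (u + 2)) * polDL j (G.coeff (w - u)) ≠ 0 → i ∈ s ∧ j ∈ t ∧ u ∈ U := by
  obtain ⟨a, ha⟩ := exists_mem_fil F
  obtain ⟨b, hb⟩ := exists_mem_fil G
  have hU := finite_conv (f := fun u => F.coeff (u + 2)) (g := G.coeff) (a := a - 2) (b := b)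
    (fun v hv => ha _ (by lia)) hb w
  refine ⟨_, _, _, hU.biUnion fun u _ => finite_polDL_ne_zero (F.coeff (u + 2)),
    hU.biUnion fun u _ => finite_polDL_ne_zero (G.coeff (w - u)), hU, fun i j u h => ?_⟩
  have h1 := left_ne_zero_of_mul h
  have h2 := right_ne_zero_of_mul h
  have hu : F.coeff (u + 2) ≠ 0 ∧ G.coeff (w - u) ≠ 0 :=
    ⟨fun hc => h1 (by rw [hc, map_zero]), fun hc => h2 (by rw [hc, map_zero])⟩
  exact ⟨Set.mem_biUnion hu h1, Set.mem_biUnion hu h2, hu⟩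

theorem summable_bracket (ωi : ι → ι → 𝕜) {F : Formal 𝕜 p} (hF : ∀ w, F.coeff w ∈ homog p 0)
    (G : Formal 𝕜 p) : Summable fun x : ι × ι => ωi x.1 x.2 • (dR x.1 F * dL x.2 G) := by
  obtain ⟨a, ha⟩ := exists_mem_fil F
  obtain ⟨b, hb⟩ := exists_mem_fil G
  refine summable_of_fil
    (fun x => smul_mem_fil _ (mul_mem_fil (dR_mem_fil ha _) (dL_mem_fil hb _))) fun w => ?_
  obtain ⟨s, t, U, hs, ht, -, h⟩ := finite_bracket F G w
  refine (hs.prod ht).subset fun x hx => ?_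
  rw [Set.mem_ofPred_eq, HahnSeries.coeff_smul, coeff_dR_mul_dL hF] at hx
  obtain ⟨u, hu⟩ := exists_ne_zero_of_finsum (right_ne_zero_of_smul hx)
  exact ⟨(h _ _ u (right_ne_zero_of_smul hu)).1, (h _ _ u (right_ne_zero_of_smul hu)).2.1⟩

theorem coeff_bracket (ωi : ι → ι → 𝕜) {F : Formal 𝕜 p} (hF : ∀ w, F.coeff w ∈ homog p 0)
    (G : Formal 𝕜 p) (w : ℤ) : (bracket ωi F G).coeff w =
      ∑ᶠ u, bidiff (signed p ωi) (F.coeff (u + 2)) (G.coeff (w - u)) := by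
  obtain ⟨s, t, U, hs, ht, hU, h⟩ := finite_bracket F G w
  have h1 : ∀ x : ι × ι, (ωi x.1 x.2 • (dR x.1 F * dL x.2 G)).coeff w =
      ∑ᶠ u, signed p ωi x.1 x.2 •
        (polDL x.1 (F.coeff (u + 2)) * polDL x.2 (G.coeff (w - u))) := fun x => by
    rw [HahnSeries.coeff_smul, coeff_dR_mul_dL hF, smul_finsum]
    exact finsum_congr fun u => by rw [smul_smul, signed, mul_comm]
  rw [bracket, coeff_formalSum (summable_bracket ωi hF G), finsum_congr h1,
    finsum_comm_of_finite (hs.prod ht) hU fun x u hx => by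
      obtain ⟨h1, h2, h3⟩ := h _ _ _ (right_ne_zero_of_smul hx)
      exact ⟨⟨h1, h2⟩, h3⟩]
  refine finsum_congr fun u => ?_
  rw [finsum_prod_eq (f := fun i j => signed p ωi i j •
    (polDL i (F.coeff (u + 2)) * polDL j (G.coeff (w - u)))) hs ht fun i j hx => by
      obtain ⟨h1, h2, h3⟩ := h _ _ _ (right_ne_zero_of_smul hx)
      exact ⟨h1, h2⟩, bidiff_apply]
  refine finsum_congr fun j => ?_
  rw [contract_apply, finsum_mul' _ _ (hasFiniteSupport_of_polDL (F.coeff (u + 2))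
    fun k hk => by simp [hk])]
  exact finsum_congr fun i => by rw [smul_mul_assoc]

theorem formalSum_coeff_mem {α : Type*} {x : α → Formal 𝕜 p} {w : ℤ}
    (P : Submodule 𝕜 (Pol 𝕜 p)) (h : ∀ a, (x a).coeff w ∈ P) : (formalSum x).coeff w ∈ P := by
  by_cases hx : Summable x
  · rw [coeff_formalSum hx]
    exact finsum_mem_submodule P h
  · rw [formalSum, dif_neg hx, HahnSeries.coeff_zero]
    exact zero_mem P

theorem mul_coeff_mem {P P' P'' : ℤ → Submodule 𝕜 (Pol 𝕜 p)}
    (h : ∀ u v, ∀ x ∈ P u, ∀ y ∈ P' v, x * y ∈ P'' (u + v)) {F G : Formal 𝕜 p}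
    (hF : ∀ w, F.coeff w ∈ P w) (hG : ∀ w, G.coeff w ∈ P' w) (w : ℤ) : (F * G).coeff w ∈ P'' w := by
  rw [coeff_mul_eq_finsum]
  refine finsum_mem_submodule _ fun u => ?_
  have := h u (w - u) _ (hF _) _ (hG _)
  rwa [add_sub_cancel] at this

theorem pow_coeff_mem {P : ℤ → Submodule 𝕜 (Pol 𝕜 p)} (h1 : 1 ∈ P 0)
    (h : ∀ u v, ∀ x ∈ P u, ∀ y ∈ P v, x * y ∈ P (u + v)) {F : Formal 𝕜 p}
    (hF : ∀ w, F.coeff w ∈ P w) (n : ℕ) (w : ℤ) : (F ^ n).coeff w ∈ P w := by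
  induction n generalizing w with
  | zero =>
    rw [pow_zero, HahnSeries.coeff_one]
    split_ifs with hw
    · exact hw ▸ h1
    · exact zero_mem _
  | succ n ih => rw [pow_succ]; exact mul_coeff_mem h ih hF w

theorem formalExp_coeff_mem {P : ℤ → Submodule 𝕜 (Pol 𝕜 p)} (h1 : 1 ∈ P 0)
    (h : ∀ u v, ∀ x ∈ P u, ∀ y ∈ P v, x * y ∈ P (u + v)) {F : Formal 𝕜 p}
    (hF : ∀ w, F.coeff w ∈ P w) (w : ℤ) : (formalExp F).coeff w ∈ P w :=
  formalSum_coeff_mem _ fun n => by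
    rw [HahnSeries.coeff_smul]
    exact Submodule.smul_mem _ _ (pow_coeff_mem h1 h hF n w)

theorem formalExp_coeff_mem_homog {F : Formal 𝕜 p} (hF : ∀ w, F.coeff w ∈ homog p 0) (w : ℤ) :
    (formalExp F).coeff w ∈ homog p 0 :=
  formalExp_coeff_mem (P := fun _ => homog p 0) (one_mem_homog p)
    (fun _ _ _ hx _ hy => by simpa using mul_mem_homog hx hy) hF w

theorem mul_comm_of_degree_zero {F : Formal 𝕜 p} (hF : ∀ w, F.coeff w ∈ homog p 0)
    (G : Formal 𝕜 p) : F * G = G * F := by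
  ext w
  rw [coeff_mul_eq_finsum, coeff_mul_eq_finsum, ← finsum_comp_equiv (Equiv.subLeft w)]
  refine finsum_congr fun u => ?_
  rw [Equiv.subLeft_apply, sub_sub_cancel, mul_comm_of_mem_homog (hF _)]
  congr 1
  refine Pol.algHom_ext (f := sgn 0) (g := AlgHom.id 𝕜 _) (fun i => ?_) _
  simp [sgn_X]

theorem formal_mul_smul (r : 𝕜) (F G : Formal 𝕜 p) : F * (r • G) = r • (F * G) := by
  ext w
  rw [HahnSeries.coeff_smul, coeff_mul_eq_finsum, coeff_mul_eq_finsum, smul_finsum]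
  exact finsum_congr fun u => by rw [HahnSeries.coeff_smul, mul_smul_comm]

theorem map_polDL_mul (j : ι) {F : Formal 𝕜 p} (hF : ∀ w, F.coeff w ∈ homog p 0)
    (G : Formal 𝕜 p) : (F * G).map (polDL j) = F.map (polDL j) * G + F * G.map (polDL j) := by
  ext w
  have hfin := finite_conv_formal F G w
  rw [HahnSeries.coeff_add, HahnSeries.map_coeff, coeff_mul_eq_finsum, coeff_mul_eq_finsum,
    coeff_mul_eq_finsum, map_finsum, ← finsum_add_distrib]
  · refine finsum_congr fun u => ?_
    rw [polDL_mul, sgn_of_mem (hF u), HahnSeries.map_coeff, HahnSeries.map_coeff]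
    simp
  all_goals
    refine hfin.subset fun u hu => ⟨fun h => hu ?_, fun h => hu ?_⟩ <;> simp [h]

theorem map_polDL_pow (j : ι) {F : Formal 𝕜 p} (hF : ∀ w, F.coeff w ∈ homog p 0) (n : ℕ) :
    (F ^ (n + 1)).map (polDL j) = ((n : 𝕜) + 1) • (F.map (polDL j) * F ^ n) := by
  induction n with
  | zero =>
    ext w
    simp
  | succ n ih =>
    rw [pow_succ' F (n + 1), map_polDL_mul j hF, ih, formal_mul_smul, ← mul_assoc F,
      mul_comm_of_degree_zero hF (F.map _), mul_assoc, ← pow_succ']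
    ext w
    rw [HahnSeries.coeff_add, HahnSeries.coeff_smul, HahnSeries.coeff_smul]
    push_cast
    module

/-- The weights of F are bounded below, so a far enough tail of the series, multiplied by F, does
not reach weight w. -/
theorem coeff_mul_formalSum (F : Formal 𝕜 p) {x : ℕ → Formal 𝕜 p} (h : ∀ n : ℕ, x n ∈ fil 𝕜 p n)
    (w : ℤ) : (F * formalSum x).coeff w = ∑ᶠ n, (F * x n).coeff w := by
  obtain ⟨b, hb⟩ := exists_mem_fil F
  set N := (w - b + 1).toNat
  have h1 : (F * formalSum x - F * ∑ n ∈ Finset.range N, x n).coeff w = 0 :=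
    (congrArg (fun G => HahnSeries.coeff G w) (mul_sub F (formalSum x) _)).symm.trans
      (mul_mem_fil hb (formalSum_sub_mem_fil h N) w (by lia))
  rw [HahnSeries.coeff_sub, sub_eq_zero, Finset.mul_sum, HahnSeries.coeff_sum] at h1
  rw [h1, finsum_eq_sum_of_forall (Finset.range N)]
  intro n hn
  exact mul_mem_fil hb (h n) w (by simp at hn; lia)

/-- F has degree 0, hence is central, so ∂_j obeys the ordinary power rule on F^n; summing over n
gives the chain rule for exp. -/
theorem map_polDL_formalExp [CharZero 𝕜] (j : ι) {F : Formal 𝕜 p}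
    (hF : ∀ w, F.coeff w ∈ homog p 0) (hF1 : F ∈ fil 𝕜 p 1) :
    (formalExp F).map (polDL j) = F.map (polDL j) * formalExp F := by
  ext w
  have hs := smul_pow_mem_fil hF1 fun n => (n.factorial : 𝕜)⁻¹
  have hfin := (summable_of_mem_fil_nat hs).2 w
  rw [HahnSeries.map_coeff, formalExp, coeff_mul_formalSum _ hs,
    coeff_formalSum (summable_of_mem_fil_nat hs), map_finsum _ hfin,
    finsum_eq_finsum_comp Nat.succ Nat.succ_injective]
  · refine finsum_congr fun n => ?_
    have h := congrArg (fun G => G.coeff w) (map_polDL_pow j hF n)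
    simp only [HahnSeries.map_coeff, HahnSeries.coeff_smul] at h
    rw [HahnSeries.coeff_smul, map_smul, h, formal_mul_smul, HahnSeries.coeff_smul, smul_smul,
      Nat.factorial_succ]
    congr 1
    push_cast
    field_simp
  · intro n hn
    obtain rfl : n = 0 := by
      by_contra hc
      exact hn ⟨n - 1, Nat.succ_pred_eq_of_ne_zero hc⟩
    rw [HahnSeries.coeff_smul, pow_zero, HahnSeries.coeff_one]
    split_ifs <;> simp

end Coefficients

/-! ### The homotopy K and the perturbations δ₁, δ₂ on coefficients. -/

section Homotopy

variable {𝕜 : Type*} [Field 𝕜] {ιH ιB ιC : Type*} {p : ιH ⊕ ιB ⊕ ιC → ℤ}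

/-- The operator `∑ k i, β^k (Q⁻¹)_k^i ∂_L/∂γ^i` on polynomials. -/
def koszul (Qi : ιB → ιC → 𝕜) : Pol 𝕜 p →ₗ[𝕜] Pol 𝕜 p :=
  finsumLin (fun i : ιC => LinearMap.mulLeft 𝕜 (∑ᶠ k : ιB, Qi k i • X p (Sum.inr (Sum.inl k))) ∘ₗ
    polDL (Sum.inr (Sum.inr i))) fun x =>
      ((finite_polDL_ne_zero x).preimage (Sum.inr_injective.comp Sum.inr_injective).injOn).subset
        fun i hi h => hi (by simp [show polDL (Sum.inr (Sum.inr i)) x = 0 from h])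

theorem koszul_apply (Qi : ιB → ιC → 𝕜) (x : Pol 𝕜 p) : koszul Qi x =
    ∑ᶠ i : ιC, (∑ᶠ k : ιB, Qi k i • X p (Sum.inr (Sum.inl k))) * polDL (Sum.inr (Sum.inr i)) x := rfl

theorem coeff_homotopy {Qi : ιB → ιC → 𝕜} (hQ : ∀ i, {k | Qi k i ≠ 0}.Finite) (F : Formal 𝕜 p)
    (w : ℤ) : (homotopy Qi F).coeff w = invCount countBC (koszul Qi (F.coeff w)) := by
  have h1 : ∀ (x : ιB × ιC) (w : ℤ), (Qi x.1 x.2 • (coord (Sum.inr (Sum.inl x.1)) *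
      dL (Sum.inr (Sum.inr x.2)) F)).coeff w = Qi x.1 x.2 • (X p (Sum.inr (Sum.inl x.1)) *
        polDL (Sum.inr (Sum.inr x.2)) (F.coeff w)) := fun x w => by
    rw [HahnSeries.coeff_smul, coord, HahnSeries.coeff_single_mul, coeff_dL, sub_add_cancel]
  have hJ : ∀ w : ℤ, {i : ιC | polDL (Sum.inr (Sum.inr i)) (F.coeff w) ≠ 0}.Finite := fun w =>
    (finite_polDL_ne_zero (F.coeff w)).preimage (Sum.inr_injective.comp Sum.inr_injective).injOn
  have hI : ∀ w : ℤ, (⋃ i ∈ {i : ιC | polDL (Sum.inr (Sum.inr i)) (F.coeff w) ≠ 0},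
      {k | Qi k i ≠ 0}).Finite := fun w => (hJ w).biUnion fun i _ => hQ i
  have hmem : ∀ (w : ℤ) (k : ιB) (i : ιC), Qi k i • (X p (Sum.inr (Sum.inl k)) *
      polDL (Sum.inr (Sum.inr i)) (F.coeff w)) ≠ 0 →
      k ∈ (⋃ i ∈ {i : ιC | polDL (Sum.inr (Sum.inr i)) (F.coeff w) ≠ 0}, {k | Qi k i ≠ 0}) ∧
      i ∈ {i : ιC | polDL (Sum.inr (Sum.inr i)) (F.coeff w) ≠ 0} := fun w k i h => by
    have hi := right_ne_zero_of_mul (right_ne_zero_of_smul h)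
    exact ⟨Set.mem_biUnion hi (left_ne_zero_of_smul h), hi⟩
  have hs : Summable fun x : ιB × ιC => Qi x.1 x.2 • (coord (Sum.inr (Sum.inl x.1)) *
      dL (Sum.inr (Sum.inr x.2)) F) := by
    obtain ⟨a, ha⟩ := exists_mem_fil F
    refine summable_of_fil (w₀ := a) (fun x v hv => ?_) fun w => ?_
    · rw [h1, ha v hv, map_zero, mul_zero, smul_zero]
    · refine ((hI w).prod (hJ w)).subset fun x hx => ?_
      rw [Set.mem_ofPred_eq, h1] at hx
      exact hmem w _ _ hx
  rw [homotopy, HahnSeries.map_coeff, coeff_formalSum hs, finsum_congr fun x => h1 x w]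
  congr 1
  rw [finsum_prod_eq (f := fun k i => Qi k i • (X p (Sum.inr (Sum.inl k)) *
    polDL (Sum.inr (Sum.inr i)) (F.coeff w))) (hI w) (hJ w) (hmem w), koszul_apply]
  refine finsum_congr fun i => ?_
  rw [finsum_mul' _ _ ((hQ i).subset fun k hk => left_ne_zero_of_smul hk)]
  exact finsum_congr fun k => by rw [smul_mul_assoc]

theorem coeff_delta₁ (ωi : ιH ⊕ ιB ⊕ ιC → ιH ⊕ ιB ⊕ ιC → 𝕜) (F : Formal 𝕜 p) (w : ℤ) :
    (delta₁ ωi F).coeff w = (1 / 2 : 𝕜) • secondOrder (signed p ωi) (F.coeff w) := by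
  rw [delta₁, coeff_hbar_mul, coeff_lap]
  simp

/-- The bracket lowers the total weight by 2; expressing it through S_int/ħ absorbs the shift and
leaves a plain convolution. -/
theorem coeff_delta₂ (ωi : ιH ⊕ ιB ⊕ ιC → ιH ⊕ ιB ⊕ ιC → 𝕜) {S : Formal 𝕜 p}
    (hS : ∀ w, (int S).coeff w ∈ homog p 0) (F : Formal 𝕜 p) (w : ℤ) :
    (delta₂ ωi S F).coeff w = (1 / 2 : 𝕜) • secondOrder (signed p ωi) (F.coeff w) +
      ∑ᶠ u, bidiff (signed p ωi) ((hbar 𝕜 p (-1) * int S).coeff u) (F.coeff (w - u)) := by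
  have h : ∀ u, (hbar 𝕜 p (-1) * int S).coeff u = (int S).coeff (u + 2) := fun u => by
    rw [coeff_hbar_mul]
    simp
  simp only [h]
  rw [← coeff_bracket ωi hS, ← coeff_delta₁]
  rfl

end Homotopy

/-! ### Setting β, and then γ, to zero. -/

section Reduction

variable {𝕜 : Type*} [Field 𝕜]

theorem map_mem_homog {ι ι' : Type*} {p : ι → ℤ} {p' : ι' → ℤ} {M : Type*} [AddCommMonoid M]
    {wt : ι → M} {wt' : ι' → M} (φ : Pol 𝕜 p →ₐ[𝕜] Pol 𝕜 p')
    (hφ : ∀ i, φ (X p i) ∈ homog wt' (wt i)) {m : M} {x : Pol 𝕜 p} (hx : x ∈ homog wt m) :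
    φ x ∈ homog wt' m := by
  have h : gradeHom wt' (φ x) = AddMonoidAlgebra.mapAlgHom M φ (gradeHom wt x) := by
    refine Pol.algHom_ext (f := (gradeHom wt').comp φ)
      (g := (AddMonoidAlgebra.mapAlgHom M φ).comp (gradeHom wt)) (fun i => ?_) x
    rw [AlgHom.comp_apply, AlgHom.comp_apply, gradeHom_X, AddMonoidAlgebra.mapAlgHom_single]
    exact hφ i
  rw [mem_homog, h, mem_homog.1 hx, AddMonoidAlgebra.mapAlgHom_single]

theorem map_mem_degIn {ι ι' : Type*} {p : ι → ℤ} {p' : ι' → ℤ} {M : Type*} [AddCommMonoid M]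
    {wt : ι → M} {wt' : ι' → M} (φ : Pol 𝕜 p →ₐ[𝕜] Pol 𝕜 p')
    (hφ : ∀ i, φ (X p i) ∈ homog wt' (wt i)) {A : Set M} {x : Pol 𝕜 p} (hx : x ∈ degIn wt A) :
    φ x ∈ degIn wt' A :=
  degIn_induction (C := fun x => φ x ∈ degIn wt' A)
    (fun _ hm _ hx => homog_le_degIn hm (map_mem_homog φ hφ hx)) (by simp)
    (fun x y hx hy => by rw [map_add]; exact add_mem hx hy) hx

theorem map_invCount {ι ι' : Type*} {p : ι → ℤ} {p' : ι' → ℤ}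
    {wt : ι → ℕ} {wt' : ι' → ℕ} (φ : Pol 𝕜 p →ₐ[𝕜] Pol 𝕜 p')
    (hφ : ∀ i, φ (X p i) ∈ homog wt' (wt i)) (x : Pol 𝕜 p) :
    φ (invCount wt x) = invCount wt' (φ x) := by
  induction x using Pol.induction_homog wt with
  | mem m x hx => rw [invCount_of_mem hx, invCount_of_mem (map_mem_homog φ hφ hx), map_smul]
  | add x y hx hy => simp only [map_add, hx, hy]

variable {ιH ιB ιC : Type*} {p : ιH ⊕ ιB ⊕ ιC → ℤ}

/-- The degrees of the coordinates `α`, `γ`. -/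
abbrev degHC (p : ιH ⊕ ιB ⊕ ιC → ℤ) (i : ιH ⊕ ιC) : ℤ := p (Sum.map id Sum.inr i)

/-- The degrees of the coordinates `α`. -/
abbrev degH (p : ιH ⊕ ιB ⊕ ιC → ℤ) (i : ιH) : ℤ := p (Sum.inl i)

/-- The coordinates `γ` count `1`, the coordinates `α` count `0`. -/
def countC : ιH ⊕ ιC → ℕ := Sum.elim (fun _ => 0) (fun _ => 1)

/-- The algebra map `α ↦ α`, `β ↦ 0`, `γ ↦ γ`. -/
def killB (p : ιH ⊕ ιB ⊕ ιC → ℤ) : Pol 𝕜 p →ₐ[𝕜] Pol 𝕜 (degHC p) :=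
  polLift (Sum.elim (fun i => X (degHC p) (Sum.inl i))
    (Sum.elim (fun _ => 0) fun i => X (degHC p) (Sum.inr i))) (by
      rintro (i | i | i) (j | j | j)
      case inl.inl => exact X_mul_X (p := degHC p) (Sum.inl i) (Sum.inl j)
      case inl.inr.inr => exact X_mul_X (p := degHC p) (Sum.inl i) (Sum.inr j)
      case inr.inr.inl => exact X_mul_X (p := degHC p) (Sum.inr i) (Sum.inl j)
      case inr.inr.inr.inr => exact X_mul_X (p := degHC p) (Sum.inr i) (Sum.inr j)
      all_goals simp)

/-- The algebra map `α ↦ α`, `γ ↦ 0`. -/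
def killC (p : ιH ⊕ ιB ⊕ ιC → ℤ) : Pol 𝕜 (degHC p) →ₐ[𝕜] Pol 𝕜 (degH p) :=
  polLift (Sum.elim (fun i => X (degH p) i) fun _ => 0) (by
    rintro (i | i) (j | j)
    · exact X_mul_X (p := degH p) i j
    all_goals simp)

/-- The algebra map `α ↦ α` from functions on `H` to functions on `H ⊕ C`. -/
def inclH (p : ιH ⊕ ιB ⊕ ιC → ℤ) : Pol 𝕜 (degH p) →ₐ[𝕜] Pol 𝕜 (degHC p) :=
  polLift (fun i => X (degHC p) (Sum.inl i)) fun i j =>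
    X_mul_X (p := degHC p) (Sum.inl i) (Sum.inl j)

theorem killB_emb (i : ιH ⊕ ιC) :
    killB p (X p (Sum.map id Sum.inr i) : Pol 𝕜 p) = X (degHC p) i := by
  rcases i with i | i <;> exact polLift_X _ _ _

theorem killB_beta (k : ιB) : killB p (X p (Sum.inr (Sum.inl k)) : Pol 𝕜 p) = 0 := polLift_X _ _ _

theorem killC_inl (i : ιH) : killC p (X (degHC p) (Sum.inl i) : Pol 𝕜 (degHC p)) = X (degH p) i :=
  polLift_X _ _ _

theorem killC_inr (i : ιC) : killC p (X (degHC p) (Sum.inr i) : Pol 𝕜 (degHC p)) = 0 :=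
  polLift_X _ _ _

theorem inclH_X (i : ιH) : inclH p (X (degH p) i : Pol 𝕜 (degH p)) = X (degHC p) (Sum.inl i) :=
  polLift_X _ _ _

theorem polRestrict_eq (x : Pol 𝕜 p) : polRestrict p x = killC p (killB p x) := by
  refine Pol.algHom_ext (f := polRestrict p) (g := (killC p).comp (killB p)) (fun i => ?_) x
  rw [polRestrict, polLift_X, AlgHom.comp_apply]
  rcases i with i | k | i
  · exact ((congrArg _ (killB_emb (Sum.inl i))).trans (killC_inl i)).symm
  · rw [killB_beta, map_zero]; rfl
  · exact ((congrArg _ (killB_emb (Sum.inr i))).trans (killC_inr i)).symm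

theorem killC_inclH (x : Pol 𝕜 (degH p)) : killC p (inclH p x) = x := by
  refine Pol.algHom_ext (f := (killC p).comp (inclH p)) (g := AlgHom.id 𝕜 _) (fun i => ?_) x
  rw [AlgHom.comp_apply, inclH_X, killC_inl]
  rfl

theorem killB_mem_homog {M : Type*} [AddCommMonoid M] {wt : ιH ⊕ ιB ⊕ ιC → M} {wt' : ιH ⊕ ιC → M}
    (h : ∀ i, wt (Sum.map id Sum.inr i) = wt' i) (i : ιH ⊕ ιB ⊕ ιC) :
    killB p (X p i : Pol 𝕜 p) ∈ homog wt' (wt i) := by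
  rcases i with i | k | i
  · exact (congrArg (· ∈ homog wt' (wt (Sum.inl i))) (killB_emb (Sum.inl i))).mpr
      (h (Sum.inl i) ▸ X_mem_homog wt' (Sum.inl i))
  · rw [killB_beta]
    exact zero_mem _
  · exact (congrArg (· ∈ homog wt' (wt (Sum.inr (Sum.inr i)))) (killB_emb (Sum.inr i))).mpr
      (h (Sum.inr i) ▸ X_mem_homog wt' (Sum.inr i))

theorem killC_mem_homog {M : Type*} [AddCommMonoid M] {wt : ιH ⊕ ιC → M} {wt' : ιH → M}
    (h : ∀ i, wt (Sum.inl i) = wt' i) (i : ιH ⊕ ιC) :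
    killC p (X (degHC p) i : Pol 𝕜 (degHC p)) ∈ homog wt' (wt i) := by
  rcases i with i | i
  · rw [killC_inl, h]
    exact X_mem_homog wt' i
  · rw [killC_inr]
    exact zero_mem _

theorem inclH_mem_homog_zero (h : Pol 𝕜 (degH p)) : inclH p h ∈ homog (countC (ιC := ιC)) 0 := by
  induction h using Pol.induction with
  | one => rw [map_one]; exact one_mem_homog _
  | X_mul i x hx =>
    rw [map_mul, inclH_X]
    exact mul_mem_homog (m := 0) (n := 0) (X_mem_homog countC (Sum.inl i)) hx
  | add x y hx hy => rw [map_add]; exact add_mem hx hy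
  | smul r x hx => rw [map_smul]; exact Submodule.smul_mem _ _ hx

theorem sub_inclH_mem (x : Pol 𝕜 (degHC p)) :
    x - inclH p (killC p x) ∈ degIn (countC (ιC := ιC)) {m | 1 ≤ m} := by
  have huniv : ∀ x : Pol 𝕜 (degHC p), x ∈ degIn (countC (ιC := ιC)) Set.univ :=
    fun x m _ => Set.mem_univ m
  induction x using Pol.induction with
  | one => simp
  | X_mul i x hx =>
    rcases i with i | i
    · rw [map_mul, map_mul, killC_inl, inclH_X, ← mul_sub]
      exact mul_mem_degIn (A := Set.univ) (fun a _ b hb => le_add_left hb) (huniv _) hx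
    · rw [map_mul, killC_inr, zero_mul, map_zero, sub_zero]
      refine mul_mem_degIn (A := {1}) (B := Set.univ) (fun a ha b _ => ?_)
        (homog_le_degIn (m := 1) (Set.mem_singleton 1) (X_mem_homog countC (Sum.inr i))) (huniv _)
      simp at ha
      simp [ha]
  | add x y hx hy =>
    rw [map_add, map_add, add_sub_add_comm]
    exact add_mem hx hy
  | smul r x hx =>
    rw [map_smul, map_smul]
    exact (smul_sub r x _).symm ▸ Submodule.smul_mem _ r hx

/-- The Euler operator multiplies γ-count m by m, so it undoes `invCount` wherever m > 0; what is
left is the γ-free part. Each integration by parts starts from this splitting. -/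
theorem eq_inclH_add_euler [CharZero 𝕜] (x : Pol 𝕜 (degHC p)) :
    x = inclH p (killC p x) + euler countC (invCount countC x) := by
  have h : ∀ x ∈ degIn (countC (ιH := ιH) (ιC := ιC)) {m | 1 ≤ m},
      euler countC (invCount countC x) = (x : Pol 𝕜 (degHC p)) := fun x hx => by
    refine degIn_induction (C := fun x => euler countC (invCount countC x) = x)
      (fun m hm x hx => ?_) (by simp) (fun x y hx hy => by simp only [map_add, hx, hy]) hx
    rw [invCount_of_mem hx, map_smul, euler_of_mem hx, smul_smul, inv_mul_cancel₀, one_smul]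
    exact_mod_cast (Nat.one_le_iff_ne_zero.1 hm)
  have h1 := h _ (sub_inclH_mem x)
  rw [map_sub, invCount_of_mem (inclH_mem_homog_zero _)] at h1
  rw [Nat.cast_zero, inv_zero, zero_smul, sub_zero] at h1
  rw [h1, add_sub_cancel]

theorem killB_polDL (j : ιH ⊕ ιC) (x : Pol 𝕜 p) :
    killB p (polDL (Sum.map id Sum.inr j) x) = polDL j (killB p x) := by
  have hinj : Function.Injective (Sum.map id Sum.inr : ιH ⊕ ιC → ιH ⊕ ιB ⊕ ιC) :=
    Function.injective_id.sumMap Sum.inr_injective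
  have key : ∀ (k : ιH ⊕ ιC) (x : Pol 𝕜 p),
      killB p (polDL (Sum.map id Sum.inr j) x) = polDL j (killB p x) →
      killB p (polDL (Sum.map id Sum.inr j) (X p (Sum.map id Sum.inr k) * x)) =
        polDL j (killB p (X p (Sum.map id Sum.inr k) * x)) := fun k x hx => by
    rw [polDL_X_mul, map_add, map_smul, map_smul, map_mul, map_mul, killB_emb, polDL_X_mul, hx]
    congr 2
    by_cases h : j = k
    · rw [h, delta_self, delta_self]
    · rw [delta_of_ne _ h, delta_of_ne _ (hinj.ne h)]
  induction x using Pol.induction with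
  | one => simp
  | X_mul k x hx =>
    rcases k with k | k | k
    · exact key (Sum.inl k) x hx
    · rw [polDL_X_mul, map_add, map_smul, map_smul, map_mul, map_mul, killB_beta, zero_mul,
        zero_mul, smul_zero, add_zero, map_zero, delta_of_ne _ (by rcases j with j | j <;> simp),
        zero_smul]
    · exact key (Sum.inr k) x hx
  | add x y hx hy => simp only [map_add, hx, hy]
  | smul r x hx => simp only [map_smul, hx]

end Reduction

/-! ### ΔK and the bracket with K modulo β. -/

section ReductionOperators

variable {𝕜 : Type*} [Field 𝕜] {ιH ιB ιC : Type*} {p : ιH ⊕ ιB ⊕ ιC → ℤ}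
  {ωi : ιH ⊕ ιB ⊕ ιC → ιH ⊕ ιB ⊕ ιC → 𝕜} {Qi : ιB → ιC → 𝕜}

/-- The propagator as a matrix on the coordinates `α`, `γ`. -/
def propagatorHC (p : ιH ⊕ ιB ⊕ ιC → ℤ) (ωi : ιH ⊕ ιB ⊕ ιC → ιH ⊕ ιB ⊕ ιC → 𝕜) (Qi : ιB → ιC → 𝕜)
    (i j : ιH ⊕ ιC) : 𝕜 :=
  Sum.elim (fun _ => 0) (fun i => Sum.elim (fun _ => 0) (fun j => propagator p ωi Qi i j) j) i

theorem IsHodgeMatrices.isPropagator (h : IsHodgeMatrices p ωi Qi) :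
    IsPropagator (degHC p) countC (propagatorHC p ωi Qi) where
  count i j hij := by
    rcases i with i | i <;> rcases j with j | j <;> simp [propagatorHC, countC] at hij ⊢
  degree i j hij := by
    rcases i with i | i <;> rcases j with j | j <;> simp [propagatorHC] at hij
    exact propagator_support h.degree h.degree_Q hij
  symm i j := by
    rcases i with i | i <;> rcases j with j | j <;> simp [propagatorHC]
    exact h.symm i j

theorem map_koszul (hQ : ∀ i, {k | Qi k i ≠ 0}.Finite) {N : Type*} [AddCommGroup N] [Module 𝕜 N]
    (L : Pol 𝕜 p →ₗ[𝕜] N) (x : Pol 𝕜 p) : L (koszul Qi x) = ∑ᶠ i : ιC, ∑ᶠ k : ιB,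
      Qi k i • L (X p (Sum.inr (Sum.inl k)) * polDL (Sum.inr (Sum.inr i)) x) := by
  rw [koszul_apply, map_finsum]
  · refine finsum_congr fun i => ?_
    rw [finsum_mul' _ _ ((hQ i).subset fun k hk => left_ne_zero_of_smul hk)]
    simp only [smul_mul_assoc]
    rw [map_finsum _ ((hQ i).subset fun k hk => left_ne_zero_of_smul hk)]
    exact finsum_congr fun k => map_smul _ _ _
  · refine ((finite_polDL_ne_zero x).preimage
      (Sum.inr_injective.comp Sum.inr_injective).injOn).subset fun i hi h => hi ?_
    simp [show polDL (Sum.inr (Sum.inr i)) x = 0 from h]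

/-- Where ω^{ij} is nonzero, p i and p j have different parities, so the signs compensate the
antisymmetry of ω^{ij}. -/
theorem IsHodgeMatrices.signed_symm (h : IsHodgeMatrices p ωi Qi) (i j : ιH ⊕ ιB ⊕ ιC) :
    signed p ωi i j = signed p ωi j i := by
  by_cases hij : ωi i j = 0
  · simp [signed, hij, h.antisymm i j]
  · rw [signed, signed, h.antisymm i j]
    have hd := h.degree i j hij
    rw [show p i = -p j - 1 by lia, sub_eq_add_neg, neg_one_zpow_add, zpow_neg, ← inv_zpow]
    simp

theorem IsHodgeMatrices.signed_sign (h : IsHodgeMatrices p ωi Qi) (i j : ιH ⊕ ιB ⊕ ιC) :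
    signed p ωi i j * (-1 : 𝕜) ^ (p i * p j) = signed p ωi i j := by
  by_cases hij : ωi i j = 0
  · simp [signed, hij]
  · have hd := h.degree i j hij
    rw [neg_one_zpow_even, mul_one]
    rw [show p j = -(p i + 1) by lia, mul_neg]
    exact (Int.even_mul_succ_self _).neg

theorem contract_X_mul_eq {ι : Type*} {q : ι → ℤ} (M : ι → ι → 𝕜) (l i : ι) (x : Pol 𝕜 q) :
    contract M l (X q i * x) = M i l • x +
      X q i * contract (fun k l => M k l * (-1 : 𝕜) ^ (q k * q i)) l x := by
  have hk : ∀ k, M k l • polDL k (X q i * x) = (M k l * delta 𝕜 k i) • x +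
      LinearMap.mulLeft 𝕜 (X q i) ((M k l * (-1 : 𝕜) ^ (q k * q i)) • polDL k x) := by
    intro k
    rw [polDL_X_mul, smul_add, smul_smul, smul_smul, LinearMap.mulLeft_apply, mul_smul_comm]
  have hfin : (fun k => (M k l * (-1 : 𝕜) ^ (q k * q i)) • polDL k x).HasFiniteSupport :=
    hasFiniteSupport_of_polDL x fun k hk => by simp [hk]
  rw [contract_apply, finsum_congr hk, finsum_add_distrib, ← map_finsum _ hfin]
  · congr 1
    rw [finsum_eq_single _ i fun k hk => by simp [delta_of_ne _ hk]]
    simp [delta_self]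
  · refine (Set.finite_singleton i).subset fun k hk => ?_
    by_contra hc
    exact hk (by simp [delta_of_ne _ hc])
  · exact hasFiniteSupport_of_polDL x fun k hk => by simp [hk]

/-- The two ways of differentiating x_i agree by `signed_symm` and `signed_sign`. The rest is
divisible by x_i, so for a variable β it disappears under `killB` and y need not be known. -/
theorem IsHodgeMatrices.secondOrder_X_mul (h : IsHodgeMatrices p ωi Qi) (i : ιH ⊕ ιB ⊕ ιC)
    (x : Pol 𝕜 p) : ∃ y, secondOrder (signed p ωi) (X p i * x) =
      (2 : 𝕜) • contract (signed p ωi) i x + X p i * y := by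
  set L := fun l => (-1 : 𝕜) ^ (p l * p i) •
    contract (𝕜 := 𝕜) (q := p) (fun k l => signed p ωi k l * (-1 : 𝕜) ^ (p k * p i)) l
  have hl : ∀ l, contract (signed p ωi) l (polDL l (X p i * x)) =
      delta 𝕜 l i • contract (signed p ωi) l x + (signed p ωi l i • polDL l x +
        LinearMap.mulLeft 𝕜 (X p i) (L l (polDL l x))) := by
    intro l
    rw [polDL_X_mul, map_add, map_smul, map_smul, contract_X_mul_eq, smul_add, smul_smul,
      mul_comm _ (signed p ωi i l), h.signed_symm i l, h.signed_sign l i, LinearMap.mulLeft_apply,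
      LinearMap.smul_apply, mul_smul_comm]
  have hfin : ∀ (f : ιH ⊕ ιB ⊕ ιC → Pol 𝕜 p →ₗ[𝕜] Pol 𝕜 p),
      (fun l => f l (polDL l x)).HasFiniteSupport := fun f =>
    hasFiniteSupport_of_polDL x fun k hk => by simp [hk]
  have hfin2 : (fun l => signed p ωi l i • polDL l x).HasFiniteSupport :=
    hasFiniteSupport_of_polDL x fun k hk => by simp [hk]
  refine ⟨∑ᶠ l, L l (polDL l x), ?_⟩
  rw [secondOrder_apply, finsum_congr hl, finsum_add_distrib, finsum_add_distrib hfin2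
    (f := fun l => signed p ωi l i • polDL l x)
    (g := fun l => LinearMap.mulLeft 𝕜 (X p i) (L l (polDL l x)))
    (hfin fun l => LinearMap.mulLeft 𝕜 (X p i) ∘ₗ L l), ← map_finsum _ (hfin L),
    ← contract_apply, LinearMap.mulLeft_apply, ← add_assoc, two_smul]
  · congr 2
    rw [finsum_eq_single _ i fun k hk => by rw [delta_of_ne _ hk, zero_smul], delta_self, one_smul]
  · refine (Set.finite_singleton i).subset fun k hk => ?_
    by_contra hc
    exact hk (by simp [delta_of_ne _ hc])
  · exact hasFiniteSupport_of_polDL x fun k hk => by simp [hk]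

/-- The contraction with `ω^{γ β_k}` on functions of `α`, `γ`. -/
theorem IsHodgeMatrices.killB_contract (h : IsHodgeMatrices p ωi Qi) (k : ιB) (x : Pol 𝕜 p) :
    killB p (contract (signed p ωi) (Sum.inr (Sum.inl k)) x) =
      ∑ᶠ i : ιC, signed p ωi (Sum.inr (Sum.inr i)) (Sum.inr (Sum.inl k)) •
        polDL (Sum.inr i) (killB p x) := by
  rw [contract_apply, map_finsum _ (hasFiniteSupport_of_polDL x fun k hk => by simp [hk]),
    finsum_eq_finsum_comp (fun i : ιC => Sum.inr (Sum.inr i))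
      (Sum.inr_injective.comp Sum.inr_injective)]
  · refine finsum_congr fun i => ?_
    rw [map_smul]
    exact congrArg _ (killB_polDL (Sum.inr i) x)
  · rintro (i | i | i) hi
    · simp [signed, h.block_H]
    · simp [signed, h.block_B]
    · exact absurd ⟨i, rfl⟩ hi

theorem IsHodgeMatrices.contract_propagatorHC (h : IsHodgeMatrices p ωi Qi) (j : ιC)
    (y : Pol 𝕜 (degHC p)) : contract (propagatorHC p ωi Qi) (Sum.inr j) y =
      ∑ᶠ k : ιB, Qi k j • ∑ᶠ i : ιC,
        signed p ωi (Sum.inr (Sum.inr i)) (Sum.inr (Sum.inl k)) • polDL (Sum.inr i) y := by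
  have hI : {i : ιC | polDL (Sum.inr i) y ≠ 0}.Finite :=
    (finite_polDL_ne_zero y).preimage Sum.inr_injective.injOn
  rw [contract_apply, finsum_eq_finsum_comp Sum.inr Sum.inr_injective]
  · have h1 : ∀ i : ιC, propagatorHC p ωi Qi (Sum.inr i) (Sum.inr j) • polDL (Sum.inr i) y =
        ∑ᶠ k : ιB, (signed p ωi (Sum.inr (Sum.inr i)) (Sum.inr (Sum.inl k)) * Qi k j) •
          polDL (Sum.inr i) y := fun i => by
      exact finsum_smul' (f := fun k : ιB => (-1 : 𝕜) ^ p (Sum.inr (Sum.inr i)) *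
        ωi (Sum.inr (Sum.inr i)) (Sum.inr (Sum.inl k)) * Qi k j)
        ((h.finite_Q' j).subset fun k hk => right_ne_zero_of_mul hk) _
    rw [finsum_congr h1, finsum_comm_of_finite hI (h.finite_Q' j) fun i k hik =>
      ⟨right_ne_zero_of_smul hik, right_ne_zero_of_mul (left_ne_zero_of_smul hik)⟩]
    refine finsum_congr fun k => ?_
    rw [smul_finsum]
    exact finsum_congr fun i => by rw [smul_smul, mul_comm (Qi k j)]
  · rintro (i | i) hi
    · simp [propagatorHC]
    · exact absurd ⟨i, rfl⟩ hi

theorem finsum_inr_eq {N : Type*} [AddCommMonoid N] {f : ιH ⊕ ιC → N}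
    (hf : ∀ i, f (Sum.inl i) = 0) : ∑ᶠ i, f i = ∑ᶠ i : ιC, f (Sum.inr i) :=
  finsum_eq_finsum_comp Sum.inr Sum.inr_injective (by
    rintro (i | i) hi
    · exact hf i
    · exact absurd ⟨i, rfl⟩ hi)

/-- The β created by `koszul` survives `killB` only if it is differentiated. Its partner under
ω^{γβ} is a γ-derivative, and with the coefficient Q⁻¹ the two form the propagator. -/
theorem IsHodgeMatrices.killB_secondOrder_koszul (h : IsHodgeMatrices p ωi Qi) (x : Pol 𝕜 p) :
    killB p (secondOrder (signed p ωi) (koszul Qi x)) =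
      (2 : 𝕜) • secondOrder (propagatorHC p ωi Qi) (killB p x) := by
  have h1 := map_koszul h.finite_Q' ((killB p).toLinearMap ∘ₗ secondOrder (signed p ωi)) x
  rw [LinearMap.comp_apply, AlgHom.toLinearMap_apply] at h1
  rw [h1, secondOrder_apply, finsum_inr_eq fun i => h.isPropagator.contract_eq_zero (by simp [countC]) _,
    smul_finsum]
  refine finsum_congr fun i => ?_
  rw [h.contract_propagatorHC, smul_finsum]
  refine finsum_congr fun k => ?_
  obtain ⟨y, hy⟩ := h.secondOrder_X_mul (Sum.inr (Sum.inl k)) (polDL (Sum.inr (Sum.inr i)) x)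
  rw [LinearMap.comp_apply, hy, AlgHom.toLinearMap_apply, map_add, map_mul, killB_beta, zero_mul,
    add_zero, map_smul, h.killB_contract, smul_comm]
  have h2 := killB_polDL (p := p) (Sum.inr i) x
  exact congrArg (fun z => (2 : 𝕜) • Qi k i • ∑ᶠ i : ιC,
    signed p ωi (Sum.inr (Sum.inr i)) (Sum.inr (Sum.inl k)) • polDL (Sum.inr i) z) h2

theorem killB_bidiff_X_mul (M : ιH ⊕ ιB ⊕ ιC → ιH ⊕ ιB ⊕ ιC → 𝕜) (s x : Pol 𝕜 p) (k : ιB) :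
    killB p (bidiff M s (X p (Sum.inr (Sum.inl k)) * x)) =
      killB p (contract M (Sum.inr (Sum.inl k)) s) * killB p x := by
  rw [bidiff_apply, map_finsum _ (hasFiniteSupport_of_polDL (X p (Sum.inr (Sum.inl k)) * x)
      fun l hl => by rw [hl, mul_zero]),
    finsum_eq_single _ (Sum.inr (Sum.inl k))]
  · rw [map_mul, polDL_X_mul, map_add, map_smul, map_smul, map_mul, killB_beta, zero_mul, smul_zero,
      add_zero, delta_self, one_smul]
  · intro l hl
    rw [map_mul, polDL_X_mul, map_add, map_smul, map_smul, map_mul, killB_beta, zero_mul, smul_zero,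
      add_zero, delta_of_ne _ hl, zero_smul, mul_zero]

/-- The same mechanism: the derivative on the second argument must hit the new β, and its partner is
a γ-derivative of s. -/
theorem IsHodgeMatrices.killB_bidiff_koszul (h : IsHodgeMatrices p ωi Qi) (s x : Pol 𝕜 p) :
    killB p (bidiff (signed p ωi) s (koszul Qi x)) =
      bidiff (propagatorHC p ωi Qi) (killB p s) (killB p x) := by
  have h1 := map_koszul h.finite_Q' ((killB p).toLinearMap ∘ₗ bidiff (signed p ωi) s) x
  rw [LinearMap.comp_apply, AlgHom.toLinearMap_apply] at h1
  rw [h1, bidiff_apply, finsum_inr_eq fun i => by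
    rw [h.isPropagator.contract_eq_zero (by simp [countC]), zero_mul]]
  refine finsum_congr fun i => ?_
  rw [h.contract_propagatorHC, finsum_mul' _ _
    ((h.finite_Q' i).subset fun k hk => left_ne_zero_of_smul hk)]
  refine finsum_congr fun k => ?_
  rw [LinearMap.comp_apply, AlgHom.toLinearMap_apply, killB_bidiff_X_mul, h.killB_contract,
    smul_mul_assoc]
  exact congrArg (fun z => Qi k i • (_ * z)) (killB_polDL (p := p) (Sum.inr i) x)

theorem koszul_mem_homog (Qi : ιB → ιC → 𝕜) {m : ℕ} {x : Pol 𝕜 p}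
    (hx : x ∈ homog (countBC (ιH := ιH)) m) : koszul Qi x ∈ homog (countBC (ιH := ιH)) m := by
  rw [koszul_apply]
  refine finsum_mem_submodule _ fun i => ?_
  have hb : ∑ᶠ k : ιB, Qi k i • X p (Sum.inr (Sum.inl k)) ∈
      homog (𝕜 := 𝕜) (p := p) (countBC (ιH := ιH)) 1 :=
    finsum_mem_submodule _ fun k => Submodule.smul_mem _ _
      (X_mem_homog (countBC (ιH := ιH)) (Sum.inr (Sum.inl k)))
  rcases m with _ | m
  · rw [polDL_eq_zero (Sum.inr (Sum.inr i)) one_pos hx, mul_zero]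
    exact zero_mem _
  · rw [add_comm]
    exact mul_mem_homog hb (polDL_mem_homog _ rfl hx)

/-- `koszul` trades a γ for a β, so #_{β+γ} is unchanged. Applied first, the factor 1/#_{β+γ} turns
into 1/#_γ at β = 0. -/
theorem invCount_koszul (Qi : ιB → ιC → 𝕜) (x : Pol 𝕜 p) :
    invCount countBC (koszul Qi x) = koszul Qi (invCount countBC x) := by
  induction x using Pol.induction_homog (countBC (ιH := ιH) (ιB := ιB) (ιC := ιC)) with
  | mem m x hx =>
    rw [invCount_of_mem hx, invCount_of_mem (koszul_mem_homog Qi hx), map_smul]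
  | add x y hx hy => simp only [map_add, hx, hy]

theorem killB_invCount (x : Pol 𝕜 p) :
    killB p (invCount countBC x) = invCount countC (killB p x) :=
  map_invCount _ (killB_mem_homog (by rintro (i | i) <;> rfl)) x

end ReductionOperators

/-! ### Integration by parts against an exponential weight. -/

section GaussianFormal

variable {𝕜 : Type*} [Field 𝕜] {ι ι' : Type*} {q : ι → ℤ} {q' : ι' → ℤ} {c : ι → ℕ}
  {D : ι → ι → 𝕜}

theorem hasFiniteSupport_conv (F G : Formal 𝕜 q) (w : ℤ) :
    (fun u => F.coeff u * G.coeff (w - u)).HasFiniteSupport :=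
  (finite_conv_formal F G w).subset fun _ hu => ⟨left_ne_zero_of_mul hu, right_ne_zero_of_mul hu⟩

theorem coeff_map_mul (φ : Pol 𝕜 q →ₐ[𝕜] Pol 𝕜 q') (F G : Formal 𝕜 q) :
    (F * G).map φ = F.map φ * G.map φ := by
  ext w
  rw [HahnSeries.map_coeff, coeff_mul_eq_finsum, coeff_mul_eq_finsum, map_finsum]
  · exact finsum_congr fun u => map_mul φ _ _
  · exact hasFiniteSupport_conv F G w

theorem contract_of_map_polDL {s y : Formal 𝕜 q}
    (hy : ∀ j, y.map (polDL j) = s.map (polDL j) * y) (i : ι) (v : ℤ) :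
    contract D i (y.coeff v) = ∑ᶠ a, contract D i (s.coeff a) * y.coeff (v - a) := by
  have hA := finite_conv_formal s y v
  have hK : (⋃ a ∈ {a | s.coeff a ≠ 0 ∧ y.coeff (v - a) ≠ 0}, {k | polDL k (s.coeff a) ≠ 0}).Finite :=
    hA.biUnion fun a _ => finite_polDL_ne_zero _
  have h1 : ∀ k, D k i • polDL k (y.coeff v) =
      ∑ᶠ a, D k i • (polDL k (s.coeff a) * y.coeff (v - a)) := fun k => by
    have h := congrArg (fun G => HahnSeries.coeff G v) (hy k)
    simp only [HahnSeries.map_coeff, coeff_mul_eq_finsum] at h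
    rw [h, smul_finsum]
  rw [contract_apply, finsum_congr h1, finsum_comm_of_finite hK hA]
  · refine finsum_congr fun a => ?_
    rw [contract_apply, finsum_mul' _ _ (hasFiniteSupport_of_polDL (s.coeff a)
      fun k hk => by simp [hk])]
    exact finsum_congr fun k => by rw [smul_mul_assoc]
  · intro k a h
    have h2 := right_ne_zero_of_smul h
    have h3 := left_ne_zero_of_mul h2
    have ha : s.coeff a ≠ 0 ∧ y.coeff (v - a) ≠ 0 :=
      ⟨fun h0 => h3 (by rw [h0, map_zero]), right_ne_zero_of_mul h2⟩
    exact ⟨Set.mem_biUnion ha h3, ha⟩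

theorem IsPropagator.contract_mem_homog_degree (hD : IsPropagator q c D) (i : ι) {x : Pol 𝕜 q}
    (hx : x ∈ homog q 0) : contract D i x ∈ homog q (q i) := by
  refine finsum_mem_submodule _ fun k => ?_
  by_cases h : D k i = 0
  · simp [h]
  · have := hD.degree k i h
    rw [show q i = 0 - q k by lia]
    exact Submodule.smul_mem _ _ (polDL_mem_homog_int k hx)

/-- The differential equation of y turns a contraction of y into one of s. That has the parity of
x_i, so moving it to the front cancels the sign in `sgn`. -/
theorem IsPropagator.finsum_sgn_polDL_mul (hD : IsPropagator q c D) {s y : Formal 𝕜 q}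
    (hs : ∀ w, s.coeff w ∈ homog q 0) (hy : ∀ j, y.map (polDL j) = s.map (polDL j) * y)
    (x : Pol 𝕜 q) (v : ℤ) :
    ∑ᶠ i, sgn (q i) (polDL i x) * contract D i (y.coeff v) =
      ∑ᶠ a, bidiff D (s.coeff a) x * y.coeff (v - a) := by
  have hA := finite_conv_formal s y v
  have h1 : ∀ i, sgn (q i) (polDL i x) * contract D i (y.coeff v) =
      ∑ᶠ a, contract D i (s.coeff a) * polDL i x * y.coeff (v - a) := fun i => by
    rw [contract_of_map_polDL hy, mul_finsum' _ _ (hA.subset fun a ha => ⟨fun h => ha (by simp [h]),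
      fun h => ha (by simp [h])⟩)]
    exact finsum_congr fun a => by
      rw [← mul_assoc, ← mul_comm_of_mem_homog (hD.contract_mem_homog_degree i (hs a))]
  rw [finsum_congr h1, finsum_comm_of_finite (finite_polDL_ne_zero x) hA]
  · refine finsum_congr fun a => ?_
    rw [bidiff_apply, finsum_mul' _ _ (hasFiniteSupport_of_polDL x fun k hk => by simp [hk])]
  · intro i a h
    have h2 := left_ne_zero_of_mul h
    exact ⟨right_ne_zero_of_mul h2, fun h0 => left_ne_zero_of_mul h2 (by rw [h0, map_zero]),
      right_ne_zero_of_mul h⟩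

/-- The lower bounds confine all indices to finite intervals, so the sums may be exchanged and
regrouped along v = u + a. -/
theorem finsum_conv_assoc {A : Type*} [Ring A] {y : ℤ → A} {g : ℤ → ℤ → A} {a₀ b₀ d₀ : ℤ}
    (hga : ∀ a u, a < a₀ → g a u = 0) (hgu : ∀ a u, u < b₀ → g a u = 0)
    (hy : ∀ v < d₀, y v = 0) (w : ℤ) :
    ∑ᶠ u, ∑ᶠ a, g a u * y (w - u - a) = ∑ᶠ v, (∑ᶠ a, g a (v - a)) * y (w - v) := by
  have hfin : ∀ a u, g a u * y (w - u - a) ≠ 0 → a₀ ≤ a ∧ b₀ ≤ u ∧ u + a ≤ w - d₀ := by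
    intro a u h
    refine ⟨?_, ?_, ?_⟩ <;> by_contra hc
    · exact left_ne_zero_of_mul h (hga _ _ (by lia))
    · exact left_ne_zero_of_mul h (hgu _ _ (by lia))
    · exact right_ne_zero_of_mul h (hy _ (by lia))
  rw [finsum_comm_of_finite (Set.finite_Icc b₀ (w - d₀ - a₀)) (Set.finite_Icc a₀ (w - d₀ - b₀))
    fun u a h => by
      have := hfin a u h
      exact ⟨⟨by lia, by lia⟩, by lia, by lia⟩]
  have h1 : ∀ a, ∑ᶠ u, g a u * y (w - u - a) = ∑ᶠ v, g a (v - a) * y (w - v) := fun a => by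
    rw [← finsum_comp_equiv (Equiv.subRight a)]
    exact finsum_congr fun v => by
      rw [Equiv.subRight_apply, show w - (v - a) - a = w - v by ring]
  rw [finsum_congr h1, finsum_comm_of_finite (Set.finite_Icc a₀ (w - d₀ - b₀))
    (Set.finite_Icc (a₀ + b₀) (w - d₀)) fun a v h => by
      have := hfin a (v - a) (by rwa [show w - (v - a) - a = w - v by ring])
      exact ⟨⟨by lia, by lia⟩, by lia, by lia⟩]
  refine finsum_congr fun v => (finsum_mul' _ _ ?_).symm
  refine (Set.finite_Icc a₀ (v - b₀)).subset fun a ha => ⟨?_, ?_⟩ <;> by_contra hc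
  · exact ha (hga _ _ (by lia))
  · exact ha (hgu _ _ (by lia))

/-- Integration by parts for formal sums. -/
theorem IsPropagator.gaussian_coeff_mul [CharZero 𝕜] (hD : IsPropagator q c D)
    {ρ : Pol 𝕜 q →ₐ[𝕜] Pol 𝕜 q'} (hρ : ∀ i, c i ≠ 0 → ρ (X q i) = 0) (hc : ∀ i, c i ≤ 1)
    (π : Pol 𝕜 q →ₗ[𝕜] Pol 𝕜 q) (hπ : ∀ x, x = π x + euler c (invCount c x)) {s y : Formal 𝕜 q}
    (hs : ∀ w, s.coeff w ∈ homog q 0) (hy : ∀ j, y.map (polDL j) = s.map (polDL j) * y)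
    {F F' : Formal 𝕜 q} (hF : ∀ w, F'.coeff w = secondOrder D (invCount c (F.coeff w)) +
      ∑ᶠ u, bidiff D (s.coeff u) (invCount c (F.coeff (w - u)))) (w : ℤ) :
    gaussian c D ρ ((F * y).coeff w) =
      gaussian c D ρ ((F.map π * y).coeff w) + gaussian c D ρ ((F' * y).coeff w) := by
  obtain ⟨a₀, ha⟩ := exists_mem_fil s
  obtain ⟨b₀, hb⟩ := exists_mem_fil F
  obtain ⟨d₀, hd⟩ := exists_mem_fil y
  have hU : ∀ (L : Pol 𝕜 q →ₗ[𝕜] Pol 𝕜 q),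
      (fun u => L (F.coeff u) * y.coeff (w - u)).HasFiniteSupport := fun L =>
    (finite_conv_formal F y w).subset fun u hu => ⟨fun h => hu (by simp [h]),
      fun h => hu (by simp [h])⟩
  have hUπ : (fun u => (F.map π).coeff u * y.coeff (w - u)).HasFiniteSupport := hU π
  have hUe : (fun u => euler c (invCount c (F.coeff u)) * y.coeff (w - u)).HasFiniteSupport :=
    hU (euler c ∘ₗ invCount c)
  have hUs : (fun u => secondOrder D (invCount c (F.coeff u)) *
      y.coeff (w - u)).HasFiniteSupport := hU (secondOrder D ∘ₗ invCount c)
  have hU2 : (fun u => ∑ᶠ i, sgn (q i) (polDL i (invCount c (F.coeff u))) *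
      contract D i (y.coeff (w - u))).HasFiniteSupport :=
    (finite_conv_formal F y w).subset fun u hu => ⟨fun h => hu (by simp [h]),
      fun h => hu (by simp [h])⟩
  have hΦ : ∀ {f : ℤ → Pol 𝕜 q}, f.HasFiniteSupport →
      (fun u => gaussian c D ρ (f u)).HasFiniteSupport := fun hf =>
    hf.subset fun u hu h => hu (by simp [h])
  have h1 : (F * y).coeff w = (F.map π * y).coeff w +
      ∑ᶠ u, euler c (invCount c (F.coeff u)) * y.coeff (w - u) := by
    rw [coeff_mul_eq_finsum, coeff_mul_eq_finsum, ← finsum_add_distrib hUπ hUe]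
    refine finsum_congr fun u => ?_
    rw [HahnSeries.map_coeff, ← add_mul, ← hπ]
  -- The bidifferential part of F', multiplied by y, is exactly the term of the integration by parts
  -- in which the contraction hits y.
  have h2 : (F' * y).coeff w =
      ∑ᶠ u, secondOrder D (invCount c (F.coeff u)) * y.coeff (w - u) +
      ∑ᶠ u, ∑ᶠ i, sgn (q i) (polDL i (invCount c (F.coeff u))) *
        contract D i (y.coeff (w - u)) := by
    have h3 := finsum_conv_assoc (g := fun a u => bidiff D (s.coeff a) (invCount c (F.coeff u)))
      (y := y.coeff) (a₀ := a₀) (b₀ := b₀) (d₀ := d₀) (fun a u h => by simp [ha a h])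
      (fun a u h => by simp [hb u h]) hd w
    rw [finsum_congr fun u => hD.finsum_sgn_polDL_mul hs hy (invCount c (F.coeff u)) (w - u), h3,
      coeff_mul_eq_finsum, ← finsum_add_distrib hUs]
    · exact finsum_congr fun v => by rw [hF, add_mul]
    · refine (Set.finite_Icc (a₀ + b₀) (w - d₀)).subset fun v hv => ⟨?_, ?_⟩ <;> by_contra hc
      · refine hv ?_
        have h0 : ∑ᶠ a, bidiff D (s.coeff a) (invCount c (F.coeff (v - a))) = 0 :=
          finsum_eq_zero_of_forall_eq_zero fun a => by
            rcases lt_or_ge a a₀ with h | h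
            · rw [ha a h, map_zero]; rfl
            · rw [hb (v - a) (by lia), map_zero, map_zero]
        simp only [h0, zero_mul]
      · exact hv (by simp only [hd (w - v) (by lia), mul_zero])
  rw [h1, h2, map_add, map_add, map_finsum _ hUe,
    map_finsum _ hUs, map_finsum _ hU2,
    ← finsum_add_distrib (hΦ hUs) (hΦ hU2)]
  congr 1
  exact finsum_congr fun u => hD.gaussian_euler_mul hρ hc _ _

theorem IsPropagator.gaussian_coeff_mul_incl (hD : IsPropagator q c D)
    {ρ : Pol 𝕜 q →ₐ[𝕜] Pol 𝕜 q'} (incl : Pol 𝕜 q' →ₐ[𝕜] Pol 𝕜 q)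
    (hincl : ∀ x, incl x ∈ homog c 0) (hρi : ∀ x, ρ (incl x) = x) {y : Formal 𝕜 q}
    (hy : ∀ w, y.coeff w ∈ homog q 0) (h : Formal 𝕜 q') (w : ℤ) :
    gaussian c D ρ ((h.map incl * y).coeff w) = (y.map (gaussian c D ρ) * h).coeff w := by
  rw [← mul_comm_of_degree_zero hy, coeff_mul_eq_finsum, coeff_mul_eq_finsum, map_finsum]
  · refine finsum_congr fun u => ?_
    rw [HahnSeries.map_coeff, HahnSeries.map_coeff, hD.gaussian_mul_right ρ (hincl _), hρi]
  · exact hasFiniteSupport_conv y (h.map incl) w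

/-- Repeated integration by parts. -/
theorem IsPropagator.gaussian_coeff_mul_eq_sum [CharZero 𝕜] (hD : IsPropagator q c D)
    {ρ : Pol 𝕜 q →ₐ[𝕜] Pol 𝕜 q'} (hρ : ∀ i, c i ≠ 0 → ρ (X q i) = 0) (hc : ∀ i, c i ≤ 1)
    (incl : Pol 𝕜 q' →ₐ[𝕜] Pol 𝕜 q) (hincl : ∀ x, incl x ∈ homog c 0)
    (hρi : ∀ x, ρ (incl x) = x) (hπ : ∀ x, x = incl (ρ x) + euler c (invCount c x))
    {s y : Formal 𝕜 q} (hs : ∀ w, s.coeff w ∈ homog q 0) (hy0 : ∀ w, y.coeff w ∈ homog q 0)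
    (hy : ∀ j, y.map (polDL j) = s.map (polDL j) * y) {F : ℕ → Formal 𝕜 q}
    (hF : ∀ n w, (F (n + 1)).coeff w = secondOrder D (invCount c ((F n).coeff w)) +
      ∑ᶠ u, bidiff D (s.coeff u) (invCount c ((F n).coeff (w - u)))) (N : ℕ) (w : ℤ) :
    gaussian c D ρ ((F 0 * y).coeff w) =
      ∑ n ∈ Finset.range N, (y.map (gaussian c D ρ) * (F n).map ρ).coeff w +
        gaussian c D ρ ((F N * y).coeff w) := by
  induction N with
  | zero => simp
  | succ N ih =>
    rw [ih, Finset.sum_range_succ, hD.gaussian_coeff_mul hρ hc (incl.toLinearMap ∘ₗ ρ.toLinearMap)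
      hπ hs hy (hF N), add_assoc, ← hD.gaussian_coeff_mul_incl incl hincl hρi hy0]
    rfl

end GaussianFormal

/-! ### Convergence of the iterated perturbations. -/

section Iteration

variable {𝕜 : Type*} [Field 𝕜] {ι : Type*} {p : ι → ℤ} {A : Pol 𝕜 p →ₗ[𝕜] Pol 𝕜 p}
  {T : Formal 𝕜 p → Formal 𝕜 p}

theorem iterate_mem_fil
    (hT : ∀ (F : Formal 𝕜 p) (w : ℤ), F ∈ fil 𝕜 p w → (T F).coeff w = A (F.coeff w)) {a : ℤ}
    {F : Formal 𝕜 p} (hF : F ∈ fil 𝕜 p a) (n : ℕ) : T^[n] F ∈ fil 𝕜 p a := by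
  induction n with
  | zero => exact hF
  | succ n ih =>
    rw [Function.iterate_succ_apply']
    intro v hv
    rw [hT _ _ (fil_mono hv.le ih), ih v hv, map_zero]

/-- On the lowest weight T acts as the locally nilpotent A, so enough iterations annihilate the
lowest coefficient; the induction on k removes one weight at a time. -/
theorem exists_iterate_mem_fil (hA : LowersDegree A)
    (hT : ∀ (F : Formal 𝕜 p) (w : ℤ), F ∈ fil 𝕜 p w → (T F).coeff w = A (F.coeff w))
    (F : Formal 𝕜 p) (w : ℤ) : ∃ N, ∀ n, N ≤ n → T^[n] F ∈ fil 𝕜 p w := by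
  obtain ⟨a, ha⟩ := exists_mem_fil F
  have key : ∀ k : ℕ, ∃ N, ∀ n, N ≤ n → T^[n] F ∈ fil 𝕜 p (a + k) := by
    intro k
    induction k with
    | zero => exact ⟨0, fun n _ => by simpa using iterate_mem_fil hT ha n⟩
    | succ k ih =>
      obtain ⟨N, hN⟩ := ih
      have h1 : ∀ n : ℕ, (T^[n + N] F).coeff (a + k) = (A ^ n) ((T^[N] F).coeff (a + k)) := by
        intro n
        induction n with
        | zero => simp
        | succ n ih =>
          rw [add_right_comm, Function.iterate_succ_apply', hT _ _ (hN _ (by lia)), ih, pow_succ']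
          rfl
      obtain ⟨M, hM⟩ := hA.exists_pow_eq_zero ((T^[N] F).coeff (a + k))
      refine ⟨N + M, fun n hn v hv => ?_⟩
      rcases lt_or_ge v (a + k) with h | h
      · exact hN n (by lia) v h
      · have h2 := h1 (n - N)
        rw [Nat.sub_add_cancel (by lia), hM _ (by lia)] at h2
        rwa [show v = a + k by push_cast at hv; lia]
  obtain ⟨N, hN⟩ := key (w - a).toNat
  exact ⟨N, fun n hn => fil_mono (by lia) (hN n hn)⟩

theorem summable_iterate (hA : LowersDegree A)
    (hT : ∀ (F : Formal 𝕜 p) (w : ℤ), F ∈ fil 𝕜 p w → (T F).coeff w = A (F.coeff w))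
    (F : Formal 𝕜 p) : Summable fun n => T^[n] F := by
  obtain ⟨a, ha⟩ := exists_mem_fil F
  refine summable_nat (iterate_mem_fil hT ha) fun w => ?_
  obtain ⟨N, hN⟩ := exists_iterate_mem_fil hA hT F (w + 1)
  exact ⟨N, fun n hn => hN n hn w (by lia)⟩

end Iteration

/-! ### The factorization P₁(f e^{S_int/ħ}) = P₁(e^{S_int/ħ}) P₂(f). -/

section Perturbation

variable {𝕜 : Type*} [Field 𝕜] {ιH ιB ιC : Type*} {p : ιH ⊕ ιB ⊕ ιC → ℤ}
  {ωi : ιH ⊕ ιB ⊕ ιC → ιH ⊕ ιB ⊕ ιC → 𝕜} {Qi : ιB → ιC → 𝕜}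

theorem koszul_mem_degIn (Qi : ιB → ιC → 𝕜) {E : Set ℕ} {x : Pol 𝕜 p}
    (hx : x ∈ degIn (fun _ => 1) E) : koszul Qi x ∈ degIn (fun _ => 1) E := by
  rw [koszul_apply]
  refine finsum_mem_submodule _ fun i => ?_
  have hb : ∑ᶠ k : ιB, Qi k i • X p (Sum.inr (Sum.inl k)) ∈
      degIn (𝕜 := 𝕜) (p := p) (fun _ => 1) {1} :=
    finsum_mem_submodule _ fun k => Submodule.smul_mem _ _
      (homog_le_degIn (Set.mem_singleton 1) (X_mem_homog (fun _ => 1) (Sum.inr (Sum.inl k))))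
  refine mul_mem_degIn (fun a ha b hb => ?_) hb (polDL_mem_degIn _ hx)
  rw [Set.mem_singleton_iff.1 ha, add_comm]
  exact hb

/-- The homotopy on polynomials. -/
def polHomotopy (Qi : ιB → ιC → 𝕜) : Pol 𝕜 p →ₗ[𝕜] Pol 𝕜 p := invCount countBC ∘ₗ koszul Qi

theorem polHomotopy_mem_degIn (Qi : ιB → ιC → 𝕜) {E : Set ℕ} {x : Pol 𝕜 p}
    (hx : x ∈ degIn (fun _ => 1) E) : polHomotopy Qi x ∈ degIn (fun _ => 1) E :=
  invCount_mem_degIn _ (koszul_mem_degIn Qi hx)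

/-- The operator `Δ K` on polynomials. -/
def polLapHomotopy (ωi : ιH ⊕ ιB ⊕ ιC → ιH ⊕ ιB ⊕ ιC → 𝕜) (Qi : ιB → ιC → 𝕜) :
    Pol 𝕜 p →ₗ[𝕜] Pol 𝕜 p :=
  (1 / 2 : 𝕜) • (secondOrder (signed p ωi) ∘ₗ polHomotopy Qi)

theorem lowersDegree_polLapHomotopy (ωi : ιH ⊕ ιB ⊕ ιC → ιH ⊕ ιB ⊕ ιC → 𝕜) (Qi : ιB → ιC → 𝕜) :
    LowersDegree (polLapHomotopy (p := p) ωi Qi) := fun E _ hx =>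
  Submodule.smul_mem _ _ (lowersDegree_secondOrder _ E _ (polHomotopy_mem_degIn Qi hx))

theorem IsHodgeMatrices.killB_polLapHomotopy [CharZero 𝕜] (h : IsHodgeMatrices p ωi Qi) (x : Pol 𝕜 p) :
    killB p (polLapHomotopy ωi Qi x) =
      secondOrder (propagatorHC p ωi Qi) (invCount countC (killB p x)) := by
  rw [polLapHomotopy, LinearMap.smul_apply, LinearMap.comp_apply, polHomotopy,
    LinearMap.comp_apply, invCount_koszul, map_smul, h.killB_secondOrder_koszul, killB_invCount,
    smul_smul]
  norm_num

theorem IsHodgeMatrices.killB_bidiff_polHomotopy (h : IsHodgeMatrices p ωi Qi) (s x : Pol 𝕜 p) :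
    killB p (bidiff (signed p ωi) s (polHomotopy Qi x)) =
      bidiff (propagatorHC p ωi Qi) (killB p s) (invCount countC (killB p x)) := by
  rw [polHomotopy, LinearMap.comp_apply, invCount_koszul, h.killB_bidiff_koszul, killB_invCount]

theorem IsHodgeMatrices.coeff_delta₁_homotopy (h : IsHodgeMatrices p ωi Qi) (F : Formal 𝕜 p)
    (w : ℤ) : (delta₁ ωi (homotopy Qi F)).coeff w = polLapHomotopy ωi Qi (F.coeff w) := by
  rw [coeff_delta₁, coeff_homotopy h.finite_Q']
  rfl

theorem IsHodgeMatrices.coeff_delta₂_homotopy (h : IsHodgeMatrices p ωi Qi) {S : Formal 𝕜 p}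
    (hS : ∀ w, (int S).coeff w ∈ homog p 0) (F : Formal 𝕜 p) (w : ℤ) :
    (delta₂ ωi S (homotopy Qi F)).coeff w = polLapHomotopy ωi Qi (F.coeff w) +
      ∑ᶠ u, bidiff (signed p ωi) ((hbar 𝕜 p (-1) * int S).coeff u)
        (polHomotopy Qi (F.coeff (w - u))) := by
  rw [coeff_delta₂ ωi hS, coeff_homotopy h.finite_Q']
  congr 1
  exact finsum_congr fun u => by rw [coeff_homotopy h.finite_Q']; rfl

/-- S_int/ħ has weight at least 1, so at weight w the bracket term sees only coefficients of F below
w, which vanish. -/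
theorem IsHodgeMatrices.coeff_delta₂_homotopy_of_mem (h : IsHodgeMatrices p ωi Qi) {S : Formal 𝕜 p}
    (hS : ∀ w, (int S).coeff w ∈ homog p 0) (hS1 : hbar 𝕜 p (-1) * int S ∈ fil 𝕜 p 1)
    (F : Formal 𝕜 p) (w : ℤ) (hF : F ∈ fil 𝕜 p w) :
    (delta₂ ωi S (homotopy Qi F)).coeff w = polLapHomotopy ωi Qi (F.coeff w) := by
  rw [h.coeff_delta₂_homotopy hS, finsum_eq_zero_of_forall_eq_zero, add_zero]
  intro u
  rcases lt_or_ge u 1 with hu | hu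
  · rw [hS1 u hu, map_zero]; rfl
  · rw [hF (w - u) (by lia), map_zero, map_zero]

theorem IsHodgeMatrices.summable_delta₁ (h : IsHodgeMatrices p ωi Qi) (F : Formal 𝕜 p) :
    Summable (perturbTerms Qi (delta₁ ωi) F) :=
  summable_iterate (lowersDegree_polLapHomotopy ωi Qi)
    (fun F w _ => h.coeff_delta₁_homotopy F w) F

theorem IsHodgeMatrices.summable_delta₂ (h : IsHodgeMatrices p ωi Qi) {S : Formal 𝕜 p}
    (hS : ∀ w, (int S).coeff w ∈ homog p 0) (hS1 : hbar 𝕜 p (-1) * int S ∈ fil 𝕜 p 1)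
    (F : Formal 𝕜 p) : Summable (perturbTerms Qi (delta₂ ωi S) F) :=
  summable_iterate (lowersDegree_polLapHomotopy ωi Qi)
    (h.coeff_delta₂_homotopy_of_mem hS hS1) F

theorem coeff_perturbedProj {δ : Formal 𝕜 p → Formal 𝕜 p} {F : Formal 𝕜 p}
    (hs : Summable (perturbTerms Qi δ F)) (w : ℤ) : (perturbedProj Qi δ F).coeff w =
      ∑ᶠ n, killC p (killB p ((perturbTerms Qi δ F n).coeff w)) := by
  rw [perturbedProj, proj, HahnSeries.map_coeff, coeff_formalSum hs, map_finsum _ (hs.2 w)]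
  exact finsum_congr fun n => polRestrict_eq _

/-- `killB` intertwines δ₁K with the operator whose geometric series defines the Gaussian integral.
-/
theorem IsHodgeMatrices.coeff_perturbedProj_delta₁ [CharZero 𝕜] (h : IsHodgeMatrices p ωi Qi) (F : Formal 𝕜 p)
    (w : ℤ) : (perturbedProj Qi (delta₁ ωi) F).coeff w =
      gaussian countC (propagatorHC p ωi Qi) (killC p) (killB p (F.coeff w)) := by
  have h1 : ∀ n : ℕ, killB p ((perturbTerms Qi (delta₁ ωi) F n).coeff w) =
      ((secondOrder (propagatorHC p ωi Qi) ∘ₗ invCount countC) ^ n) (killB p (F.coeff w)) := by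
    intro n
    induction n with
    | zero => rfl
    | succ n ih =>
      rw [perturbTerms, Function.iterate_succ_apply', h.coeff_delta₁_homotopy,
        h.killB_polLapHomotopy, pow_succ']
      exact congrArg (fun z => secondOrder (propagatorHC p ωi Qi) (invCount countC z)) ih
  rw [coeff_perturbedProj (h.summable_delta₁ F)]
  exact finsum_congr fun n => congrArg _ (h1 n)

theorem killC_of_countC (i : ιH ⊕ ιC) (hi : countC i ≠ 0) :
    killC p (X (degHC p) i : Pol 𝕜 (degHC p)) = 0 := by
  rcases i with i | i
  · exact absurd rfl hi
  · exact killC_inr i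

theorem countC_le_one (i : ιH ⊕ ιC) : countC i ≤ 1 := by
  rcases i with i | i <;> simp [countC]

theorem killB_homog_zero {x : Pol 𝕜 p} (hx : x ∈ homog p 0) : killB p x ∈ homog (degHC p) 0 :=
  map_mem_homog (killB p) (killB_mem_homog fun _ => rfl) hx

theorem coeff_hbar_int_mem {S : Formal 𝕜 p} (hS : ∀ w, (int S).coeff w ∈ homog p 0) (w : ℤ) :
    (hbar 𝕜 p (-1) * int S).coeff w ∈ homog p 0 := by
  rw [coeff_hbar_mul]
  exact hS _

theorem map_killB_polDL_expInt [CharZero 𝕜] {S : Formal 𝕜 p} (hS : ∀ w, (int S).coeff w ∈ homog p 0)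
    (hS1 : hbar 𝕜 p (-1) * int S ∈ fil 𝕜 p 1) (j : ιH ⊕ ιC) :
    ((expInt S).map (killB p)).map (polDL j) =
      ((hbar 𝕜 p (-1) * int S).map (killB p)).map (polDL j) * (expInt S).map (killB p) := by
  have h := congrArg (fun G => HahnSeries.map G (killB p))
    (map_polDL_formalExp (Sum.map id Sum.inr j) (coeff_hbar_int_mem hS) hS1)
  simp only [coeff_map_mul] at h
  have h2 : ∀ F : Formal 𝕜 p, (F.map (killB p)).map (polDL j) =
      (F.map (polDL (Sum.map id Sum.inr j))).map (killB p) := fun F => by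
    ext w
    simp only [HahnSeries.map_coeff]
    exact (killB_polDL j _).symm
  rw [h2, h2]
  exact h

/-- At β = 0 one integration by parts against y is one application of δ₂K. Repeating it turns the
integral of f y into Φ(y) times the partial sums of P₂(f), plus a remainder of arbitrarily high
weight. -/
theorem IsHodgeMatrices.perturbedProj_mul_expInt [CharZero 𝕜] (h : IsHodgeMatrices p ωi Qi) {S : Formal 𝕜 p}
    (hS : ∀ w, (int S).coeff w ∈ homog p 0) (hS1 : hbar 𝕜 p (-1) * int S ∈ fil 𝕜 p 1)
    (f : Formal 𝕜 p) : perturbedProj Qi (delta₁ ωi) (f * expInt S) =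
      perturbedProj Qi (delta₁ ωi) (expInt S) * perturbedProj Qi (delta₂ ωi S) f := by
  set Φ := gaussian countC (propagatorHC p ωi Qi) (killC (𝕜 := 𝕜) p)
  set F : ℕ → Formal 𝕜 (degHC p) := fun n => (perturbTerms Qi (delta₂ ωi S) f n).map (killB p)
  set y := (expInt S).map (killB p) with hy
  have hP1 : perturbedProj Qi (delta₁ ωi) (expInt S) = y.map Φ := by
    ext w
    rw [h.coeff_perturbedProj_delta₁]
    rfl
  have hexp0 : expInt S ∈ fil 𝕜 p 0 := by
    rw [expInt, formalExp_eq]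
    exact (isEval_evalSeries hS1 (PowerSeries.exp 𝕜)).mem isFiltration_fil (N := 0) hS1 (by simp)
  have hy1 : y ∈ fil 𝕜 (degHC p) 0 := fun v hv => by
    rw [hy, HahnSeries.map_coeff, hexp0 v hv, map_zero]
  have hF : ∀ n w, (F (n + 1)).coeff w =
      secondOrder (propagatorHC p ωi Qi) (invCount countC ((F n).coeff w)) +
        ∑ᶠ u, bidiff (propagatorHC p ωi Qi)
          (((hbar 𝕜 p (-1) * int S).map (killB p)).coeff u)
            (invCount countC ((F n).coeff (w - u))) := by
    intro n w
    have h1 : (perturbTerms Qi (delta₂ ωi S) f (n + 1)).coeff w =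
        (delta₂ ωi S (homotopy Qi (perturbTerms Qi (delta₂ ωi S) f n))).coeff w := by
      rw [perturbTerms, Function.iterate_succ_apply']
      rfl
    simp only [F, HahnSeries.map_coeff]
    rw [h1, h.coeff_delta₂_homotopy hS, map_add, h.killB_polLapHomotopy, map_finsum]
    · congr 1
      exact finsum_congr fun u => h.killB_bidiff_polHomotopy _ _
    · exact (finite_conv_formal (hbar 𝕜 p (-1) * int S) (perturbTerms Qi (delta₂ ωi S) f n) w).subset
        fun u hu => ⟨fun h0 => hu (by simp [h0]), fun h0 => hu (by simp [h0])⟩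
  ext w
  -- From N on the iterates have weight above w. As y has weight at least 0, the remainder then
  -- contributes nothing at weight w.
  obtain ⟨N, hN⟩ := exists_iterate_mem_fil (lowersDegree_polLapHomotopy ωi Qi)
    (h.coeff_delta₂_homotopy_of_mem hS hS1) f (w + 1)
  have hNF : ∀ n, N ≤ n → F n ∈ fil 𝕜 (degHC p) (w + 1) := fun n hn v hv => by
    change killB p ((perturbTerms Qi (delta₂ ωi S) f n).coeff v) = 0
    rw [show (perturbTerms Qi (delta₂ ωi S) f n).coeff v = 0 from hN n hn v hv, map_zero]
  have hsum := h.isPropagator.gaussian_coeff_mul_eq_sum (ρ := killC (𝕜 := 𝕜) p) killC_of_countC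
    countC_le_one (inclH p) inclH_mem_homog_zero killC_inclH eq_inclH_add_euler
    (fun w => killB_homog_zero (coeff_hbar_int_mem hS w))
    (fun w => killB_homog_zero (formalExp_coeff_mem_homog (coeff_hbar_int_mem hS) w))
    (map_killB_polDL_expInt hS hS1) hF N w
  have hzero : (F N * y).coeff w = 0 := mul_mem_fil (hNF N le_rfl) hy1 w (by lia)
  have hP2 : ∀ v ≤ w, (perturbedProj Qi (delta₂ ωi S) f).coeff v =
      ∑ n ∈ Finset.range N, ((F n).map (killC p)).coeff v := fun v hv => by
    rw [coeff_perturbedProj (h.summable_delta₂ hS hS1 f)]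
    refine finsum_eq_sum_of_forall _ fun n hn => ?_
    have := hNF n (by simpa using hn) v (by lia)
    rw [show killB p ((perturbTerms Qi (delta₂ ωi S) f n).coeff v) = 0 from this, map_zero]
  have hL : (perturbedProj Qi (delta₁ ωi) (f * expInt S)).coeff w = Φ ((F 0 * y).coeff w) := by
    rw [h.coeff_perturbedProj_delta₁, ← HahnSeries.map_coeff, coeff_map_mul]
    rfl
  rw [hL, hsum, hP1]
  change _ + Φ ((F N * y).coeff w) = _
  rw [hzero, map_zero, add_zero, coeff_mul_eq_finsum]
  have h2 : ∀ u, (y.map Φ).coeff u * (perturbedProj Qi (delta₂ ωi S) f).coeff (w - u) =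
      ∑ n ∈ Finset.range N, (y.map Φ).coeff u * ((F n).map (killC p)).coeff (w - u) := fun u => by
    rcases lt_or_ge u 0 with hu | hu
    · rw [HahnSeries.map_coeff, hy1 u hu, map_zero, zero_mul]
      simp
    · rw [hP2 _ (by lia), Finset.mul_sum]
  rw [finsum_congr h2, finsum_sum_comm]
  · exact Finset.sum_congr rfl fun n _ => coeff_mul_eq_finsum _ _ _
  · intro n _
    exact hasFiniteSupport_conv (y.map Φ) ((F n).map (killC p)) w

/-- The exponential is 1 plus terms of positive weight, and the Gaussian integral preserves weights
and fixes 1. -/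
theorem IsHodgeMatrices.perturbedProj_expInt_sub_one_mem [CharZero 𝕜] (h : IsHodgeMatrices p ωi Qi)
    {S : Formal 𝕜 p} (hS1 : hbar 𝕜 p (-1) * int S ∈ fil 𝕜 p 1) :
    perturbedProj Qi (delta₁ ωi) (expInt S) - 1 ∈ fil 𝕜 (degH p) 1 := by
  intro v hv
  have h1 := formalSum_sub_mem_fil (smul_pow_mem_fil hS1 fun n => (n.factorial : 𝕜)⁻¹) 1 v hv
  rw [HahnSeries.coeff_sub, sub_eq_zero] at h1
  rw [HahnSeries.coeff_sub, h.coeff_perturbedProj_delta₁, expInt, formalExp, h1]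
  simp only [Finset.range_one, Finset.sum_singleton, pow_zero,
    HahnSeries.coeff_one, Nat.factorial_zero, Nat.cast_one, inv_one, one_smul]
  split_ifs with hv0
  · rw [map_one, gaussian_eq_add, map_one, invCount_of_mem (one_mem_homog _)]
    simp
  · simp

theorem IsHodgeMatrices.formalExp_hbar_effAction [CharZero 𝕜] (h : IsHodgeMatrices p ωi Qi) {S : Formal 𝕜 p}
    (hS1 : hbar 𝕜 p (-1) * int S ∈ fil 𝕜 p 1) :
    hbar 𝕜 (degH p) (-1) * effAction ωi Qi S =
      formalLog (perturbedProj Qi (delta₁ ωi) (expInt S)) ∧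
    formalExp (hbar 𝕜 (degH p) (-1) * effAction ωi Qi S) =
      perturbedProj Qi (delta₁ ωi) (expInt S) := by
  have h1 : hbar 𝕜 (degH p) (-1) * effAction ωi Qi S =
      formalLog (perturbedProj Qi (delta₁ ωi) (expInt S)) := by
    ext w
    rw [effAction, coeff_hbar_mul, coeff_hbar_mul]
    congr 1
    ring
  exact ⟨h1, by rw [h1, formalExp_formalLog (h.perturbedProj_expInt_sub_one_mem hS1)]⟩

theorem IsHodgeMatrices.pathIntegral_eq [CharZero 𝕜] (h : IsHodgeMatrices p ωi Qi) {S : Formal 𝕜 p}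
    (hS : ∀ w, (int S).coeff w ∈ homog p 0) (hS1 : hbar 𝕜 p (-1) * int S ∈ fil 𝕜 p 1)
    (f : Formal 𝕜 p) : pathIntegral ωi Qi S f = perturbedProj Qi (delta₂ ωi S) f := by
  obtain ⟨h1, h2⟩ := h.formalExp_hbar_effAction hS1
  have h3 : hbar 𝕜 (degH p) (-1) * effAction ωi Qi S ∈ fil 𝕜 (degH p) 1 := by
    rw [h1]
    exact formalLog_mem_fil (h.perturbedProj_expInt_sub_one_mem hS1)
  rw [pathIntegral, h.perturbedProj_mul_expInt hS hS1, ← h2, ← mul_assoc, formalExp_neg_mul h3,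
    one_mul]

end Perturbation

/-! ### Genus bookkeeping. -/

section Parts

variable {𝕜 : Type*} [Field 𝕜] {ι : Type*} {p : ι → ℤ}

/-- The possible coefficients of weight `w` of a formal sum whose parts have genera in `P`. -/
def genusIn (P : Set ℤ) (w : ℤ) : Submodule 𝕜 (Pol 𝕜 p) :=
  degIn (fun _ => 1) {n : ℕ | ∃ g : ℤ, w = 2 * g + n ∧ g ∈ P}

theorem mem_fun_iff {F : Formal 𝕜 p} :
    F ∈ Fun 𝕜 p ↔ ∀ w, F.coeff w ∈ genusIn (Set.Ici 0) w := Iff.rfl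

/-- With arbitrary integer genus, `genusIn Set.univ w` only requires degrees of the parity of w;
positivity is the filtration condition. -/
theorem mem_funPos_iff {F : Formal 𝕜 p} :
    F ∈ FunPos 𝕜 p ↔ F ∈ fil 𝕜 p 1 ∧ ∀ w, F.coeff w ∈ genusIn Set.univ w := by
  constructor
  · intro h
    refine ⟨fun w hw => degIn_empty (wt := fun _ => 1) fun n hn => ?_, fun w n hn => ?_⟩
    · obtain ⟨g, hg, hg1⟩ := h w n hn
      lia
    · obtain ⟨g, hg, hg1⟩ := h w n hn
      exact ⟨g, hg, trivial⟩
  · rintro ⟨h1, h2⟩ w n hn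
    obtain ⟨g, hg, -⟩ := h2 w n hn
    refine ⟨g, hg, ?_⟩
    by_contra hc
    exact hn (by rw [h1 w (by lia), map_zero])

theorem one_mem_genusIn {P : Set ℤ} (hP : 0 ∈ P) : (1 : Pol 𝕜 p) ∈ genusIn P 0 :=
  homog_le_degIn (m := (0 : ℕ)) (A := {n : ℕ | ∃ g : ℤ, (0 : ℤ) = 2 * g + n ∧ g ∈ P})
    ⟨0, by simp, hP⟩ (one_mem_homog _)

theorem mul_mem_genusIn_univ (u v : ℤ) (x : Pol 𝕜 p) (hx : x ∈ genusIn Set.univ u) (y : Pol 𝕜 p)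
    (hy : y ∈ genusIn Set.univ v) : x * y ∈ genusIn Set.univ (u + v) := by
  refine mul_mem_degIn ?_ hx hy
  rintro m ⟨g, hg, -⟩ n ⟨k, hk, -⟩
  exact ⟨g + k, by push_cast; lia, trivial⟩

theorem one_coeff_mem_genusIn (w : ℤ) :
    (1 : Formal 𝕜 p).coeff w ∈ genusIn (𝕜 := 𝕜) (p := p) Set.univ w := by
  rw [HahnSeries.coeff_one]
  split_ifs with h
  · exact h ▸ one_mem_genusIn (Set.mem_univ 0)
  · exact zero_mem _

theorem formalLog_coeff_mem_genusIn {F : Formal 𝕜 p} (hF : ∀ w, F.coeff w ∈ genusIn Set.univ w)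
    (w : ℤ) : (formalLog F).coeff w ∈ genusIn Set.univ w := by
  refine formalSum_coeff_mem _ fun n => ?_
  rw [HahnSeries.coeff_smul]
  refine Submodule.smul_mem _ _ (pow_coeff_mem (one_mem_genusIn (Set.mem_univ 0))
    (fun u v x hx y hy => mul_mem_genusIn_univ u v x hx y hy) (fun w => ?_) (n + 1) w)
  rw [HahnSeries.coeff_sub]
  exact sub_mem (hF w) (one_coeff_mem_genusIn w)

/-- At fixed weight 2g + n, lowering n by 2 raises g by 1. -/
theorem LowersDegree.mem_genusIn {A : Pol 𝕜 p →ₗ[𝕜] Pol 𝕜 p} (hA : LowersDegree A) {P : Set ℤ}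
    (hP : ∀ g ∈ P, g + 1 ∈ P) {w : ℤ} {x : Pol 𝕜 p} (hx : x ∈ genusIn P w) :
    A x ∈ genusIn P w := by
  refine degIn_mono ?_ (hA _ _ hx)
  rintro n ⟨g, hg, hgP⟩
  exact ⟨g + 1, by push_cast at hg; lia, hP g hgP⟩

/-- The weights u and v add while two derivatives lower the total degree by 2, so genera g and k
combine to g + k + 1. -/
theorem bidiff_mem_genusIn (D : ι → ι → 𝕜) {P P' P'' : Set ℤ}
    (hP : ∀ g ∈ P, ∀ k ∈ P', g + k + 1 ∈ P'') {u v : ℤ} {x y : Pol 𝕜 p} (hx : x ∈ genusIn P u)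
    (hy : y ∈ genusIn P' v) : bidiff D x y ∈ genusIn P'' (u + v) := by
  rw [bidiff_apply]
  refine finsum_mem_submodule _ fun l =>
    mul_mem_degIn ?_ (contract_mem_degIn D l hx) (polDL_mem_degIn l hy)
  rintro m ⟨g, hg, hgP⟩ n ⟨k, hk, hkP⟩
  exact ⟨g + k + 1, by push_cast at hg hk ⊢; lia, hP g hgP k hkP⟩

end Parts

/-! ### Weights and genera of the interaction. -/

section Interaction

variable {𝕜 : Type*} [Field 𝕜] {ι : Type*} {p : ι → ℤ} {ωi : ι → ι → 𝕜} {S : Formal 𝕜 p}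

theorem coeff_free (S : Formal 𝕜 p) (w : ℤ) :
    (free S).coeff w = if w = 2 then polyPart 2 (S.coeff 2) else 0 := by
  rw [free]
  split_ifs with h
  · rw [h, HahnSeries.coeff_single_same]
    rfl
  · rw [HahnSeries.coeff_single_of_ne h]

theorem coeff_int_mem (hS : HasDegree 0 S) (w : ℤ) : (int S).coeff w ∈ homog p 0 := by
  rw [int, HahnSeries.coeff_sub, coeff_free]
  refine sub_mem (hS w) ?_
  split_ifs
  · exact component_mem_homog_of_mem (fun _ => 1) 2 (hS 2)
  · exact zero_mem _

theorem IsQuantumLInfty.hasParts_int (h : IsQuantumLInfty ωi S) :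
    HasParts (fun g n => 0 ≤ g ∧ 3 ≤ 2 * g + n) (int S) := by
  intro w n hn
  have hpp : ∀ x : Pol 𝕜 p, polyPart n (polyPart 2 x) = if 2 = n then polyPart 2 x else 0 :=
    fun x => by
      split_ifs with h2
      · exact h2 ▸ component_self (component_mem_homog _ _ _)
      · exact component_of_ne (component_mem_homog _ _ _) h2
  rw [int, HahnSeries.coeff_sub, coeff_free, map_sub] at hn
  have hSn : polyPart n (S.coeff w) ≠ 0 := by
    intro h0
    refine hn ?_
    rw [h0, zero_sub, neg_eq_zero]
    split_ifs with hw
    · rw [hpp]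
      split_ifs with h2
      · rwa [← h2, hw] at h0
      · rfl
    · exact map_zero _
  obtain ⟨g, hg, hg0⟩ := h.mem_fun w n hSn
  refine ⟨g, hg, hg0, ?_⟩
  by_contra hc
  -- These are all pairs with g ≥ 0 and 2g + n ≤ 2. They are excluded by the condition in genus 0,
  -- the subtraction of S_free and the condition in genus 1.
  have hcases : (g = 0 ∧ n < 2) ∨ (g = 0 ∧ n = 2) ∨ (g = 1 ∧ n = 0) := by lia
  rcases hcases with ⟨rfl, h2⟩ | ⟨rfl, rfl⟩ | ⟨rfl, rfl⟩
  · exact hSn (by rw [hg]; exact h.genus_zero n h2)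
  · refine hn ?_
    rw [if_pos (by lia), hpp, if_pos rfl, show w = 2 by lia, sub_self]
  · exact hSn (by rw [hg]; exact h.genus_one)

theorem IsQuantumLInfty.hbar_int_mem_fil (h : IsQuantumLInfty ωi S) :
    hbar 𝕜 p (-1) * int S ∈ fil 𝕜 p 1 := by
  intro w hw
  rw [coeff_hbar_mul]
  refine degIn_empty (wt := fun _ => 1) fun n hn => ?_
  obtain ⟨g, hg, h0, h3⟩ := h.hasParts_int _ n hn
  lia

theorem IsQuantumLInfty.coeff_hbar_int_mem_genusIn (h : IsQuantumLInfty ωi S) (w : ℤ) :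
    (hbar 𝕜 p (-1) * int S).coeff w ∈ genusIn (Set.Ici (-1)) w := by
  rw [coeff_hbar_mul]
  intro n hn
  obtain ⟨g, hg, h0, h3⟩ := h.hasParts_int _ n hn
  exact ⟨g - 1, by lia, by rw [Set.mem_Ici]; lia⟩

end Interaction

/-! ### Stability of Fun and Fun₊ under the perturbed projections. -/

section PerturbationParts

variable {𝕜 : Type*} [Field 𝕜] {ιH ιB ιC : Type*} {p : ιH ⊕ ιB ⊕ ιC → ℤ}
  {ωi : ιH ⊕ ιB ⊕ ιC → ιH ⊕ ιB ⊕ ιC → 𝕜} {Qi : ιB → ιC → 𝕜} {P : Set ℤ}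

theorem perturbedProj_coeff_mem_genusIn {δ : Formal 𝕜 p → Formal 𝕜 p}
    (hδ : ∀ F, (∀ w, F.coeff w ∈ genusIn P w) →
      ∀ w, (δ (homotopy Qi F)).coeff w ∈ genusIn P w) {F : Formal 𝕜 p}
    (hF : ∀ w, F.coeff w ∈ genusIn P w) (w : ℤ) :
    (perturbedProj Qi δ F).coeff w ∈ genusIn P w := by
  have h : ∀ n w, (perturbTerms Qi δ F n).coeff w ∈ genusIn P w := by
    intro n
    induction n with
    | zero => exact hF
    | succ n ih =>
      rw [perturbTerms, Function.iterate_succ_apply']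
      exact hδ _ ih
  rw [perturbedProj, proj, HahnSeries.map_coeff, polRestrict_eq]
  have h1 : (formalSum (perturbTerms Qi δ F)).coeff w ∈ genusIn P w :=
    formalSum_coeff_mem _ fun n => h n w
  have h2 := map_mem_degIn (wt := fun _ => 1) (wt' := fun _ => 1) (killB p)
    (killB_mem_homog fun _ => rfl) h1
  exact map_mem_degIn (wt := fun _ => 1) (wt' := fun _ => 1) (killC p)
    (killC_mem_homog fun _ => rfl) h2

theorem perturbedProj_mem_fil {δ : Formal 𝕜 p → Formal 𝕜 p} {a : ℤ} {F : Formal 𝕜 p}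
    (h : ∀ n, perturbTerms Qi δ F n ∈ fil 𝕜 p a) : perturbedProj Qi δ F ∈ fil 𝕜 (degH p) a := by
  intro v hv
  have h0 : (formalSum (perturbTerms Qi δ F)).coeff v ∈ (⊥ : Submodule 𝕜 (Pol 𝕜 p)) :=
    formalSum_coeff_mem _ fun n => h n v hv
  rw [perturbedProj, proj, HahnSeries.map_coeff, (Submodule.mem_bot 𝕜).1 h0, map_zero]

theorem IsHodgeMatrices.delta₁_coeff_mem_genusIn (h : IsHodgeMatrices p ωi Qi)
    (hP : ∀ g ∈ P, g + 1 ∈ P) (F : Formal 𝕜 p) (hF : ∀ w, F.coeff w ∈ genusIn P w) (w : ℤ) :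
    (delta₁ ωi (homotopy Qi F)).coeff w ∈ genusIn P w := by
  rw [h.coeff_delta₁_homotopy]
  exact (lowersDegree_polLapHomotopy ωi Qi).mem_genusIn hP (hF w)

/-- In `hP`, g ≥ -1 is a genus of S_int/ħ and the summand 1 comes from the contraction; the instance
g = 0 accounts for ħΔ. -/
theorem IsHodgeMatrices.delta₂_coeff_mem_genusIn (h : IsHodgeMatrices p ωi Qi) {S : Formal 𝕜 p}
    (hS : IsQuantumLInfty ωi S) (hP : ∀ g ∈ Set.Ici (-1), ∀ k ∈ P, g + k + 1 ∈ P)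
    (F : Formal 𝕜 p) (hF : ∀ w, F.coeff w ∈ genusIn P w) (w : ℤ) :
    (delta₂ ωi S (homotopy Qi F)).coeff w ∈ genusIn P w := by
  rw [h.coeff_delta₂_homotopy (coeff_int_mem hS.degree_zero)]
  refine add_mem ((lowersDegree_polLapHomotopy ωi Qi).mem_genusIn (fun g hg => ?_) (hF w))
    (finsum_mem_submodule _ fun u => ?_)
  · simpa using hP 0 (by simp) g hg
  · have := bidiff_mem_genusIn (signed p ωi) hP (hS.coeff_hbar_int_mem_genusIn u)
      (polHomotopy_mem_degIn Qi (hF (w - u)) : _ ∈ genusIn P (w - u))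
    rwa [add_sub_cancel] at this

theorem IsHodgeMatrices.perturbedProj_mem_fun (h : IsHodgeMatrices p ωi Qi) {S : Formal 𝕜 p}
    (hS : IsQuantumLInfty ωi S) {f : Formal 𝕜 p} (hf : f ∈ Fun 𝕜 p) :
    perturbedProj Qi (delta₂ ωi S) f ∈ Fun 𝕜 (degH p) :=
  perturbedProj_coeff_mem_genusIn (P := Set.Ici 0) (h.delta₂_coeff_mem_genusIn hS fun g hg k hk => by
    rw [Set.mem_Ici] at hg hk ⊢
    lia) (mem_fun_iff.1 hf)

theorem IsHodgeMatrices.perturbedProj_mem_funPos (h : IsHodgeMatrices p ωi Qi) {S : Formal 𝕜 p}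
    (hS : IsQuantumLInfty ωi S) {f : Formal 𝕜 p} (hf : f ∈ FunPos 𝕜 p) :
    perturbedProj Qi (delta₂ ωi S) f ∈ FunPos 𝕜 (degH p) := by
  obtain ⟨h1, h2⟩ := mem_funPos_iff.1 hf
  exact mem_funPos_iff.2 ⟨perturbedProj_mem_fil (iterate_mem_fil
    (h.coeff_delta₂_homotopy_of_mem (coeff_int_mem hS.degree_zero) hS.hbar_int_mem_fil) h1),
    perturbedProj_coeff_mem_genusIn
      (h.delta₂_coeff_mem_genusIn hS fun _ _ _ _ => Set.mem_univ _) h2⟩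

theorem IsHodgeMatrices.hbar_effAction_mem_funPos [CharZero 𝕜] (h : IsHodgeMatrices p ωi Qi)
    {S : Formal 𝕜 p} (hS : IsQuantumLInfty ωi S) :
    hbar 𝕜 (degH p) (-1) * effAction ωi Qi S ∈ FunPos 𝕜 (degH p) := by
  rw [(h.formalExp_hbar_effAction hS.hbar_int_mem_fil).1]
  refine mem_funPos_iff.2
    ⟨formalLog_mem_fil (h.perturbedProj_expInt_sub_one_mem hS.hbar_int_mem_fil),
      formalLog_coeff_mem_genusIn (perturbedProj_coeff_mem_genusIn
        (h.delta₁_coeff_mem_genusIn fun _ _ => Set.mem_univ _)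
        (formalExp_coeff_mem (one_mem_genusIn (Set.mem_univ 0))
          (fun u v x hx y hy => mul_mem_genusIn_univ u v x hx y hy) fun w => ?_))⟩
  refine degIn_mono ?_ (hS.coeff_hbar_int_mem_genusIn w)
  rintro n ⟨g, hg, -⟩
  exact ⟨g, hg, trivial⟩

end PerturbationParts

end BV

end

/-! ### The main theorem. -/

theorem mainTheorem3 {𝕜 : Type*} [RCLike 𝕜] {V : Type*} [AddCommGroup V] [Module 𝕜 V]
    (𝒱 : ℤ → Submodule 𝕜 V) (h𝒱 : DirectSum.IsInternal 𝒱)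
    (hfin : ∀ k, FiniteDimensional 𝕜 (𝒱 k))
    (ω : V →ₗ[𝕜] V →ₗ[𝕜] 𝕜) (Q : V →ₗ[𝕜] V) (hV : BV.IsDGSymplectic 𝒱 ω Q)
    (H C : Submodule 𝕜 V) (hHodge : BV.IsHodgeDecomposition ω Q H C)
    {ιH ιB ιC : Type*} (a : Module.Basis ιH 𝕜 H) (b : Module.Basis ιB 𝕜 (LinearMap.range Q))
    (c : Module.Basis ιC 𝕜 C)
    (e : ιH ⊕ ιB ⊕ ιC → V) (he : e = BV.assemble a b c)
    (d : ιH ⊕ ιB ⊕ ιC → ℤ) (hd : ∀ i, e i ∈ 𝒱 (d i))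
    (p : ιH ⊕ ιB ⊕ ιC → ℤ) (hp : ∀ i, p i = -d i)
    (ωi : ιH ⊕ ιB ⊕ ιC → ιH ⊕ ιB ⊕ ιC → 𝕜) (hωi : ωi = BV.invMatrix (fun i j => ω (e i) (e j)))
    (Qi : ιB → ιC → 𝕜) (hQi : Qi = BV.invMatrix (BV.matrixQ Q b c))
    (S : BV.Formal 𝕜 p) (hS : BV.IsQuantumLInfty ωi S) (hSQ : BV.IsLinearOperation ω Q e S)
    (W : BV.Formal 𝕜 (fun i : ιH => p (Sum.inl i))) (hW : W = BV.effAction ωi Qi S) :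
    (BV.hbar 𝕜 _ (-1) * W ∈ BV.FunPos 𝕜 (fun i : ιH => p (Sum.inl i)) ∧
      BV.formalExp (BV.hbar 𝕜 _ (-1) * W) =
        BV.perturbedProj Qi (BV.delta₁ ωi) (BV.expInt S)) ∧
    (∀ f ∈ BV.Fun 𝕜 p ∪ BV.FunPos 𝕜 p,
      BV.Summable (BV.perturbTerms Qi (BV.delta₁ ωi) (f * BV.expInt S)) ∧
      BV.Summable (BV.perturbTerms Qi (BV.delta₂ ωi S) f) ∧
      BV.pathIntegral ωi Qi S f = BV.perturbedProj Qi (BV.delta₂ ωi S) f) ∧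
    (∀ f ∈ BV.FunPos 𝕜 p,
      BV.pathIntegral ωi Qi S f ∈ BV.FunPos 𝕜 (fun i : ιH => p (Sum.inl i))) ∧
    (∀ f ∈ BV.Fun 𝕜 p,
      BV.pathIntegral ωi Qi S f ∈ BV.Fun 𝕜 (fun i : ιH => p (Sum.inl i))) := by
  subst he hωi hQi hW
  have h := BV.isHodgeMatrices h𝒱 hfin hV hHodge hd hp
  have hdeg := BV.coeff_int_mem hS.degree_zero
  refine ⟨⟨h.hbar_effAction_mem_funPos hS,
      (h.formalExp_hbar_effAction hS.hbar_int_mem_fil).2⟩,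
    fun f _ => ⟨h.summable_delta₁ _, h.summable_delta₂ hdeg hS.hbar_int_mem_fil f,
      h.pathIntegral_eq hdeg hS.hbar_int_mem_fil f⟩, fun f hf => ?_, fun f hf => ?_⟩
  · rw [h.pathIntegral_eq hdeg hS.hbar_int_mem_fil]
    exact h.perturbedProj_mem_funPos hS hf
  · rw [h.pathIntegral_eq hdeg hS.hbar_int_mem_fil]
    exact h.perturbedProj_mem_fun hS hf
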